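/- All graphs are finite. **The Borisov–Manin category $\mathbf{BM}$.** An object is a quadruple $\tau=(V_\tau,F_\tau,\partial_\tau,j_\tau)$ with finite sets $V_\tau$ (vertices) and $F_\tau$ (flags), a map $\partial_\tau:F_\tau\to V_\tau$ and an involution $j_\tau$ of $F_\tau$; fixpoints of $j_\tau$ are tails, two-element orbits are edges. A morphism $h:\tau\to\sigma$ is a triple $(h^F,h_V,j_h)$ of an injection $h^F:F_\sigma\to F_\tau$, a surjection $h_V:V_\tau\to V_\sigma$ and a fixpoint-free involution $j_h$ of $F_\tau\setminus h^F(F_\sigma)$, such that: $h^F(F_\sigma)$ and its complement are $j_\tau$-invariant; $j_h$ agrees with $j_\tau$ on edges; $h_V(\partial_\tau h^F(f))=\partial_\sigma f$ for $f\in F_\sigma$; $h_V\partial_\tau f=h_V\partial_\tau j_h(f)$ for $f\notin h^F(F_\sigma)$; and $(h^F)^{-1}$ maps edges of $\tau$ contained in $h^F(F_\sigma)$ to edges of $\sigma$. Composition is composition of the maps $h_V$ and of the maps $h^F$; for $\tau\xrightarrow{g}\sigma\xrightarrow{c}\rho$ the involution $j_{c\circ g}$ is $j_g$ on $F_\tau\setminus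 g^F(F_\sigma)$ and $j_c$ (transported along $g^F$) on $g^F(F_\sigma\setminus c^F(F_\rho))$. A morphism $h$ is a grafting if $h_V$ and $h^F$ are bijective, and a compression if $h^F$ restricts to a bijection between the sets of tails. **Graphs and etale morphisms.** The category $\mathbf{Gr}$ has as objects the diagrams of finite sets $A\xleftarrow{s}H\xrightarrow{p}V$ with $s$ injective, together with a fixpoint-free involution $i$ on $A$ (arcs; its orbits are the edges), and as morphisms the commutative diagrams compatible with $i$ whose square over $p$ is a pullback. A port is an arc outside $s(H)$; an edge is isolated if both its arcs are ports; an edge is inner if neither is; a graph is effective if it is nonempty and has no isolated edges. An etale morphism is a cover if it is surjective on edges and vertices; a cover is reduced if its domain cannot be replaced by a proper open subgraph (for graphs without isolated edges: if it is bijective on vertices). **The restricted Kleisli category $\widetilde{\mathbf{Gr}}$.** Let $\mathbf{elGr}\subset\mathbf{Gr}$ be the category of elementary graphs, i.e. the unit graph $I$ (one edge, no vertex) and the corollas $\mathbf n$ (one vertex, with a finite set $n$ of ports). On presheaves on $\mathbf{elGr}$ there is the monad $F\mapsto\overline F$ with $\overline F[I]=F[I]$ and $\overline F[\mathbf n]$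 the set of isomorphism classes of effective graphs $G$ equipped with a bijection of $n$ with the ports of $G$ and a morphism $\mathrm{Hom}(-,G)\to F$; the unit interprets an $F$-corolla as an $F$-graph, and the multiplication substitutes graphs into vertices (a colimit in $\mathbf{Gr}$ indexed by the elements of the outer graph). $\widetilde{\mathbf{Gr}}$ is the full subcategory of the Kleisli category of this monad on the graphs without isolated edges (embedded in presheaves by $X\mapsto\mathrm{Hom}(-,X)$). Reduced covers are regarded as (free) morphisms in $\widetilde{\mathbf{Gr}}$. A morphism $R\to Y$ of $\widetilde{\mathbf{Gr}}$ is given by an effective graph over $Y$ for each vertex of $R$; it is generic (a refinement) if the graph $S$ obtained by gluing these graphs together in the same way as the corollas of $R$ are glued to give $R$ maps isomorphically to $Y$. **The category $\mathbf{Cosp}$.** Its objects are the graphs without isolated edges; a morphism from $T$ to $R$ is an isomorphism class of cospans $T\to S\leftarrow R$ in $\widetilde{\mathbf{Gr}}$ whose first leg is a reduced cover and whose second leg is generic; composition is by pushout in $\widetilde{\mathbf{Gr}}$ (reduced covers and generic morphisms admit pushouts along each other, and the resulting morphisms are again a reduced cover and a generic morphism). **Theorem.** There is an equivalence of categories $\Phi:\mathbf{BM}\to\mathbf{Cosp}$.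 On objects, $\Phi$ sends $\tau$ to the graph $T$ with vertices $V_\tau$, flags $F_\tau$, arcs $F_\tau$ together with one port for each tail, $p=\partial_\tau$, $s$ the inclusion, and $i$ given by $j_\tau$ on flags that are not tails and exchanging each tail with its port. On morphisms: every $h:\tau\to\rho$ in $\mathbf{BM}$ factors as a grafting $g:\tau\to\sigma$ followed by a compression $c:\sigma\to\rho$, and for every such factorisation $\Phi(h)$ is the class of the cospan $T\to S\leftarrow R$ with $T,S,R$ the graphs of $\tau,\sigma,\rho$, in which $T\to S$ is the reduced cover corresponding to $g$ (equal to $g_V$ on vertices and to $(g^F)^{-1}$ on flags) and $R\to S$ is the generic morphism corresponding to $c$ (the vertices of the graph substituted into a vertex $x$ of $R$ are the elements of $c_V^{-1}(x)$, and the induced map on flags from $R$ to $S$ is $c^F$). -/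

import Mathlib

open CategoryTheory Opposite

/-! ## Graphs and etale morphisms -/

/-- A graph: finite sets of arcs `A`, half-edges (flags) `H` and vertices `V`, a fixpoint-free
involution `i` on arcs, an injection `s : H → A` and a map `p : H → V`. -/
structure JKGraph : Type 1 where
  A : Type
  H : Type
  V : Type
  finA : Finite A
  finH : Finite H
  finV : Finite V
  i : A → A
  s : H → A
  p : H → V
  s_inj : Function.Injective s
  i_i : ∀ a, i (i a) = a
  i_ne : ∀ a, i a ≠ a

namespace JKGraph

/-- Etale morphisms: commutative diagrams whose right-hand square is a pullback. -/
@[ext]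
structure Hom (X Y : JKGraph) where
  fA : X.A → Y.A
  fH : X.H → Y.H
  fV : X.V → Y.V
  map_i : ∀ a, fA (X.i a) = Y.i (fA a)
  map_s : ∀ h, fA (X.s h) = Y.s (fH h)
  map_p : ∀ h, fV (X.p h) = Y.p (fH h)
  etale : ∀ (v : X.V) (h : Y.H), Y.p h = fV v → ∃! h' : X.H, X.p h' = v ∧ fH h' = h

instance : Category JKGraph where
  Hom := Hom
  id X :=
    { fA := id
      fH := id
      fV := id
      map_i := fun _ => rfl
      map_s := fun _ => rfl
      map_p := fun _ => rfl
      etale := fun v h e => ⟨h, ⟨e, rfl⟩, fun _ hy => hy.2⟩ }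
  comp f g :=
    { fA := fun a => g.fA (f.fA a)
      fH := fun h => g.fH (f.fH h)
      fV := fun v => g.fV (f.fV v)
      map_i := fun a => by rw [f.map_i, g.map_i]
      map_s := fun a => by rw [f.map_s, g.map_s]
      map_p := fun a => by rw [f.map_p, g.map_p]
      etale := fun v h e => by
        obtain ⟨h1, ⟨e1, e2⟩, u1⟩ := g.etale _ h e
        obtain ⟨h2, ⟨e3, e4⟩, u2⟩ := f.etale v h1 e1
        refine ⟨h2, ⟨e3, ?_⟩, ?_⟩
        · rw [e4, e2]
        · rintro y ⟨y1, y2⟩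
          exact u2 y ⟨y1, u1 _ ⟨by rw [← f.map_p, y1], y2⟩⟩ }

@[ext] lemma hom_ext {X Y : JKGraph} {f g : X ⟶ Y} (hA : f.fA = g.fA) (hH : f.fH = g.fH)
    (hV : f.fV = g.fV) : f = g := Hom.ext hA hH hV

@[simp] lemma id_fA (X : JKGraph) (a : X.A) : Hom.fA (𝟙 X) a = a := rfl
@[simp] lemma id_fH (X : JKGraph) (a : X.H) : Hom.fH (𝟙 X) a = a := rfl
@[simp] lemma id_fV (X : JKGraph) (a : X.V) : Hom.fV (𝟙 X) a = a := rfl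
@[simp] lemma comp_fA {X Y Z : JKGraph} (f : X ⟶ Y) (g : Y ⟶ Z) (a : X.A) :
    (f ≫ g).fA a = g.fA (f.fA a) := rfl
@[simp] lemma comp_fH {X Y Z : JKGraph} (f : X ⟶ Y) (g : Y ⟶ Z) (a : X.H) :
    (f ≫ g).fH a = g.fH (f.fH a) := rfl
@[simp] lemma comp_fV {X Y Z : JKGraph} (f : X ⟶ Y) (g : Y ⟶ Z) (a : X.V) :
    (f ≫ g).fV a = g.fV (f.fV a) := rfl

/-- The flags at a vertex. -/
abbrev Flags (X : JKGraph) (v : X.V) : Type := {h : X.H // X.p h = v}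

instance (X : JKGraph) (v : X.V) : Finite (X.Flags v) :=
  have := X.finH
  inferInstanceAs (Finite {h : X.H // X.p h = v})

/-- A port is an arc which is not in the image of `s`. -/
def IsPort (X : JKGraph) (a : X.A) : Prop := ∀ h, X.s h ≠ a

/-- An edge is isolated if neither of its arcs is in the image of `s`. -/
def NoIsolatedEdges (X : JKGraph) : Prop := ∀ a, ¬ (X.IsPort a ∧ X.IsPort (X.i a))

/-- A graph is effective if it is nonempty and has no isolated edges. -/
def Effective (X : JKGraph) : Prop := (Nonempty X.V ∨ Nonempty X.A) ∧ X.NoIsolatedEdges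

/-- Open subgraph inclusions: levelwise injective etale morphisms. -/
def IsOpenInclusion {X Y : JKGraph} (f : X ⟶ Y) : Prop :=
  Function.Injective f.fA ∧ Function.Injective f.fH ∧ Function.Injective f.fV

/-- Covers: etale morphisms that are surjective on edges and vertices.  (As etale morphisms
commute with the involutions, surjectivity on edges is the same as surjectivity on arcs.) -/
def IsCover {X Y : JKGraph} (f : X ⟶ Y) : Prop :=
  Function.Surjective f.fA ∧ Function.Surjective f.fV

/-- A cover is reduced if the domain cannot be replaced by a proper open subgraph. -/
def IsReducedCover {X Y : JKGraph} (f : X ⟶ Y) : Prop :=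
  IsCover f ∧ ∀ (Z : JKGraph) (j : Z ⟶ X), IsOpenInclusion j → IsCover (j ≫ f) → IsIso j

lemma IsPort.of_not {X : JKGraph} {a : X.A} (h : ¬ X.IsPort a) : ∃ f, X.s f = a := by
  simpa [IsPort] using h

lemma not_isPort_s (X : JKGraph) (h : X.H) : ¬ X.IsPort (X.s h) := fun H => H h rfl

/-- Bijective etale morphisms are invertible. -/
lemma isIso_of_bijective {X Y : JKGraph} (f : X ⟶ Y) (hA : Function.Bijective f.fA)
    (hV : Function.Bijective f.fV) : IsIso f := by
  have hH : Function.Bijective f.fH := by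
    constructor
    · intro a b e
      apply X.s_inj
      apply hA.1
      rw [f.map_s, f.map_s, e]
    · intro h
      obtain ⟨v, hv⟩ := hV.2 (Y.p h)
      obtain ⟨h', ⟨_, e⟩, _⟩ := f.etale v h hv.symm
      exact ⟨h', e⟩
  let eA := Equiv.ofBijective _ hA
  let eH := Equiv.ofBijective _ hH
  let eV := Equiv.ofBijective _ hV
  have kA : ∀ a, f.fA (eA.symm a) = a := fun a => eA.apply_symm_apply a
  have kH : ∀ a, f.fH (eH.symm a) = a := fun a => eH.apply_symm_apply a
  have kV : ∀ a, f.fV (eV.symm a) = a := fun a => eV.apply_symm_apply a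
  let g : Y ⟶ X :=
    { fA := eA.symm
      fH := eH.symm
      fV := eV.symm
      map_i := fun a => hA.1 (by rw [f.map_i, kA, kA])
      map_s := fun a => hA.1 (by rw [f.map_s, kA, kH])
      map_p := fun a => hV.1 (by rw [f.map_p, kV, kH])
      etale := fun v h e => by
        refine ⟨f.fH h, ⟨?_, eH.symm_apply_apply h⟩, ?_⟩
        · rw [← f.map_p, e, kV]
        · rintro y ⟨_, hy⟩
          rw [← hy, kH] }
  refine ⟨g, ?_, ?_⟩
  · apply hom_ext <;> funext x
    · exact eA.symm_apply_apply x
    · exact eH.symm_apply_apply x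
    · exact eV.symm_apply_apply x
  · apply hom_ext <;> funext x
    · exact kA x
    · exact kH x
    · exact kV x

lemma iso_hom_inv_fA {X Y : JKGraph} (θ : X ≅ Y) (a : X.A) : θ.inv.fA (θ.hom.fA a) = a := by
  rw [← comp_fA, θ.hom_inv_id, id_fA]
lemma iso_inv_hom_fA {X Y : JKGraph} (θ : X ≅ Y) (a : Y.A) : θ.hom.fA (θ.inv.fA a) = a := by
  rw [← comp_fA, θ.inv_hom_id, id_fA]
lemma iso_hom_inv_fV {X Y : JKGraph} (θ : X ≅ Y) (a : X.V) : θ.inv.fV (θ.hom.fV a) = a := by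
  rw [← comp_fV, θ.hom_inv_id, id_fV]
lemma iso_inv_hom_fV {X Y : JKGraph} (θ : X ≅ Y) (a : Y.V) : θ.hom.fV (θ.inv.fV a) = a := by
  rw [← comp_fV, θ.inv_hom_id, id_fV]

lemma bijective_fA {X Y : JKGraph} (θ : X ≅ Y) : Function.Bijective θ.hom.fA :=
  ⟨fun a b e => by rw [← iso_hom_inv_fA θ a, e, iso_hom_inv_fA],
    fun b => ⟨_, iso_inv_hom_fA θ b⟩⟩
lemma bijective_fV {X Y : JKGraph} (θ : X ≅ Y) : Function.Bijective θ.hom.fV :=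
  ⟨fun a b e => by rw [← iso_hom_inv_fV θ a, e, iso_hom_inv_fV],
    fun b => ⟨_, iso_inv_hom_fV θ b⟩⟩

lemma isPort_of_map {X Y : JKGraph} (f : X ⟶ Y) {a : X.A} (h : Y.IsPort (f.fA a)) :
    X.IsPort a := fun k e => h (f.fH k) (by rw [← f.map_s, e])

lemma isPort_iso {X Y : JKGraph} (θ : X ≅ Y) {a : X.A} : Y.IsPort (θ.hom.fA a) ↔ X.IsPort a :=
  ⟨isPort_of_map _, fun h => isPort_of_map θ.inv (by rwa [iso_hom_inv_fA])⟩

/-- In the absence of isolated edges, reduced covers are the covers bijective on vertices. -/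
lemma isReducedCover_iff {X Y : JKGraph} (hX : X.NoIsolatedEdges) (f : X ⟶ Y) :
    IsReducedCover f ↔ Function.Surjective f.fA ∧ Function.Bijective f.fV := by
  constructor
  · rintro ⟨⟨hA, hV⟩, hr⟩
    refine ⟨hA, ?_, hV⟩
    intro v w hvw
    by_contra hne
    let Z : JKGraph :=
      { A := X.A
        H := {h : X.H // X.p h ≠ v}
        V := {x : X.V // x ≠ v}
        finA := X.finA
        finH := have := X.finH; inferInstance
        finV := have := X.finV; inferInstance
        i := X.i
        s := fun h => X.s h.1
        p := fun h => ⟨X.p h.1, h.2⟩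
        s_inj := fun a b e => Subtype.ext (X.s_inj e)
        i_i := X.i_i
        i_ne := X.i_ne }
    let j : Z ⟶ X :=
      { fA := id
        fH := Subtype.val
        fV := Subtype.val
        map_i := fun _ => rfl
        map_s := fun _ => rfl
        map_p := fun _ => rfl
        etale := fun x h e => ⟨⟨h, by rw [e]; exact x.2⟩, ⟨Subtype.ext e, rfl⟩,
          fun y hy => Subtype.ext hy.2⟩ }
    have hj := hr Z j ⟨fun _ _ e => e, Subtype.val_injective, Subtype.val_injective⟩
      ⟨hA, fun y => by
        obtain ⟨x, rfl⟩ := hV y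
        by_cases hx : x = v
        · exact ⟨⟨w, fun e => hne e.symm⟩, by subst hx; exact hvw.symm⟩
        · exact ⟨⟨x, hx⟩, rfl⟩⟩
    obtain ⟨z, hz⟩ := (bijective_fV (asIso j)).2 v
    exact z.2 hz
  · rintro ⟨hA, hV⟩
    refine ⟨⟨hA, hV.2⟩, fun Z j hj hc => ?_⟩
    have hjV : Function.Bijective j.fV := by
      refine ⟨hj.2.2, fun x => ?_⟩
      obtain ⟨z, hz⟩ := hc.2 (f.fV x)
      exact ⟨z, hV.1 hz⟩
    have hs : ∀ h, ∃ z, j.fA z = X.s h := fun h => by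
      obtain ⟨z, hz⟩ := hjV.2 (X.p h)
      obtain ⟨h', ⟨_, e⟩, _⟩ := j.etale z h hz.symm
      exact ⟨Z.s h', by rw [j.map_s, e]⟩
    refine isIso_of_bijective j ⟨hj.1, fun a => ?_⟩ hjV
    by_cases ha : X.IsPort a
    · obtain ⟨h, hh⟩ := IsPort.of_not fun hb => hX a ⟨ha, hb⟩
      obtain ⟨z, hz⟩ := hs h
      exact ⟨Z.i z, by rw [j.map_i, hz, hh, X.i_i]⟩
    · obtain ⟨h, rfl⟩ := IsPort.of_not ha
      exact hs h

lemma Effective.nonempty_V {X : JKGraph} (h : X.Effective) : Nonempty X.V := by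
  obtain ⟨h1 | ⟨⟨a⟩⟩, h2⟩ := h
  · exact h1
  · by_cases ha : X.IsPort a
    · obtain ⟨k, _⟩ := IsPort.of_not fun hb => h2 a ⟨ha, hb⟩
      exact ⟨X.p k⟩
    · obtain ⟨k, _⟩ := IsPort.of_not ha
      exact ⟨X.p k⟩

end JKGraph

/-! ## Elementary graphs and graphical species -/

/-- The elementary graphs (connected graphs without inner edges), up to isomorphism: the unit
graph, and the corollas on finite sets. -/
inductive El : Type 1
  | unit : El
  | corolla (n : Type) (fin : Finite n) : El

namespace El

/-- The unit graph: one edge and no vertices. -/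
abbrev unitGraph : JKGraph where
  A := Bool
  H := Empty
  V := Empty
  finA := inferInstance
  finH := inferInstance
  finV := inferInstance
  i := not
  s := Empty.elim
  p := Empty.elim
  s_inj := fun x => x.elim
  i_i := Bool.not_not
  i_ne := by decide

/-- The corolla on a finite set `n`.  Its ports are the arcs `Sum.inl k`. -/
abbrev corollaGraph (n : Type) (fin : Finite n) : JKGraph where
  A := n ⊕ n
  H := n
  V := Unit
  finA := inferInstance
  finH := fin
  finV := inferInstance
  i := Sum.swap
  s := Sum.inr
  p := fun _ => ()
  s_inj := Sum.inr_injective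
  i_i := Sum.swap_swap
  i_ne := by rintro (a | a) <;> simp

/-- The graph underlying an elementary graph. -/
abbrev graph : El → JKGraph
  | unit => unitGraph
  | corolla n fin => corollaGraph n fin

/-- The category of elementary graphs: all etale morphisms between them. -/
instance : Category El where
  Hom E E' := E.graph ⟶ E'.graph
  id E := 𝟙 E.graph
  comp f g := f ≫ g

/-- A morphism of elementary graphs, viewed as a morphism of graphs. -/
def toGraph {E E' : El} (f : E ⟶ E') : E.graph ⟶ E'.graph := f

@[simp] lemma toGraph_id (E : El) : toGraph (𝟙 E) = 𝟙 E.graph := rfl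
@[simp] lemma toGraph_comp {E E' E'' : El} (f : E ⟶ E') (g : E' ⟶ E'') :
    toGraph (f ≫ g) = toGraph f ≫ toGraph g := rfl

end El

/-- Graphical species: presheaves on the category of elementary graphs. -/
abbrev Species := Elᵒᵖ ⥤ Type 1

namespace JKGraph

open El

/-- The morphism from the unit graph determined by an arc. -/
def arc {X : JKGraph} (a : X.A) : unitGraph ⟶ X where
  fA b := cond b a (X.i a)
  fH := Empty.elim
  fV := Empty.elim
  map_i b := by
    rcases b with _ | _
    · exact (X.i_i a).symm
    · rfl
  map_s h := h.elim
  map_p h := h.elim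
  etale v := v.elim

lemma unit_hom_ext {X : JKGraph} {f g : unitGraph ⟶ X} (h : f.fA true = g.fA true) : f = g := by
  apply hom_ext
  · funext b
    rcases b with _ | _
    · have h1 := f.map_i true
      have h2 := g.map_i true
      rw [h, ← h2] at h1
      exact h1
    · exact h
  · funext x; exact x.elim
  · funext x; exact x.elim

@[simp] lemma arc_true {X : JKGraph} (a : X.A) : (arc a).fA true = a := rfl

lemma arc_eq {X : JKGraph} (f : unitGraph ⟶ X) : arc (f.fA true) = f := unit_hom_ext rfl

lemma arc_comp {X Y : JKGraph} (a : X.A) (f : X ⟶ Y) : arc a ≫ f = arc (f.fA a) :=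
  unit_hom_ext rfl

/-- The corolla at a vertex. -/
def star {X : JKGraph} (v : X.V) : corollaGraph (X.Flags v) inferInstance ⟶ X where
  fA := Sum.elim (fun k => X.i (X.s k.1)) (fun k => X.s k.1)
  fH := fun k => k.1
  fV := fun _ => v
  map_i := by
    rintro (k | k)
    · exact (X.i_i _).symm
    · rfl
  map_s _ := rfl
  map_p k := k.2.symm
  etale _ h e := ⟨⟨h, e⟩, ⟨rfl, rfl⟩, fun _ hy => Subtype.ext hy.2⟩

/-- Etale morphisms between corollas and arbitrary graphs lift along etale morphisms. -/
lemma exists_lift {n : Type} {hn : Finite n} {X Y : JKGraph} (ι : X ⟶ Y)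
    (g : corollaGraph n hn ⟶ Y) (v : X.V) (hv : ι.fV v = g.fV ()) :
    ∃ f : corollaGraph n hn ⟶ X, f ≫ ι = g ∧ f.fV () = v := by
  have key : ∀ k : n, ∃ h : X.H, X.p h = v ∧ ι.fH h = g.fH k := fun k => by
    obtain ⟨h, hh, _⟩ := ι.etale v (g.fH k) (by rw [hv]; exact (g.map_p k).symm)
    exact ⟨h, hh⟩
  choose l hl1 hl2 using key
  refine ⟨{ fA := Sum.elim (fun k => X.i (X.s (l k))) (fun k => X.s (l k))
            fH := l
            fV := fun _ => v
            map_i := ?_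
            map_s := fun _ => rfl
            map_p := fun k => (hl1 k).symm
            etale := ?_ }, ?_, rfl⟩
  · rintro (k | k)
    · exact (X.i_i _).symm
    · rfl
  · intro u h e
    obtain ⟨k, ⟨_, hk⟩, uk⟩ := g.etale () (ι.fH h) (by rw [← ι.map_p, e, hv])
    refine ⟨k, ⟨rfl, ?_⟩, fun k' hk' => uk k' ⟨rfl, ?_⟩⟩
    · obtain ⟨h0, _, hu⟩ := ι.etale v (ι.fH h) (by rw [← ι.map_p, e])
      rw [hu (l k) ⟨hl1 k, by rw [hl2, hk]⟩, hu h ⟨e, rfl⟩]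
    · rw [← hk'.2, hl2]
  · apply hom_ext
    · funext a
      rcases a with k | k
      · change ι.fA (X.i (X.s (l k))) = g.fA (Sum.swap (Sum.inr k))
        rw [ι.map_i, ι.map_s, hl2, ← g.map_s k]
        exact (g.map_i (Sum.inr k)).symm
      · change ι.fA (X.s (l k)) = g.fA (Sum.inr k)
        rw [ι.map_s, hl2, ← g.map_s k]
    · funext k; exact hl2 k
    · funext x; exact hv

lemma corolla_hom_ext {n : Type} {hn : Finite n} {X Y : JKGraph} (ι : X ⟶ Y)
    {f g : corollaGraph n hn ⟶ X} (h : f ≫ ι = g ≫ ι) (hv : f.fV () = g.fV ()) : f = g := by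
  have hH : ∀ k : n, f.fH k = g.fH k := fun k => by
    have hp : Y.p (ι.fH (f.fH k)) = ι.fV (f.fV ()) := by
      rw [← ι.map_p, ← f.map_p]
    obtain ⟨h0, _, hu⟩ := ι.etale (f.fV ()) (ι.fH (f.fH k)) hp
    rw [hu (f.fH k) ⟨(f.map_p k).symm, rfl⟩, hu (g.fH k) ⟨?_, ?_⟩]
    · rw [hv]; exact (g.map_p k).symm
    · rw [← comp_fH, ← comp_fH, h]
  have hr : ∀ k : n, f.fA (Sum.inr k) = g.fA (Sum.inr k) := fun k => by
    have h1 := f.map_s k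
    have h2 := g.map_s k
    rw [hH k, ← h2] at h1
    exact h1
  apply hom_ext
  · funext a
    rcases a with k | k
    · have h1 := f.map_i (Sum.inr k)
      have h2 := g.map_i (Sum.inr k)
      rw [hr k, ← h2] at h1
      exact h1
    · exact hr k
  · funext k; exact hH k
  · funext x; exact hv

/-- The embedding of graphs in graphical species: a graph represents the species of etale
morphisms from elementary graphs. -/
def nerve : JKGraph ⥤ Species where
  obj X :=
    { obj := fun E => ULift.{1} (E.unop.graph ⟶ X)
      map := fun f => ↾fun g => ⟨toGraph f.unop ≫ g.down⟩ }
  map α :=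
    { app := fun E => ↾fun g => ⟨g.down ≫ α⟩ }

end JKGraph

/-- Restriction of elements of a graphical species. -/
def pull (F : Species) {E E' : El} (t : E ⟶ E') (x : F.obj (op E')) : F.obj (op E) := F.map t.op x

/-- Evaluation of a morphism of species on an element. -/
def ev {F G : Species} (α : F ⟶ G) {E : El} (x : F.obj (op E)) : G.obj (op E) := α.app (op E) x

/-- The value of an `F`-decoration of the graph `X` at an element of `X`. -/
def at' {X : JKGraph} {F : Species} (φ : JKGraph.nerve.obj X ⟶ F) {E : El} (f : E.graph ⟶ X) :
    F.obj (op E) := ev φ (ULift.up f : (JKGraph.nerve.obj X).obj (op E))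

/-- The colour of an arc in an `F`-decorated graph. -/
abbrev col {X : JKGraph} {F : Species} (φ : JKGraph.nerve.obj X ⟶ F) (a : X.A) :
    F.obj (op El.unit) := at' (E := El.unit) φ (JKGraph.arc a)

section api
variable {F G K : Species} {X Y : JKGraph} {E E' E'' : El}
open JKGraph

@[simp] lemma pull_id (x : F.obj (op E)) : pull F (𝟙 E) x = x := by simp [pull]
lemma pull_comp (s : E ⟶ E') (t : E' ⟶ E'') (x : F.obj (op E'')) :
    pull F (s ≫ t) x = pull F s (pull F t x) := by simp [pull]
lemma ev_pull (α : F ⟶ G) (t : E ⟶ E') (x : F.obj (op E')) :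
    ev α (pull F t x) = pull G t (ev α x) := NatTrans.naturality_apply α t.op x
@[simp] lemma ev_comp (α : F ⟶ G) (β : G ⟶ K) (x : F.obj (op E)) :
    ev (α ≫ β) x = ev β (ev α x) := rfl
@[simp] lemma ev_id (x : F.obj (op E)) : ev (𝟙 F) x = x := rfl
lemma ev_ext {α β : F ⟶ G} (h : ∀ E (x : F.obj (op E)), ev α x = ev β x) : α = β := by
  ext E x
  exact h E.unop x
/-- A morphism of species from its components. -/
def mkHom (a : ∀ E : El, F.obj (op E) → G.obj (op E))
    (h : ∀ (E E' : El) (t : E ⟶ E') x, a E (pull F t x) = pull G t (a E' x)) : F ⟶ G where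
  app E := ↾(a E.unop)
  naturality E E' f := by
    ext x
    exact h _ _ f.unop x
@[simp] lemma ev_mkHom (a : ∀ E : El, F.obj (op E) → G.obj (op E)) (h) (x : F.obj (op E)) :
    ev (mkHom a h) x = a E x := rfl

lemma at_comp (φ : nerve.obj X ⟶ F) (t : E ⟶ E') (f : E'.graph ⟶ X) :
    at' φ (El.toGraph t ≫ f) = pull F t (at' φ f) :=
  ev_pull φ t (ULift.up f : (nerve.obj X).obj (op E'))
@[simp] lemma at_comp_right (φ : nerve.obj X ⟶ F) (α : F ⟶ G) (f : E.graph ⟶ X) :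
    at' (φ ≫ α) f = ev α (at' φ f) := rfl
@[simp] lemma at_nerve (g : X ⟶ Y) (φ : nerve.obj Y ⟶ F) (f : E.graph ⟶ X) :
    at' (nerve.map g ≫ φ) f = at' φ (f ≫ g) := rfl
lemma at_ext {φ ψ : nerve.obj X ⟶ F} (h : ∀ (E : El) (f : E.graph ⟶ X), at' φ f = at' ψ f) : φ = ψ :=
  ev_ext fun E x => h E x.down
/-- A decoration of a graph from its values. -/
def mkDec (a : ∀ E : El, (E.graph ⟶ X) → F.obj (op E))
    (h : ∀ (E E' : El) (t : E ⟶ E') f, a E (El.toGraph t ≫ f) = pull F t (a E' f)) :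
    nerve.obj X ⟶ F :=
  mkHom (fun E x => a E x.down) fun E E' t x => h E E' t x.down
@[simp] lemma at_mkDec (a : ∀ E : El, (E.graph ⟶ X) → F.obj (op E)) (h) (f : E.graph ⟶ X) :
    at' (mkDec a h) f = a E f := rfl

/-- The Yoneda correspondence. -/
def yo (x : F.obj (op E)) : nerve.obj E.graph ⟶ F :=
  mkDec (fun _ f => pull F (f : _ ⟶ E) x) fun _ _ t f => pull_comp t (f : _ ⟶ E) x
@[simp] lemma at_yo (x : F.obj (op E)) (f : E'.graph ⟶ E.graph) :
    at' (yo x) f = pull F (f : E' ⟶ E) x := rfl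
lemma eq_yo (φ : nerve.obj E.graph ⟶ F) : φ = yo (at' φ (𝟙 E.graph)) :=
  at_ext fun E' f => by
    rw [at_yo, ← at_comp]
    rfl
end api

namespace JKGraph
open El

/-- Flip of an arc colour. -/
def flipHom : El.unit ⟶ El.unit := arc (X := El.unit.graph) false

lemma unit_hom_cases (t : El.unit ⟶ El.unit) : t = 𝟙 _ ∨ t = flipHom := by
  have : ∀ b : Bool, (toGraph t).fA true = b → (t = 𝟙 _ ∨ t = flipHom) := by
    rintro (_ | _) hb
    · right; exact unit_hom_ext hb
    · left; exact unit_hom_ext hb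
  exact this _ rfl

lemma flip_arc {X : JKGraph} (a : X.A) : toGraph flipHom ≫ arc a = arc (X.i a) :=
  unit_hom_ext rfl

lemma at_i {X : JKGraph} {F : Species} (φ : nerve.obj X ⟶ F) (a : X.A) :
    col φ (X.i a) = pull F flipHom (col φ a) := by
  rw [col, ← flip_arc, at_comp]

/-- Uniqueness part of the sheaf property. -/
lemma cover_ext {I : Type} {X : I → JKGraph} {S : JKGraph} (ι : ∀ x, X x ⟶ S)
    (hV : ∀ v, ∃ x w, (ι x).fV w = v) (hA : ∀ a, ∃ x b, (ι x).fA b = a) {F : Species}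
    {φ ψ : nerve.obj S ⟶ F} (h : ∀ x, nerve.map (ι x) ≫ φ = nerve.map (ι x) ≫ ψ) : φ = ψ := by
  refine at_ext fun E f => ?_
  cases E with
  | unit =>
    obtain ⟨x, b, hb⟩ := hA (f.fA true)
    have : f = arc b ≫ ι x := unit_hom_ext (by simp [hb])
    rw [this, ← at_nerve, ← at_nerve, h]
  | corolla n hn =>
    obtain ⟨x, w, hw⟩ := hV (f.fV ())
    obtain ⟨g, hg, _⟩ := exists_lift (ι x) f w hw
    rw [← hg, ← at_nerve, ← at_nerve, h]

/-- Existence part of the sheaf property, for covers bijective on vertices. -/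
lemma exists_descent {I : Type} {X : I → JKGraph} {S : JKGraph} (ι : ∀ x, X x ⟶ S)
    (hV : Function.Bijective fun z : Σ x, (X x).V => (ι z.1).fV z.2)
    (hA : ∀ a, ∃ x b, (ι x).fA b = a) {F : Species} (φ : ∀ x, nerve.obj (X x) ⟶ F)
    (hφ : ∀ x y a b, (ι x).fA a = (ι y).fA b → col (φ x) a = col (φ y) b) :
    ∃ ψ : nerve.obj S ⟶ F, ∀ x, nerve.map (ι x) ≫ ψ = φ x := by
  choose ax ab hab using hA
  let vz : S.V → Σ x, (X x).V := fun v => (hV.2 v).choose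
  have hvz : ∀ v, (ι (vz v).1).fV (vz v).2 = v := fun v => (hV.2 v).choose_spec
  choose L hL1 hL2 using fun (n : Type) (hn : Finite n) (f : corollaGraph n hn ⟶ S) =>
    exists_lift (ι (vz (f.fV ())).1) f (vz (f.fV ())).2 (hvz _)
  let val : ∀ E : El, (E.graph ⟶ S) → F.obj (op E) := fun E =>
    match E with
    | unit => fun f => col (φ (ax (f.fA true))) (ab (f.fA true))
    | corolla n hn => fun f => at' (φ (vz (f.fV ())).1) (L n hn f)
  have hval : ∀ (E : El) x (g : E.graph ⟶ X x), val E (g ≫ ι x) = at' (φ x) g := by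
    intro E x g
    cases E with
    | unit =>
      conv_rhs => rw [← arc_eq g]
      exact hφ _ _ _ _ (hab _)
    | corolla n hn =>
      change at' (E := corolla n hn) (φ (vz ((g ≫ ι x).fV ())).1) (L n hn (g ≫ ι x)) = _
      have e1 := hL1 n hn (g ≫ ι x)
      have e2 := hL2 n hn (g ≫ ι x)
      have e3 : vz ((g ≫ ι x).fV ()) = ⟨x, g.fV ()⟩ := hV.1 (hvz _)
      generalize L n hn (g ≫ ι x) = l at *
      generalize vz ((g ≫ ι x).fV ()) = z at *
      subst e3
      rw [corolla_hom_ext (ι x) e1 e2]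
  have hfac : ∀ (E : El) (f : E.graph ⟶ S), ∃ x, ∃ g : E.graph ⟶ X x, g ≫ ι x = f := by
    intro E f
    cases E with
    | unit => exact ⟨_, arc (ab (f.fA true)), unit_hom_ext (hab _)⟩
    | corolla n hn => exact ⟨_, _, hL1 n hn f⟩
  refine ⟨mkDec val ?_, fun x => at_ext fun E g => ?_⟩
  · intro E E' t f
    obtain ⟨x, g, rfl⟩ := hfac E' f
    rw [← Category.assoc, hval, hval, at_comp]
  · rw [at_nerve, at_mkDec, hval]

lemma pull_unit {X : JKGraph} {F : Species} (φ : nerve.obj X ⟶ F) {E : El} (t : unit ⟶ E)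
    (f : E.graph ⟶ X) : pull F t (at' φ f) = col φ (f.fA ((toGraph t).fA true)) := by
  rw [← at_comp, col]
  congr 1
  exact unit_hom_ext rfl

lemma col_nerve {X Y : JKGraph} {F : Species} (g : X ⟶ Y) (φ : nerve.obj Y ⟶ F) (a : X.A) :
    col (nerve.map g ≫ φ) a = col φ (g.fA a) := by
  rw [col, at_nerve, arc_comp]

lemma at_nerve_map {X Y : JKGraph} (g : X ⟶ Y) {E : El} (f : E.graph ⟶ X) :
    at' (nerve.map g) f = ULift.up (f ≫ g) := rfl

lemma nerve_faithful {X Y : JKGraph} {f g : X ⟶ Y} (h : nerve.map f = nerve.map g) : f = g := by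
  have key : ∀ (E : El) (k : E.graph ⟶ X), k ≫ f = k ≫ g := fun E k => by
    have := congrArg (fun φ => at' φ k) h
    exact congrArg ULift.down this
  apply hom_ext <;> funext x
  · exact congrArg (fun k => k.fA true) (key unit (arc x))
  · exact congrArg (fun k => k.fH ⟨x, rfl⟩) (key (corolla _ _) (star (X.p x)))
  · exact congrArg (fun k => k.fV ()) (key (corolla _ _) (star x))

/-- The nerve functor is full. -/
lemma nerve_full {X Y : JKGraph} (φ : nerve.obj X ⟶ nerve.obj Y) :
    ∃ f : X ⟶ Y, nerve.map f = φ := by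
  let cc : ∀ v : X.V, corollaGraph (X.Flags v) inferInstance ⟶ Y := fun v =>
    (at' (E := corolla _ _) φ (star v)).down
  let ca : X.A → (unitGraph ⟶ Y) := fun a => (col φ a).down
  have hca : ∀ v (a : X.Flags v ⊕ X.Flags v), (cc v).fA a = (ca ((star v).fA a)).fA true := by
    intro v a
    have h1 := pull_unit φ (E := corolla (X.Flags v) inferInstance)
      (arc (X := corollaGraph (X.Flags v) inferInstance) a : _ ⟶ _) (star v)
    exact congrArg (fun k => k.down.fA true) h1
  have hi : ∀ a, (ca (X.i a)).fA true = Y.i ((ca a).fA true) := by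
    intro a
    have h1 := at_i φ a
    have h2 : (ca (X.i a)).fA true = (ca a).fA false := congrArg (fun k => k.down.fA true) h1
    rw [h2]
    exact (ca a).map_i true
  let f : X ⟶ Y :=
    { fA := fun a => (ca a).fA true
      fH := fun h => (cc (X.p h)).fH ⟨h, rfl⟩
      fV := fun v => (cc v).fV ()
      map_i := hi
      map_s := fun h => by
        have h1 := hca (X.p h) (Sum.inr ⟨h, rfl⟩)
        rw [← (cc (X.p h)).map_s ⟨h, rfl⟩]
        exact h1.symm
      map_p := fun h => (cc (X.p h)).map_p ⟨h, rfl⟩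
      etale := fun v h e => by
        obtain ⟨⟨k, rfl⟩, ⟨_, hk⟩, hu⟩ := (cc v).etale () h e
        refine ⟨k, ⟨rfl, hk⟩, ?_⟩
        rintro k' ⟨k1, k2⟩
        have : (⟨k', k1⟩ : X.Flags (X.p k)) = ⟨k, rfl⟩ := by
          apply hu
          refine ⟨rfl, ?_⟩
          rw [← k2]
          revert k1
          generalize X.p k = v
          rintro rfl
          rfl
        exact congrArg Subtype.val this }
  refine ⟨f, ?_⟩
  have hstar : ∀ v, star v ≫ f = cc v := by
    intro v
    apply hom_ext <;> funext k
    · exact (hca v k).symm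
    · obtain ⟨k, rfl⟩ := k
      rfl
    · rfl
  refine cover_ext (I := X.V ⊕ X.A)
    (X := Sum.elim (fun v => corollaGraph (X.Flags v) inferInstance) (fun _ => unitGraph))
    (fun x => match x with
      | Sum.inl v => star v
      | Sum.inr a => arc a) (fun v => ⟨Sum.inl v, (), rfl⟩) (fun a => ⟨Sum.inr a, true, rfl⟩) ?_
  rintro (v | a)
  · refine (eq_yo (E := corolla (X.Flags v) inferInstance) _).trans
      (Eq.trans ?_ (eq_yo (E := corolla (X.Flags v) inferInstance) _).symm)
    congr 1
    exact congrArg ULift.up (hstar v)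
  · refine (eq_yo (E := unit) _).trans (Eq.trans ?_ (eq_yo (E := unit) _).symm)
    congr 1
    refine congrArg ULift.up ?_
    exact unit_hom_ext rfl
end JKGraph

/-! ## The monad for compact coloured props -/

section

open JKGraph El

/-- An effective `n`-graph: an effective graph with a bijection from `n` to its set of ports. -/
structure NGraph (n : Type) : Type 1 where
  G : JKGraph
  eff : G.Effective
  b : n → G.A
  b_inj : Function.Injective b
  b_port : ∀ a, G.IsPort a ↔ ∃ k, b k = a

/-- An effective `n`-graph decorated by the species `F`. -/
structure DecGraph (F : Species) (n : Type) : Type 1 extends NGraph n where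
  φ : nerve.obj G ⟶ F

/-- The map from the arcs of the corolla to the arcs of an `n`-graph. -/
def NGraph.ext {n : Type} (X : NGraph n) : n ⊕ n → X.G.A :=
  Sum.elim X.b fun k => X.G.i (X.b k)

lemma NGraph.ext_swap {n : Type} (X : NGraph n) (a : n ⊕ n) :
    X.ext a.swap = X.G.i (X.ext a) := by
  rcases a with k | k
  · rfl
  · exact (X.G.i_i _).symm

/-- Relabelling of the ports of an `n`-graph along a bijection. -/
def NGraph.relabel {m n : Type} (X : NGraph n) (u : m → n) (hu : Function.Bijective u) :
    NGraph m where
  G := X.G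
  eff := X.eff
  b k := X.b (u k)
  b_inj := X.b_inj.comp hu.1
  b_port a := by
    rw [X.b_port]
    constructor
    · rintro ⟨k, hk⟩
      obtain ⟨l, rfl⟩ := hu.2 k
      exact ⟨l, hk⟩
    · rintro ⟨k, hk⟩
      exact ⟨_, hk⟩

namespace DecGraph

/-- Relabelling of the ports of a decorated `n`-graph along a bijection. -/
def relabel {F : Species} {m n : Type} (X : DecGraph F n) (u : m → n)
    (hu : Function.Bijective u) : DecGraph F m where
  toNGraph := X.toNGraph.relabel u hu
  φ := X.φ

/-- Change of decorations along a morphism of species. -/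
def mapDec {F G : Species} (α : F ⟶ G) {n : Type} (X : DecGraph F n) : DecGraph G n where
  toNGraph := X.toNGraph
  φ := X.φ ≫ α

/-- Isomorphism of decorated `n`-graphs (compatible with the port bijections). -/
instance setoid (F : Species) (n : Type) : Setoid (DecGraph F n) where
  r X Y := ∃ θ : X.G ≅ Y.G, (∀ k, θ.hom.fA (X.b k) = Y.b k) ∧ nerve.map θ.hom ≫ Y.φ = X.φ
  iseqv :=
    { refl := fun X => ⟨Iso.refl _, fun _ => rfl, by simp⟩
      symm := by
        rintro X Y ⟨θ, h1, h2⟩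
        refine ⟨θ.symm, fun k => ?_, ?_⟩
        · rw [← h1, Iso.symm_hom, iso_hom_inv_fA]
        · rw [← h2, ← Category.assoc, ← Functor.map_comp]
          simp
      trans := by
        rintro X Y Z ⟨θ, h1, h2⟩ ⟨θ', h3, h4⟩
        refine ⟨θ ≪≫ θ', fun k => ?_, ?_⟩
        · rw [← h3, ← h1]; rfl
        · rw [← h2, ← h4]; simp }

lemma rel_ext {F : Species} {n : Type} {X Y : DecGraph F n} (θ : X.G ≅ Y.G)
    (h : ∀ k, θ.hom.fA (X.b k) = Y.b k) (a : n ⊕ n) : θ.hom.fA (X.ext a) = Y.ext a := by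
  rcases a with k | k
  · exact h k
  · change θ.hom.fA (X.G.i (X.b k)) = Y.G.i (Y.b k)
    rw [θ.hom.map_i, h]

end DecGraph

lemma El.bijective_fH {m n : Type} {hm : Finite m} {hn : Finite n}
    (t : corollaGraph m hm ⟶ corollaGraph n hn) : Function.Bijective t.fH := by
  constructor
  · intro a b e
    obtain ⟨k, _, hk⟩ := t.etale () (t.fH a) rfl
    rw [hk a ⟨rfl, rfl⟩, hk b ⟨rfl, e.symm⟩]
  · intro k
    obtain ⟨l, ⟨_, hl⟩, _⟩ := t.etale () k rfl
    exact ⟨l, hl⟩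

lemma El.fA_inl {m n : Type} {hm : Finite m} {hn : Finite n}
    (t : corollaGraph m hm ⟶ corollaGraph n hn) (k : m) :
    t.fA (Sum.inl k) = Sum.inl (t.fH k) := by
  have h := t.map_i (Sum.inr k)
  rw [show t.fA (Sum.inr k) = Sum.inr (t.fH k) from t.map_s k] at h
  exact h

lemma El.fA_inr {m n : Type} {hm : Finite m} {hn : Finite n}
    (t : corollaGraph m hm ⟶ corollaGraph n hn) (k : m) :
    t.fA (Sum.inr k) = Sum.inr (t.fH k) := t.map_s k

namespace CCP

/-- Values of the species `F̄`: on the unit graph those of `F`, on the corolla `n` the set of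
isomorphism classes of effective `n`-graphs decorated by `F`. -/
def Obj (F : Species) : El → Type 1
  | unit => F.obj (op unit)
  | corolla n _ => Quotient (DecGraph.setoid F n)

/-- Restriction maps of the species `F̄`. -/
def res (F : Species) : (E E' : El) → (E ⟶ E') → Obj F E' → Obj F E
  | unit, unit, t => fun x => pull F t x
  | unit, corolla n _, t =>
    Quotient.lift (fun X : DecGraph F n => col X.φ (X.ext ((toGraph t).fA true))) <| by
      rintro X Y ⟨θ, h1, h2⟩
      change col X.φ _ = col Y.φ _
      rw [← h2, col_nerve, DecGraph.rel_ext θ h1]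
  | corolla m _, corolla n _, t =>
    Quotient.map (fun X : DecGraph F n => X.relabel (toGraph t).fH (bijective_fH (toGraph t))) <| by
      rintro X Y ⟨θ, h1, h2⟩
      exact ⟨θ, fun k => h1 _, h2⟩
  | corolla _ _, unit, t => ((toGraph t).fV ()).elim

lemma res_id (F : Species) (E : El) (x : Obj F E) : res F E E (𝟙 E) x = x := by
  cases E with
  | unit => exact pull_id x
  | corolla n hn =>
    induction x using Quotient.inductionOn with
    | h X => rfl

lemma res_comp (F : Species) (E E' E'' : El) (s : E ⟶ E') (t : E' ⟶ E'') (x : Obj F E'') :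
    res F E E'' (s ≫ t) x = res F E E' s (res F E' E'' t x) := by
  match E, E', E'', s, t, x with
  | unit, unit, unit, s, t, x => exact pull_comp s t x
  | unit, unit, corolla n _, s, t, x =>
    induction x using Quotient.inductionOn with
    | h X =>
      change col X.φ (X.ext _) = pull F s (col X.φ (X.ext _))
      rcases unit_hom_cases s with rfl | rfl
      · rw [pull_id, Category.id_comp]
      · rw [← at_i]
        congr 1
        rw [← NGraph.ext_swap]
        congr 1
        exact (toGraph t).map_i true
  | unit, corolla m _, corolla n _, s, t, x =>
    induction x using Quotient.inductionOn with
    | h X =>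
      change col X.φ (X.ext ((toGraph t).fA ((toGraph s).fA true))) =
        col X.φ ((X.toNGraph.relabel (toGraph t).fH (bijective_fH (toGraph t))).ext
          ((toGraph s).fA true))
      congr 1
      generalize (toGraph s).fA true = a
      rcases a with k | k
      · rw [fA_inl]; rfl
      · rw [fA_inr]; rfl
  | corolla l _, corolla m _, corolla n _, s, t, x =>
    induction x using Quotient.inductionOn with
    | h X => rfl
  | _, corolla _ _, unit, _, t, _ => exact ((toGraph t).fV ()).elim
  | corolla _ _, unit, _, s, _, _ => exact ((toGraph s).fV ()).elim

/-- The species `F̄`. -/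
def bar (F : Species) : Species where
  obj E := Obj F E.unop
  map {E E'} f := ↾(res F E'.unop E.unop f.unop)
  map_id E := by
    ext x
    exact res_id F _ x
  map_comp f g := by
    ext x
    exact res_comp F _ _ _ g.unop f.unop x

/-- The class of a decorated `n`-graph. -/
def cls {F : Species} {n : Type} {hn : Finite n} (X : DecGraph F n) :
    (bar F).obj (op (corolla n hn)) := Quotient.mk (DecGraph.setoid F n) X

lemma cls_eq {F : Species} {n : Type} {hn : Finite n} {X Y : DecGraph F n} (θ : X.G ≅ Y.G)
    (h1 : ∀ k, θ.hom.fA (X.b k) = Y.b k) (h2 : nerve.map θ.hom ≫ Y.φ = X.φ) :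
    (cls X : (bar F).obj (op (corolla n hn))) = cls Y := Quotient.sound ⟨θ, h1, h2⟩

lemma cls_exact {F : Species} {n : Type} {hn : Finite n} {X Y : DecGraph F n}
    (h : (cls X : (bar F).obj (op (corolla n hn))) = cls Y) :
    ∃ θ : X.G ≅ Y.G, (∀ k, θ.hom.fA (X.b k) = Y.b k) ∧ nerve.map θ.hom ≫ Y.φ = X.φ :=
  Quotient.exact h

lemma cls_ind {F : Species} {n : Type} {hn : Finite n}
    (x : (bar F).obj (op (corolla n hn))) : ∃ X : DecGraph F n, cls X = x :=
  Quotient.exists_rep x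

lemma pull_cls_unit {F : Species} {n : Type} {hn : Finite n} (X : DecGraph F n)
    (t : unit ⟶ corolla n hn) :
    pull (bar F) t (cls X) = col X.φ (X.ext ((toGraph t).fA true)) := rfl

lemma pull_cls {F : Species} {m n : Type} {hm : Finite m} {hn : Finite n} (X : DecGraph F n)
    (t : corolla m hm ⟶ corolla n hn) :
    pull (bar F) t (cls X) = cls (X.relabel (toGraph t).fH (bijective_fH (toGraph t))) := rfl

/-- Components of the action of `F ↦ F̄` on morphisms. -/
def mapObj {F G : Species} (α : F ⟶ G) : (E : El) → Obj F E → Obj G E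
  | unit => fun x => ev α (E := unit) x
  | corolla n _ =>
    Quotient.map (fun X : DecGraph F n => X.mapDec α) <| by
      rintro X Y ⟨θ, h1, h2⟩
      refine ⟨θ, h1, ?_⟩
      change nerve.map θ.hom ≫ Y.φ ≫ α = X.φ ≫ α
      rw [← Category.assoc, h2]

/-- The action of `F ↦ F̄` on morphisms. -/
def barMap {F G : Species} (α : F ⟶ G) : bar F ⟶ bar G :=
  mkHom (mapObj α) fun E E' t x => by
    match E, E', t, x with
    | unit, unit, t, x => exact ev_pull α t x
    | unit, corolla n _, t, x =>
      obtain ⟨X, rfl⟩ := cls_ind x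
      rfl
    | corolla m _, corolla n _, t, x =>
      obtain ⟨X, rfl⟩ := cls_ind x
      rfl
    | corolla _ _, unit, t, _ => exact ((toGraph t).fV ()).elim

lemma barMap_cls {F G : Species} (α : F ⟶ G) {n : Type} {hn : Finite n} (X : DecGraph F n) :
    ev (barMap α) (E := corolla n hn) (cls X) = cls (X.mapDec α) := rfl

lemma barMap_unit {F G : Species} (α : F ⟶ G) (x : (bar F).obj (op unit)) :
    ev (barMap α) (E := unit) x = ev α (E := unit) x := rfl

/-- The endofunctor `F ↦ F̄`. -/
def T : Species ⥤ Species where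
  obj := bar
  map := barMap
  map_id F := ev_ext fun E x => by
    cases E with
    | unit => rfl
    | corolla n hn =>
      obtain ⟨X, rfl⟩ := cls_ind x
      rw [barMap_cls]
      exact cls_eq (Iso.refl _) (fun _ => rfl) (by simp [DecGraph.mapDec])
  map_comp α β := ev_ext fun E x => by
    cases E with
    | unit => rfl
    | corolla n hn =>
      obtain ⟨X, rfl⟩ := cls_ind x
      exact cls_eq (Iso.refl _) (fun _ => rfl) (by simp [DecGraph.mapDec])

/-- The corolla as an `n`-graph. -/
def corN (n : Type) (hn : Finite n) : NGraph n where
  G := corollaGraph n hn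
  eff := ⟨Or.inl ⟨()⟩, by
    rintro (k | k) ⟨h1, h2⟩
    · exact h2 k rfl
    · exact h1 k rfl⟩
  b := Sum.inl
  b_inj := Sum.inl_injective
  b_port := by
    rintro (k | k)
    · exact ⟨fun _ => ⟨k, rfl⟩, fun _ h e => by cases e⟩
    · exact ⟨fun h => (h k rfl).elim, fun ⟨_, e⟩ => by cases e⟩

lemma corN_ext (n : Type) (hn : Finite n) (a : n ⊕ n) : (corN n hn).ext a = a := by
  rcases a with k | k <;> rfl

/-- The corolla decorated by an element of a species. -/
def corDec {F : Species} (n : Type) (hn : Finite n) (x : F.obj (op (corolla n hn))) :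
    DecGraph F n where
  toNGraph := corN n hn
  φ := yo x

/-- Components of the unit of the monad: interpret an `F`-corolla as an `F`-graph. -/
def unitObj (F : Species) : (E : El) → F.obj (op E) → (bar F).obj (op E)
  | unit => fun x => x
  | corolla n hn => fun x => cls (corDec n hn x)

/-- The unit of the monad. -/
def eta (F : Species) : F ⟶ bar F :=
  mkHom (unitObj F) fun E E' t x => by
    match E, E', t, x with
    | unit, unit, t, x => rfl
    | unit, corolla n hn, t, x =>
      change pull F t x = col (yo x) ((corN n hn).ext _)
      rw [corN_ext]
      conv_rhs => rw [col, at_yo]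
      congr 1
      exact (arc_eq (toGraph t)).symm
    | corolla m hm, corolla n hn, t, x =>
      change cls _ = cls _
      have hb : Function.Bijective (toGraph t).fA := by
        have hh := bijective_fH (toGraph t)
        constructor
        · rintro (a | a) (b | b) e
          · rw [fA_inl, fA_inl] at e
            rw [hh.1 (Sum.inl_injective e)]
          · rw [fA_inl, fA_inr] at e; cases e
          · rw [fA_inl, fA_inr] at e; cases e
          · rw [fA_inr, fA_inr] at e
            rw [hh.1 (Sum.inr_injective e)]
        · rintro (a | a)
          · obtain ⟨k, rfl⟩ := hh.2 a
            exact ⟨Sum.inl k, fA_inl _ _⟩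
          · obtain ⟨k, rfl⟩ := hh.2 a
            exact ⟨Sum.inr k, fA_inr _ _⟩
      have hV : Function.Bijective (toGraph t).fV :=
        ⟨fun _ _ _ => rfl, fun _ => ⟨(), rfl⟩⟩
      have := isIso_of_bijective (toGraph t) hb hV
      let θ := @asIso _ _ _ _ (toGraph t) this
      refine cls_eq θ (fun k => fA_inl _ k) ?_
      refine at_ext fun E f => ?_
      exact pull_comp (f : E ⟶ _) t x
    | corolla _ _, unit, t, _ => exact ((toGraph t).fV ()).elim

lemma eta_corolla {F : Species} {n : Type} {hn : Finite n} (x : F.obj (op (corolla n hn))) :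
    ev (eta F) x = cls (corDec n hn x) := rfl
lemma eta_unit {F : Species} (x : F.obj (op unit)) : ev (eta F) x = x := rfl

/-- A gluing datum: the graph `S` is obtained from a family of effective graphs indexed by the
vertices of `R`, each having the same interface as the corresponding corolla of `R`, by gluing
them together in the same way as `R` is glued from its corollas.  In other words, `S` with the
etale morphisms `ι x` (on vertices) and the arc map `e` (on edges) is a colimit of the diagram
indexed by the elements of `R`: an arc `i (s k)` of `R` pointing towards a vertex `x` is sent to
the corresponding port of the piece at `x`, the vertices of `S` are those of the pieces, and the
ports of `S` are those of `R`. -/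
structure Gluing (R S : JKGraph) where
  piece : ∀ x : R.V, NGraph (R.Flags x)
  ι : ∀ x, (piece x).G ⟶ S
  e : R.A → S.A
  e_i : ∀ a, e (R.i a) = S.i (e a)
  ι_b : ∀ x (k : R.Flags x), (ι x).fA ((piece x).b k) = e (R.i (R.s k.1))
  bijV : Function.Bijective fun z : Σ x, (piece x).G.V => (ι z.1).fV z.2
  ports : Set.BijOn e {a | R.IsPort a} {a | S.IsPort a}

/-- A decorated graph `(S, φ)` is the result of substituting into the `F̄`-decorated graph
`(R, ψ)` if it is glued from `F`-graphs representing the decorations of the vertices of `R`. -/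
structure Subst {R S : JKGraph} {F : Species} (ψ : nerve.obj R ⟶ bar F)
    (φ : nerve.obj S ⟶ F) extends Gluing R S where
  dec : ∀ x, cls ⟨piece x, nerve.map (ι x) ≫ φ⟩ = at' (E := corolla (R.Flags x) inferInstance)
    ψ (star x)

lemma inj_fH {I : Type} {X : I → JKGraph} {S : JKGraph} (ι : ∀ x, X x ⟶ S)
    (hV : Function.Bijective fun z : Σ x, (X x).V => (ι z.1).fV z.2) {x y : I} {h : (X x).H}
    {h' : (X y).H} (e : (ι x).fH h = (ι y).fH h') :
    (⟨x, h⟩ : Σ x, (X x).H) = ⟨y, h'⟩ := by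
  have h1 : (⟨x, (X x).p h⟩ : Σ x, (X x).V) = ⟨y, (X y).p h'⟩ :=
    hV.1 (show (ι x).fV _ = (ι y).fV _ by rw [(ι x).map_p, (ι y).map_p, e])
  obtain rfl : x = y := congrArg Sigma.fst h1
  have h2 : (X x).p h = (X x).p h' := by simpa using h1
  obtain ⟨k, _, hk⟩ := (ι x).etale ((X x).p h) ((ι x).fH h) ((ι x).map_p _).symm
  rw [hk h ⟨rfl, rfl⟩, hk h' ⟨h2.symm, e.symm⟩]

lemma surj_fH {I : Type} {X : I → JKGraph} {S : JKGraph} (ι : ∀ x, X x ⟶ S)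
    (hV : Function.Bijective fun z : Σ x, (X x).V => (ι z.1).fV z.2) (h : S.H) :
    ∃ x h', (ι x).fH h' = h := by
  obtain ⟨⟨x, v⟩, hv⟩ := hV.2 (S.p h)
  obtain ⟨k, ⟨_, hk⟩, _⟩ := (ι x).etale v h hv.symm
  exact ⟨x, k, hk⟩

lemma _root_.NGraph.exists_flag {n : Type} (X : NGraph n) (k : n) : ∃ h, X.G.s h = X.G.i (X.b k) :=
  IsPort.of_not fun h => X.eff.2 (X.b k) ⟨(X.b_port _).2 ⟨k, rfl⟩, h⟩

namespace Gluing
variable {R S : JKGraph} (gl : Gluing R S)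

/-- The flag of the piece corresponding to a flag of the vertex. -/
noncomputable def fl (x : R.V) (k : R.Flags x) : (gl.piece x).G.H :=
  ((gl.piece x).exists_flag k).choose

lemma s_fl (x : R.V) (k : R.Flags x) :
    (gl.piece x).G.s (gl.fl x k) = (gl.piece x).G.i ((gl.piece x).b k) :=
  ((gl.piece x).exists_flag k).choose_spec

lemma e_s (x : R.V) (k : R.Flags x) : gl.e (R.s k.1) = S.s ((gl.ι x).fH (gl.fl x k)) := by
  rw [← (gl.ι x).map_s, gl.s_fl, (gl.ι x).map_i, gl.ι_b, ← gl.e_i, R.i_i]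

lemma fl_inj {x y : R.V} {k : R.Flags x} {l : R.Flags y}
    (h : (gl.ι x).fH (gl.fl x k) = (gl.ι y).fH (gl.fl y l)) : k.1 = l.1 := by
  have h1 := inj_fH gl.ι gl.bijV h
  obtain rfl : x = y := congrArg Sigma.fst h1
  have h2 : gl.fl x k = gl.fl x l := by simpa using h1
  have h3 := gl.s_fl x k
  rw [h2, gl.s_fl x l] at h3
  have h4 := congrArg (gl.piece x).G.i h3
  rw [(gl.piece x).G.i_i, (gl.piece x).G.i_i] at h4
  rw [(gl.piece x).b_inj h4]

lemma isPort_e {a : R.A} : S.IsPort (gl.e a) ↔ R.IsPort a := by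
  refine ⟨fun h => ?_, fun h => gl.ports.1 h⟩
  by_contra hn
  obtain ⟨k, rfl⟩ := IsPort.of_not hn
  rw [gl.e_s (R.p k) ⟨k, rfl⟩] at h
  exact h _ rfl

lemma e_inj : Function.Injective gl.e := by
  intro a b hab
  by_cases ha : R.IsPort a
  · have hb : R.IsPort b := by rw [← gl.isPort_e, ← hab, gl.isPort_e]; exact ha
    exact gl.ports.2.1 ha hb hab
  · have hb : ¬ R.IsPort b := by rw [← gl.isPort_e, ← hab, gl.isPort_e]; exact ha
    obtain ⟨k, rfl⟩ := IsPort.of_not ha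
    obtain ⟨l, rfl⟩ := IsPort.of_not hb
    rw [gl.e_s (R.p k) ⟨k, rfl⟩, gl.e_s (R.p l) ⟨l, rfl⟩] at hab
    exact congrArg R.s (gl.fl_inj (S.s_inj hab))

lemma eq_i_s (hR : R.NoIsolatedEdges) (a : R.A) :
    ∃ (x : R.V) (k : R.Flags x), a = R.s k.1 ∨ a = R.i (R.s k.1) := by
  by_cases ha : R.IsPort a
  · obtain ⟨k, hk⟩ := IsPort.of_not fun hb => hR a ⟨ha, hb⟩
    exact ⟨R.p k, ⟨k, rfl⟩, Or.inr (by rw [hk, R.i_i])⟩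
  · obtain ⟨k, rfl⟩ := IsPort.of_not ha
    exact ⟨R.p k, ⟨k, rfl⟩, Or.inl rfl⟩

lemma e_lift (hR : R.NoIsolatedEdges) (a : R.A) : ∃ x b, (gl.ι x).fA b = gl.e a := by
  obtain ⟨x, k, rfl | rfl⟩ := eq_i_s hR a
  · exact ⟨x, _, by rw [gl.e_s x k, ← (gl.ι x).map_s]⟩
  · exact ⟨x, _, gl.ι_b x k⟩

lemma surjA (hR : R.NoIsolatedEdges) (a : S.A) : ∃ x b, (gl.ι x).fA b = a := by
  by_cases ha : S.IsPort a
  · obtain ⟨r, _, rfl⟩ := gl.ports.2.2 ha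
    exact gl.e_lift hR r
  · obtain ⟨h, rfl⟩ := IsPort.of_not ha
    obtain ⟨x, h', rfl⟩ := surj_fH gl.ι gl.bijV h
    exact ⟨x, _, (gl.ι x).map_s h'⟩

lemma surjV (v : S.V) : ∃ x w, (gl.ι x).fV w = v := by
  obtain ⟨⟨x, w⟩, h⟩ := gl.bijV.2 v
  exact ⟨x, w, h⟩

lemma noIsolatedEdges (gl : Gluing R S) (hR : R.NoIsolatedEdges) : S.NoIsolatedEdges := by
  rintro a ⟨ha, hb⟩
  obtain ⟨r, hr, rfl⟩ := gl.ports.2.2 ha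
  rw [← gl.e_i, gl.isPort_e] at hb
  exact hR r ⟨hr, hb⟩

lemma effective (gl : Gluing R S) (hR : R.Effective) : S.Effective := by
  refine ⟨Or.inl ?_, gl.noIsolatedEdges hR.2⟩
  obtain ⟨x⟩ := hR.nonempty_V
  obtain ⟨v⟩ := (gl.piece x).eff.nonempty_V
  exact ⟨(gl.ι x).fV v⟩

/-- The only identifications made by the gluing are those coming from the edges of `R`. -/
lemma ident {x y : R.V} {a : (gl.piece x).G.A} {b : (gl.piece y).G.A}
    (h : (gl.ι x).fA a = (gl.ι y).fA b) :
    (⟨x, a⟩ : Σ x, (gl.piece x).G.A) = ⟨y, b⟩ ∨ ∃ r, (gl.ι x).fA a = gl.e r := by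
  by_cases ha : (gl.piece x).G.IsPort a
  · obtain ⟨k, rfl⟩ := ((gl.piece x).b_port a).1 ha
    exact Or.inr ⟨_, gl.ι_b x k⟩
  by_cases hb : (gl.piece y).G.IsPort b
  · obtain ⟨k, rfl⟩ := ((gl.piece y).b_port b).1 hb
    exact Or.inr ⟨_, h.trans (gl.ι_b y k)⟩
  obtain ⟨k, rfl⟩ := IsPort.of_not ha
  obtain ⟨l, rfl⟩ := IsPort.of_not hb
  left
  rw [(gl.ι x).map_s, (gl.ι y).map_s] at h
  have h1 := inj_fH gl.ι gl.bijV (S.s_inj h)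
  obtain rfl : x = y := congrArg Sigma.fst h1
  have h2 : k = l := by simpa using h1
  rw [h2]

/-- Arcs of the pieces lying over an arc of `R`. -/
lemma over_e {x : R.V} {a : (gl.piece x).G.A} {r : R.A} (h : (gl.ι x).fA a = gl.e r) :
    ∃ k : R.Flags x, (a = (gl.piece x).b k ∧ r = R.i (R.s k.1)) ∨
      (a = (gl.piece x).G.i ((gl.piece x).b k) ∧ r = R.s k.1) := by
  by_cases ha : (gl.piece x).G.IsPort a
  · obtain ⟨k, rfl⟩ := ((gl.piece x).b_port a).1 ha
    refine ⟨k, Or.inl ⟨rfl, gl.e_inj ?_⟩⟩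
    rw [← h, gl.ι_b]
  · obtain ⟨l, rfl⟩ := IsPort.of_not ha
    have hr : ¬ R.IsPort r := by
      rw [← gl.isPort_e, ← h, (gl.ι x).map_s]
      exact not_isPort_s _ _
    obtain ⟨k, rfl⟩ := IsPort.of_not hr
    rw [gl.e_s (R.p k) ⟨k, rfl⟩, (gl.ι x).map_s] at h
    have h1 := inj_fH gl.ι gl.bijV (S.s_inj h)
    obtain rfl : x = R.p k := congrArg Sigma.fst h1
    have h2 : l = gl.fl (R.p k) ⟨k, rfl⟩ := by simpa using h1
    exact ⟨⟨k, rfl⟩, Or.inr ⟨by rw [h2, gl.s_fl], rfl⟩⟩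

/-- Decorations of a glued graph. -/
lemma exists_dec (hR : R.NoIsolatedEdges) {F : Species}
    (φ : ∀ x, nerve.obj (gl.piece x).G ⟶ F) (c : R.A → F.obj (op unit))
    (hc : ∀ a, c (R.i a) = pull F flipHom (c a))
    (hφ : ∀ x k, col (φ x) ((gl.piece x).b k) = c (R.i (R.s k.1))) :
    ∃ ψ : nerve.obj S ⟶ F, (∀ x, nerve.map (gl.ι x) ≫ ψ = φ x) ∧
      ∀ a, col ψ (gl.e a) = c a := by
  have key : ∀ x a r, (gl.ι x).fA a = gl.e r → col (φ x) a = c r := by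
    intro x a r h
    obtain ⟨k, ⟨rfl, rfl⟩ | ⟨rfl, rfl⟩⟩ := gl.over_e h
    · exact hφ x k
    · rw [at_i, hφ, ← hc, R.i_i]
  obtain ⟨ψ, hψ⟩ := exists_descent gl.ι gl.bijV (gl.surjA hR) φ (fun x y a b h => by
    rcases gl.ident h with h1 | ⟨r, hr⟩
    · obtain rfl : x = y := congrArg Sigma.fst h1
      have h2 : a = b := by simpa using h1
      rw [h2]
    · rw [key x a r hr, key y b r (h ▸ hr)])
  refine ⟨ψ, hψ, fun a => ?_⟩
  obtain ⟨x, b, hb⟩ := gl.e_lift hR a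
  rw [← hb, ← col_nerve, hψ, key x b a hb]

lemma dec_ext (hR : R.NoIsolatedEdges) {F : Species} {φ ψ : nerve.obj S ⟶ F}
    (h : ∀ x, nerve.map (gl.ι x) ≫ φ = nerve.map (gl.ι x) ≫ ψ) : φ = ψ :=
  cover_ext gl.ι gl.surjV (gl.surjA hR) h

/-- Existence in the universal property of a glued graph as a colimit (uniqueness is `hom_ext`
below). -/
lemma exists_desc (hR : R.NoIsolatedEdges) {Y : JKGraph} (f : ∀ x, (gl.piece x).G ⟶ Y)
    (c : R.A → Y.A) (hc : ∀ a, c (R.i a) = Y.i (c a))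
    (hf : ∀ x k, (f x).fA ((gl.piece x).b k) = c (R.i (R.s k.1))) :
    ∃ g : S ⟶ Y, (∀ x, gl.ι x ≫ g = f x) ∧ ∀ a, g.fA (gl.e a) = c a := by
  obtain ⟨ψ, h1, h2⟩ := gl.exists_dec hR (fun x => nerve.map (f x))
    (fun a => (ULift.up (arc (c a)) : (nerve.obj Y).obj (op unit)))
    (fun a => by
      rw [hc]
      exact congrArg ULift.up (flip_arc (c a)).symm)
    (fun x k => by
      rw [← hf]
      exact congrArg ULift.up (arc_comp _ _))
  obtain ⟨g, rfl⟩ := nerve_full ψ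
  refine ⟨g, fun x => nerve_faithful (by rw [Functor.map_comp, h1]), fun a => ?_⟩
  exact congrArg (fun k => k.down.fA true) (h2 a)

lemma hom_ext (hR : R.NoIsolatedEdges) {Y : JKGraph} {f g : S ⟶ Y}
    (h : ∀ x, gl.ι x ≫ f = gl.ι x ≫ g) : f = g :=
  nerve_faithful (gl.dec_ext hR fun x => by
    rw [← Functor.map_comp, ← Functor.map_comp, h])

end Gluing

/-- Every family of effective graphs with the right interfaces can be glued. -/
lemma exists_gluing {R : JKGraph} (piece : ∀ x : R.V, NGraph (R.Flags x)) :
    ∃ (S : JKGraph) (gl : Gluing R S), gl.piece = piece := by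
  classical
  let Inn : Type := {z : Σ x, (piece x).G.A //
    ¬ (piece z.1).G.IsPort z.2 ∧ ¬ (piece z.1).G.IsPort ((piece z.1).G.i z.2)}
  have sp : ∀ x (a : (piece x).G.A), (piece x).G.IsPort a → ∃ k, (piece x).b k = a :=
    fun x a h => ((piece x).b_port a).1 h
  let m : ∀ x, (piece x).G.A → Inn ⊕ R.A := fun x a =>
    if h : (piece x).G.IsPort a then Sum.inr (R.i (R.s (sp x a h).choose.1))
    else if h' : (piece x).G.IsPort ((piece x).G.i a) then Sum.inr (R.s (sp x _ h').choose.1)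
    else Sum.inl ⟨⟨x, a⟩, h, h'⟩
  have hport : ∀ x k, (piece x).G.IsPort ((piece x).b k) := fun x k =>
    ((piece x).b_port _).2 ⟨k, rfl⟩
  have hch : ∀ x k (h : (piece x).G.IsPort ((piece x).b k)), (sp x _ h).choose = k :=
    fun x k h => (piece x).b_inj (sp x _ h).choose_spec
  have m_b : ∀ x k, m x ((piece x).b k) = Sum.inr (R.i (R.s k.1)) := fun x k => by
    simp only [m]
    rw [dif_pos (hport x k), hch x k (hport x k)]
  have m_ib : ∀ x k, m x ((piece x).G.i ((piece x).b k)) = Sum.inr (R.s k.1) := fun x k => by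
    have h1 : ¬ (piece x).G.IsPort ((piece x).G.i ((piece x).b k)) := fun h =>
      (piece x).eff.2 _ ⟨hport x k, h⟩
    have h2 : (piece x).G.IsPort ((piece x).G.i ((piece x).G.i ((piece x).b k))) := by
      rw [(piece x).G.i_i]; exact hport x k
    simp only [m]
    rw [dif_neg h1, dif_pos h2]
    congr 3
    apply (piece x).b_inj
    rw [(sp x _ h2).choose_spec, (piece x).G.i_i]
  have m_inn : ∀ x a (h : ¬ (piece x).G.IsPort a) (h' : ¬ (piece x).G.IsPort ((piece x).G.i a)),
      m x a = Sum.inl ⟨⟨x, a⟩, h, h'⟩ := fun x a h h' => by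
    simp only [m]
    rw [dif_neg h, dif_neg h']
  have trich : ∀ x a, (∃ k, a = (piece x).b k) ∨ (∃ k, a = (piece x).G.i ((piece x).b k)) ∨
      (¬ (piece x).G.IsPort a ∧ ¬ (piece x).G.IsPort ((piece x).G.i a)) := by
    intro x a
    by_cases h : (piece x).G.IsPort a
    · obtain ⟨k, rfl⟩ := sp x a h
      exact Or.inl ⟨k, rfl⟩
    by_cases h' : (piece x).G.IsPort ((piece x).G.i a)
    · obtain ⟨k, hk⟩ := sp x _ h'
      exact Or.inr (Or.inl ⟨k, by rw [hk, (piece x).G.i_i]⟩)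
    exact Or.inr (Or.inr ⟨h, h'⟩)
  let inv : Inn ⊕ R.A → Inn ⊕ R.A := Sum.map
    (fun z => ⟨⟨z.1.1, (piece z.1.1).G.i z.1.2⟩, z.2.2, by
      rw [(piece z.1.1).G.i_i]; exact z.2.1⟩) R.i
  have m_i : ∀ x a, m x ((piece x).G.i a) = inv (m x a) := by
    intro x a
    rcases trich x a with ⟨k, rfl⟩ | ⟨k, rfl⟩ | ⟨h, h'⟩
    · rw [m_ib, m_b]
      simp only [inv, Sum.map_inr, R.i_i]
    · rw [m_ib, (piece x).G.i_i, m_b]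
      rfl
    · rw [m_inn x a h h', m_inn x _ h' (by rw [(piece x).G.i_i]; exact h)]
      rfl
  have sb : ∀ x h, (∃ k, (piece x).G.s h = (piece x).G.i ((piece x).b k)) ∨
      (¬ (piece x).G.IsPort ((piece x).G.s h) ∧
        ¬ (piece x).G.IsPort ((piece x).G.i ((piece x).G.s h))) := fun x h => by
    rcases trich x ((piece x).G.s h) with ⟨k, hk⟩ | ⟨k, hk⟩ | h'
    · exact (hport x k _ hk).elim
    · exact Or.inl ⟨k, hk⟩
    · exact Or.inr h'
  have fR := R.finA
  have fV := R.finV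
  have fA := fun x => (piece x).G.finA
  have fH := fun x => (piece x).G.finH
  have fV' := fun x => (piece x).G.finV
  let S : JKGraph :=
    { A := Inn ⊕ R.A
      H := Σ x, (piece x).G.H
      V := Σ x, (piece x).G.V
      finA := inferInstance
      finH := inferInstance
      finV := inferInstance
      i := inv
      s := fun z => m z.1 ((piece z.1).G.s z.2)
      p := fun z => ⟨z.1, (piece z.1).G.p z.2⟩
      s_inj := by
        rintro ⟨x, h⟩ ⟨y, l⟩ e
        replace e : m x ((piece x).G.s h) = m y ((piece y).G.s l) := e
        rcases sb x h with ⟨k, hk⟩ | ⟨h1, h2⟩ <;> rcases sb y l with ⟨k', hk'⟩ | ⟨h3, h4⟩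
        · rw [hk, hk', m_ib, m_ib] at e
          have e1 := R.s_inj (Sum.inr_injective e)
          obtain rfl : x = y := by rw [← k.2, ← k'.2, e1]
          obtain rfl : k = k' := Subtype.ext e1
          rw [← hk'] at hk
          rw [(piece x).G.s_inj hk]
        · rw [hk, m_ib, m_inn _ _ h3 h4] at e; cases e
        · rw [hk', m_ib, m_inn _ _ h1 h2] at e; cases e
        · rw [m_inn _ _ h1 h2, m_inn _ _ h3 h4] at e
          have e1 := congrArg Subtype.val (Sum.inl_injective e)
          obtain rfl : x = y := congrArg Sigma.fst e1
          have e2 : (piece x).G.s h = (piece x).G.s l := by simpa using e1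
          rw [(piece x).G.s_inj e2]
      i_i := by
        rintro (⟨⟨x, a⟩, h⟩ | a)
        · simp [inv, (piece x).G.i_i]
        · simp [inv, R.i_i]
      i_ne := by
        rintro (⟨⟨x, a⟩, h⟩ | a) e
        · have e1 := congrArg Subtype.val (Sum.inl_injective e)
          have e2 : (piece x).G.i a = a := by simpa using e1
          exact (piece x).G.i_ne _ e2
        · exact R.i_ne _ (Sum.inr_injective e) }
  have hSp : ∀ a : R.A, S.IsPort (Sum.inr a : Inn ⊕ R.A) ↔ R.IsPort a := by
    intro a
    constructor
    · intro h k hk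
      obtain ⟨l, hl⟩ := (piece (R.p k)).exists_flag ⟨k, rfl⟩
      apply h ⟨R.p k, l⟩
      change m (R.p k) ((piece (R.p k)).G.s l) = _
      rw [hl, m_ib, hk]
    · rintro h ⟨x, l⟩ hl
      replace hl : m x ((piece x).G.s l) = Sum.inr a := hl
      rcases sb x l with ⟨k, hk⟩ | ⟨h1, h2⟩
      · rw [hk, m_ib] at hl
        exact h _ (Sum.inr_injective hl)
      · rw [m_inn _ _ h1 h2] at hl; cases hl
  refine ⟨S,
    { piece := piece
      ι := fun x =>
        { fA := m x
          fH := fun h => ⟨x, h⟩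
          fV := fun v => ⟨x, v⟩
          map_i := m_i x
          map_s := fun _ => rfl
          map_p := fun _ => rfl
          etale := by
            rintro v ⟨y, h⟩ hv
            obtain rfl : y = x := congrArg Sigma.fst hv
            have hv' : (piece y).G.p h = v := by
              have : (⟨y, (piece y).G.p h⟩ : Σ x, (piece x).G.V) = ⟨y, v⟩ := hv
              simpa using this
            refine ⟨h, ⟨hv', rfl⟩, ?_⟩
            rintro h' ⟨_, hh⟩
            have hh' : (⟨y, h'⟩ : Σ x, (piece x).G.H) = ⟨y, h⟩ := hh
            simpa using hh' }
      e := Sum.inr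
      e_i := fun _ => rfl
      ι_b := m_b
      bijV := Function.bijective_id
      ports := by
        refine ⟨fun a ha => (hSp a).2 ha, Sum.inr_injective.injOn, ?_⟩
        rintro (⟨⟨x, a⟩, h, h'⟩ | a) hz
        · obtain ⟨l, hl⟩ := IsPort.of_not h
          refine (hz ⟨x, l⟩ ?_).elim
          change m x ((piece x).G.s l) = _
          rw [hl]
          exact m_inn _ _ h h'
        · exact ⟨a, (hSp a).1 hz, rfl⟩ }, rfl⟩

/-- The bijection on flags induced by an etale morphism. -/
def flagMap {X Y : JKGraph} (f : X ⟶ Y) (x : X.V) (k : X.Flags x) : Y.Flags (f.fV x) :=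
  ⟨f.fH k.1, by rw [← f.map_p, k.2]⟩

lemma flagMap_bij {X Y : JKGraph} (f : X ⟶ Y) (x : X.V) : Function.Bijective (flagMap f x) := by
  constructor
  · intro k l e
    have e' : f.fH k.1 = f.fH l.1 := congrArg Subtype.val e
    obtain ⟨h, _, hu⟩ := f.etale x (f.fH k.1) (by rw [← f.map_p, k.2])
    exact Subtype.ext ((hu _ ⟨k.2, rfl⟩).trans (hu _ ⟨l.2, e'.symm⟩).symm)
  · rintro ⟨h, hh⟩
    obtain ⟨k, ⟨h1, h2⟩, _⟩ := f.etale x h hh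
    exact ⟨⟨k, h1⟩, Subtype.ext h2⟩

/-- The morphism of corollas induced by a bijection. -/
def relabHom {m n : Type} (hm : Finite m) (hn : Finite n) (u : m → n) (hu : Function.Bijective u) :
    corollaGraph m hm ⟶ corollaGraph n hn where
  fA := Sum.map u u
  fH := u
  fV := id
  map_i := by rintro (k | k) <;> rfl
  map_s _ := rfl
  map_p _ := rfl
  etale _ h _ := by
    obtain ⟨k, hk⟩ := hu.2 h
    exact ⟨k, ⟨rfl, hk⟩, fun l hl => hu.1 (hl.2.trans hk.symm)⟩

lemma star_comp {X Y : JKGraph} (f : X ⟶ Y) (x : X.V) :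
    star x ≫ f = relabHom inferInstance inferInstance _ (flagMap_bij f x) ≫ star (f.fV x) := by
  apply JKGraph.hom_ext
  · funext a
    rcases a with k | k
    · change f.fA (X.i (X.s k.1)) = Y.i (Y.s (f.fH k.1))
      rw [f.map_i, f.map_s]
    · exact f.map_s k.1
  · rfl
  · rfl

lemma at_star_comp {X Y : JKGraph} {F : Species} (f : X ⟶ Y) (ψ : nerve.obj Y ⟶ bar F) (x : X.V)
    (D : DecGraph F (Y.Flags (f.fV x)))
    (h : cls D = at' (E := corolla (Y.Flags (f.fV x)) inferInstance) ψ (star (f.fV x))) :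
    at' (E := corolla (X.Flags x) inferInstance) ψ (star x ≫ f) =
      cls (D.relabel (flagMap f x) (flagMap_bij f x)) := by
  rw [star_comp]
  refine (at_comp ψ (E := corolla (X.Flags x) inferInstance)
    (E' := corolla (Y.Flags (f.fV x)) inferInstance)
    (relabHom inferInstance inferInstance _ (flagMap_bij f x)) (star (f.fV x))).trans ?_
  rw [← h, pull_cls]
  rfl

lemma col_dec {X : JKGraph} {F : Species} (ψ : nerve.obj X ⟶ bar F) (x : X.V)
    (D : DecGraph F (X.Flags x))
    (h : cls D = at' (E := corolla (X.Flags x) inferInstance) ψ (star x)) (k : X.Flags x) :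
    (col D.φ (D.b k) : F.obj (op unit)) = col ψ (X.i (X.s k.1)) := by
  have h1 := pull_unit ψ (E := corolla (X.Flags x) inferInstance)
    (arc (X := corollaGraph (X.Flags x) inferInstance) (Sum.inl k) : _ ⟶ _) (star x)
  rw [← h, pull_cls_unit] at h1
  exact h1

/-- A substitution preserves the colours of the arcs. -/
lemma Subst.col_e {R S : JKGraph} {F : Species} {ψ : nerve.obj R ⟶ bar F}
    {φ : nerve.obj S ⟶ F} (σ : Subst ψ φ) (hR : R.NoIsolatedEdges) (a : R.A) :
    (col φ (σ.e a) : F.obj (op unit)) = col ψ a := by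
  have key : ∀ x (k : R.Flags x),
      (col φ (σ.e (R.i (R.s k.1))) : F.obj (op unit)) = col ψ (R.i (R.s k.1)) := by
    intro x k
    rw [← col_dec ψ x _ (σ.dec x) k, ← σ.ι_b]
    exact (col_nerve _ _ _).symm
  obtain ⟨x, k, rfl | rfl⟩ := Gluing.eq_i_s hR a
  · have h := key x k
    rw [σ.e_i, at_i, at_i] at h
    have h' := congrArg (pull F flipHom) h
    have e1 : ∀ y : F.obj (op unit), pull F flipHom (pull F flipHom y) = y := fun y => by
      rw [← pull_comp]
      have : flipHom ≫ flipHom = 𝟙 unit := unit_hom_ext rfl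
      rw [this, pull_id]
    rw [e1] at h'
    exact h'.trans (e1 _)
  · exact key x k

lemma exists_subst {R : JKGraph} (hR : R.NoIsolatedEdges) {F : Species}
    (ψ : nerve.obj R ⟶ bar F) :
    ∃ (S : JKGraph) (φ : nerve.obj S ⟶ F), Nonempty (Subst ψ φ) := by
  choose X hX using fun x => cls_ind (at' (E := corolla (R.Flags x) inferInstance) ψ (star x))
  obtain ⟨S, gl, hgl⟩ := exists_gluing fun x => (X x).toNGraph
  have h1 : ∃ ω : ∀ x, nerve.obj (gl.piece x).G ⟶ F, ∀ x, cls ⟨gl.piece x, ω x⟩ =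
      at' (E := corolla (R.Flags x) inferInstance) ψ (star x) := by
    rw [hgl]
    exact ⟨fun x => (X x).φ, hX⟩
  obtain ⟨ω, hω⟩ := h1
  let c : R.A → F.obj (op unit) := fun a => (col ψ a : (bar F).obj (op unit))
  obtain ⟨φ, h2, _⟩ := gl.exists_dec hR ω c (fun a => at_i ψ a)
    (fun x k => col_dec ψ x _ (hω x) k)
  exact ⟨S, φ, ⟨{ gl with dec := fun x => by rw [h2]; exact hω x }⟩⟩

lemma subst_hom {R S S' : JKGraph} (hR : R.NoIsolatedEdges) {F : Species}
    {ψ : nerve.obj R ⟶ bar F} {φ : nerve.obj S ⟶ F} {φ' : nerve.obj S' ⟶ F} (σ : Subst ψ φ)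
    (σ' : Subst ψ φ') (θ : ∀ x, (σ.piece x).G ⟶ (σ'.piece x).G)
    (h : ∀ x k, (θ x).fA ((σ.piece x).b k) = (σ'.piece x).b k) :
    ∃ g : S ⟶ S', (∀ x, σ.ι x ≫ g = θ x ≫ σ'.ι x) ∧ ∀ a, g.fA (σ.e a) = σ'.e a :=
  σ.exists_desc hR (fun x => θ x ≫ σ'.ι x) σ'.e σ'.e_i fun x k => by
    rw [comp_fA, h, σ'.ι_b]

/-- Uniqueness of substitution. -/
lemma subst_unique {R S S' : JKGraph} (hR : R.NoIsolatedEdges) {F : Species}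
    {ψ : nerve.obj R ⟶ bar F} {φ : nerve.obj S ⟶ F} {φ' : nerve.obj S' ⟶ F} (σ : Subst ψ φ)
    (σ' : Subst ψ φ') :
    ∃ θ : S ≅ S', (∀ a, θ.hom.fA (σ.e a) = σ'.e a) ∧ nerve.map θ.hom ≫ φ' = φ := by
  choose θ h1 h2 using fun x => cls_exact ((σ.dec x).trans (σ'.dec x).symm)
  obtain ⟨g, g1, g2⟩ := subst_hom hR σ σ' (fun x => (θ x).hom) h1
  obtain ⟨g', g1', _⟩ := subst_hom hR σ' σ (fun x => (θ x).inv) (fun x k => by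
    rw [← h1]; exact iso_hom_inv_fA _ _)
  refine ⟨⟨g, g', σ.hom_ext hR fun x => ?_, σ'.hom_ext hR fun x => ?_⟩, g2,
    σ.dec_ext hR fun x => ?_⟩
  · rw [← Category.assoc, g1, Category.assoc, g1', ← Category.assoc]
    simp
  · rw [← Category.assoc, g1', Category.assoc, g1, ← Category.assoc]
    simp
  · rw [← Category.assoc, ← Functor.map_comp, g1, Functor.map_comp, Category.assoc]
    exact h2 x

/-- Transport of a substitution along an isomorphism. -/
def Subst.ofIso {R R' S : JKGraph} {F : Species} (θ : R ≅ R') {ψ : nerve.obj R' ⟶ bar F}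
    {φ : nerve.obj S ⟶ F} (σ : Subst ψ φ) : Subst (nerve.map θ.hom ≫ ψ) φ where
  piece x := (σ.piece (θ.hom.fV x)).relabel _ (flagMap_bij θ.hom x)
  ι x := σ.ι (θ.hom.fV x)
  e a := σ.e (θ.hom.fA a)
  e_i a := by rw [θ.hom.map_i, σ.e_i]
  ι_b x k := by
    rw [θ.hom.map_i, θ.hom.map_s]
    exact σ.ι_b _ _
  bijV := by
    have h := σ.bijV
    constructor
    · rintro ⟨x, v⟩ ⟨y, w⟩ e
      have e1 : (⟨θ.hom.fV x, v⟩ : Σ x, (σ.piece x).G.V) = ⟨θ.hom.fV y, w⟩ := h.1 e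
      obtain rfl : x = y := (bijective_fV θ).1 (congrArg Sigma.fst e1)
      have e2 : v = w := eq_of_heq (Sigma.mk.inj_iff.1 e1).2
      rw [e2]
    · intro v
      obtain ⟨⟨x, w⟩, hw⟩ := h.2 v
      obtain ⟨y, rfl⟩ := (bijective_fV θ).2 x
      exact ⟨⟨y, w⟩, hw⟩
  ports := by
    refine σ.ports.comp ⟨fun a ha => (isPort_iso θ).2 ha, (bijective_fA θ).1.injOn, ?_⟩
    intro a ha
    obtain ⟨b, rfl⟩ := (bijective_fA θ).2 a
    exact ⟨b, (isPort_iso θ).1 ha, rfl⟩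
  dec x := by
    rw [at_nerve, at_star_comp θ.hom ψ x _ (σ.dec _)]
    rfl

/-- The decorated `n`-graph resulting from a substitution. -/
def Subst.toDec {F : Species} {n : Type} (X : DecGraph (bar F) n) {S : JKGraph}
    {φ : nerve.obj S ⟶ F} (σ : Subst X.φ φ) : DecGraph F n where
  G := S
  eff := σ.effective X.eff
  b k := σ.e (X.b k)
  b_inj := σ.e_inj.comp X.b_inj
  b_port a := by
    constructor
    · intro ha
      obtain ⟨r, hr, rfl⟩ := σ.ports.2.2 ha
      obtain ⟨k, rfl⟩ := (X.b_port r).1 hr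
      exact ⟨k, rfl⟩
    · rintro ⟨k, rfl⟩
      exact σ.isPort_e.2 ((X.b_port _).2 ⟨k, rfl⟩)
  φ := φ

lemma toDec_eq {F : Species} {n : Type} {hn : Finite n} {X Y : DecGraph (bar F) n}
    (θ : X.G ≅ Y.G) (h1 : ∀ k, θ.hom.fA (X.b k) = Y.b k) (h2 : nerve.map θ.hom ≫ Y.φ = X.φ)
    {S S' : JKGraph} {φ : nerve.obj S ⟶ F} {φ' : nerve.obj S' ⟶ F}
    (σ : Subst X.φ φ) (σ' : Subst Y.φ φ') :
    (cls (σ.toDec X) : (bar F).obj (op (corolla n hn))) = cls (σ'.toDec Y) := by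
  obtain ⟨τ, t1, t2⟩ := subst_unique X.eff.2 σ (h2 ▸ σ'.ofIso θ)
  refine cls_eq τ (fun k => ?_) t2
  refine (t1 (X.b k)).trans ?_
  have : ∀ (ψ : nerve.obj X.G ⟶ bar F) (e : nerve.map θ.hom ≫ Y.φ = ψ),
      (e ▸ σ'.ofIso θ : Subst ψ φ').e = (σ'.ofIso θ).e := by
    rintro _ rfl; rfl
  rw [this]
  change σ'.e (θ.hom.fA (X.b k)) = σ'.e (Y.b k)
  rw [h1]

/-- The result of substitution, as an isomorphism class. -/
noncomputable def muCls {F : Species} {n : Type} (hn : Finite n) (X : DecGraph (bar F) n) :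
    (bar F).obj (op (corolla n hn)) :=
  cls ((exists_subst X.eff.2 X.φ).choose_spec.choose_spec.some.toDec X)

lemma muCls_eq {F : Species} {n : Type} {hn : Finite n} (X : DecGraph (bar F) n) {S : JKGraph}
    {φ : nerve.obj S ⟶ F} (σ : Subst X.φ φ) : muCls hn X = cls (σ.toDec X) :=
  toDec_eq (Iso.refl _) (fun _ => rfl) (by simp) _ _

/-- Components of the multiplication of the monad. -/
noncomputable def muObj (F : Species) : (E : El) → (bar (bar F)).obj (op E) → (bar F).obj (op E)
  | unit => fun x => x
  | corolla n hn => Quotient.lift (muCls hn) <| by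
      rintro X Y ⟨θ, h1, h2⟩
      exact toDec_eq θ h1 h2 _ _

/-- The multiplication of the monad: substitute the graphs decorating the vertices. -/
noncomputable def mu (F : Species) : bar (bar F) ⟶ bar F :=
  mkHom (muObj F) fun E E' t x => by
    match E, E', t, x with
    | unit, unit, t, x => rfl
    | unit, corolla n hn, t, x =>
      obtain ⟨X, rfl⟩ := cls_ind x
      obtain ⟨S, φ, ⟨σ⟩⟩ := exists_subst X.eff.2 X.φ
      have e1 : muObj F (corolla n hn) (cls X) = cls (σ.toDec X) := muCls_eq X σ
      rw [e1]
      change col X.φ (X.ext _) = col φ ((σ.toDec X).ext _)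
      refine (σ.col_e X.eff.2 _).symm.trans ?_
      have key : ∀ a, σ.e (X.ext a) = (σ.toDec X).ext a := by
        rintro (k | k)
        · rfl
        · exact σ.e_i _
      rw [key]
    | corolla m hm, corolla n hn, t, x =>
      obtain ⟨X, rfl⟩ := cls_ind x
      obtain ⟨S, φ, ⟨σ⟩⟩ := exists_subst X.eff.2 X.φ
      have e1 : muObj F (corolla n hn) (cls X) = cls (σ.toDec X) := muCls_eq X σ
      have e2 : muObj F (corolla m hm) (cls (X.relabel (toGraph t).fH (bijective_fH (toGraph t))))
        = cls (Subst.toDec (X.relabel (toGraph t).fH (bijective_fH (toGraph t))) σ) :=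
          muCls_eq (X.relabel (toGraph t).fH (bijective_fH (toGraph t))) σ
      rw [e1, pull_cls, pull_cls, e2]
      rfl
    | corolla _ _, unit, t, _ => exact ((toGraph t).fV ()).elim

lemma mu_cls {F : Species} {n : Type} {hn : Finite n} (X : DecGraph (bar F) n) {S : JKGraph}
    {φ : nerve.obj S ⟶ F} (σ : Subst X.φ φ) :
    ev (mu F) (E := corolla n hn) (cls X) = cls (σ.toDec X) := muCls_eq X σ

lemma mu_unit {F : Species} (x : (bar (bar F)).obj (op unit)) :
    ev (mu F) (E := unit) x = x := rfl

/-- Substitution is natural in the species of decorations. -/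
def Subst.map {R S : JKGraph} {F G : Species} {ψ : nerve.obj R ⟶ bar F} {φ : nerve.obj S ⟶ F}
    (σ : Subst ψ φ) (α : F ⟶ G) : Subst (ψ ≫ barMap α) (φ ≫ α) where
  toGluing := σ.toGluing
  dec x := by
    rw [at_comp_right, ← σ.dec x, barMap_cls]
    rfl

/-- Substitution of corollas. -/
def Subst.corollas {S : JKGraph} {F : Species} (φ : nerve.obj S ⟶ F) :
    Subst (φ ≫ eta F) φ where
  piece x := corN (S.Flags x) inferInstance
  ι x := star x
  e a := a
  e_i _ := rfl
  ι_b _ _ := rfl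
  bijV := ⟨by rintro ⟨x, ⟨⟩⟩ ⟨y, ⟨⟩⟩ e; cases (show x = y from e); rfl, fun v => ⟨⟨v, ()⟩, rfl⟩⟩
  ports := ⟨fun _ h => h, fun _ _ _ _ e => e, fun a h => ⟨a, h, rfl⟩⟩
  dec x := by
    rw [at_comp_right, eta_corolla]
    congr 1
    unfold corDec
    congr 1
    exact eq_yo (E := corolla (S.Flags x) inferInstance) _

/-- Substitution into a corolla. -/
def Subst.intoCorolla {F : Species} {n : Type} (hn : Finite n) (X : DecGraph F n) :
    Subst (R := corollaGraph n hn) (yo (F := bar F) (E := corolla n hn) (cls X)) X.φ where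
  piece x := X.toNGraph.relabel (fun k => k.1)
    ⟨Subtype.val_injective, fun k => ⟨⟨k, rfl⟩, rfl⟩⟩
  ι x := 𝟙 _
  e := X.ext
  e_i := X.ext_swap
  ι_b _ _ := rfl
  bijV := ⟨by rintro ⟨⟨⟩, v⟩ ⟨⟨⟩, w⟩ e; cases (show v = w from e); rfl, fun v => ⟨⟨(), v⟩, rfl⟩⟩
  ports := by
    refine ⟨?_, ?_, ?_⟩
    · rintro (k | k) h
      · exact (X.b_port _).2 ⟨k, rfl⟩
      · exact (h k rfl).elim
    · rintro (k | k) hk (l | l) hl e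
      · rw [X.b_inj e]
      · exact (hl l rfl).elim
      · exact (hk k rfl).elim
      · exact (hl l rfl).elim
    · intro a ha
      obtain ⟨k, rfl⟩ := (X.b_port a).1 ha
      refine ⟨Sum.inl k, fun h e => ?_, rfl⟩
      cases e
  dec x := by
    rw [at_yo]
    refine Eq.trans ?_ (pull_cls X _).symm
    refine cls_eq (Iso.refl _) (fun _ => rfl) ?_
    rfl

/-- Iterated substitution. -/
lemma Subst.exists_comp {P R S : JKGraph} {F : Species} (hP : P.NoIsolatedEdges)
    {χ : nerve.obj P ⟶ bar (bar F)} {ψ : nerve.obj R ⟶ bar F} {φ : nerve.obj S ⟶ F}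
    (σ : Subst χ ψ) (τ : Subst ψ φ) :
    ∃ ω : Subst (χ ≫ mu F) φ, (∀ a, ω.e a = τ.e (σ.e a)) ∧
      ∀ x v, ∃ y w, (ω.ι x).fV v = (τ.ι ((σ.ι x).fV y)).fV w := by
  have hR := σ.noIsolatedEdges hP
  choose Q ρ hQ using fun x : P.V =>
    exists_subst (σ.piece x).eff.2 (nerve.map (σ.ι x) ≫ ψ)
  let w : ∀ x, Subst (nerve.map (σ.ι x) ≫ ψ) (ρ x) := fun x => (hQ x).some
  have hiso : ∀ x (y : (σ.piece x).G.V), ∃ θ : ((w x).piece y).G ≅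
      (τ.piece ((σ.ι x).fV y)).G,
      (∀ k, θ.hom.fA (((w x).piece y).b k) =
        (τ.piece ((σ.ι x).fV y)).b (flagMap (σ.ι x) y k)) ∧
      nerve.map θ.hom ≫ nerve.map (τ.ι _) ≫ φ = nerve.map ((w x).ι y) ≫ ρ x := by
    intro x y
    have h1 := (w x).dec y
    rw [at_nerve, at_star_comp (σ.ι x) ψ y _ (τ.dec _)] at h1
    exact cls_exact h1
  choose θ θ1 θ2 using hiso
  have hκ := fun x => (w x).exists_desc (σ.piece x).eff.2
    (fun y => (θ x y).hom ≫ τ.ι _) (fun a => τ.e ((σ.ι x).fA a))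
    (fun a => by rw [(σ.ι x).map_i, τ.e_i])
    (fun y k => by
      rw [comp_fA, θ1, τ.ι_b, (σ.ι x).map_i, (σ.ι x).map_s]
      rfl)
  choose κ κ1 κ2 using hκ
  have hκφ : ∀ x, nerve.map (κ x) ≫ φ = ρ x := fun x =>
    (w x).dec_ext (σ.piece x).eff.2 fun y => by
      rw [← Category.assoc, ← Functor.map_comp, κ1, Functor.map_comp, Category.assoc, θ2]
  have hκV : ∀ x y v, (κ x).fV (((w x).ι y).fV v) = (τ.ι _).fV ((θ x y).hom.fV v) :=
    fun x y v => congrArg (fun f => f.fV v) (κ1 x y)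
  refine ⟨
    { piece := fun x =>
        ((w x).toDec ⟨σ.piece x, nerve.map (σ.ι x) ≫ ψ⟩).toNGraph
      ι := κ
      e := fun a => τ.e (σ.e a)
      e_i := fun a => by rw [σ.e_i, τ.e_i]
      ι_b := fun x k => by
        rw [← σ.ι_b]
        exact κ2 x _
      bijV := ?_
      ports := τ.ports.comp σ.ports
      dec := fun x => ?_ }, fun _ => rfl, fun x v => ?_⟩
  · constructor
    · rintro ⟨x, v⟩ ⟨x', v'⟩ e
      obtain ⟨y, u, rfl⟩ := (w x).surjV v
      obtain ⟨y', u', rfl⟩ := (w x').surjV v'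
      have e1 : (τ.ι _).fV ((θ x y).hom.fV u) = (τ.ι _).fV ((θ x' y').hom.fV u') := by
        rw [← hκV, ← hκV]
        exact e
      have e2 : (⟨_, (θ x y).hom.fV u⟩ : Σ z, (τ.piece z).G.V) = ⟨_, (θ x' y').hom.fV u'⟩ :=
        τ.bijV.1 e1
      have e3 : (⟨x, y⟩ : Σ x, (σ.piece x).G.V) = ⟨x', y'⟩ := σ.bijV.1 (congrArg Sigma.fst e2)
      obtain rfl : x = x' := congrArg Sigma.fst e3
      obtain rfl : y = y' := by simpa using e3
      have e4 : (θ x y).hom.fV u = (θ x y).hom.fV u' := by simpa using e2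
      rw [(bijective_fV (θ x y)).1 e4]
    · intro v
      obtain ⟨z, u, rfl⟩ := τ.surjV v
      obtain ⟨x, y, rfl⟩ := σ.surjV z
      obtain ⟨u', rfl⟩ := (bijective_fV (θ x y)).2 u
      exact ⟨⟨x, ((w x).ι y).fV u'⟩, hκV x y u'⟩
  · rw [at_comp_right, ← σ.dec x, mu_cls _ (w x)]
    refine cls_eq (Iso.refl _) (fun _ => rfl) ?_
    change nerve.map (𝟙 _) ≫ ρ x = nerve.map (κ x) ≫ φ
    rw [hκφ]
    simp
  · obtain ⟨y, u, rfl⟩ := (w x).surjV v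
    exact ⟨y, _, hκV x y u⟩

/-- The monad on graphical species whose algebras are the compact coloured props. -/
noncomputable def monad : Monad Species where
  toFunctor := T
  η :=
    { app := eta
      naturality := fun F G α => ev_ext fun E x => by
        cases E with
        | unit => rfl
        | corolla n hn =>
          change cls (corDec n hn (ev α x)) = cls ((corDec n hn x).mapDec α)
          refine cls_eq (Iso.refl _) (fun _ => rfl) ?_
          refine at_ext fun E f => ?_
          exact ev_pull α (f : E ⟶ _) x }
  μ :=
    { app := mu
      naturality := fun F G α => ev_ext fun E x => by
        cases E with
        | unit => rfl
        | corolla n hn =>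
          obtain ⟨X, rfl⟩ := cls_ind x
          obtain ⟨S, φ, ⟨σ⟩⟩ := exists_subst X.eff.2 X.φ
          change ev (mu G) (cls (X.mapDec (barMap α))) = ev (barMap α) (ev (mu F) (cls X))
          rw [mu_cls X σ, mu_cls (X.mapDec (barMap α)) (σ.map α)]
          rfl }
  assoc F := ev_ext fun E x => by
    cases E with
    | unit => rfl
    | corolla n hn =>
      obtain ⟨X, rfl⟩ := cls_ind (F := bar (bar F)) x
      obtain ⟨R, ψ, ⟨σ⟩⟩ := exists_subst X.eff.2 X.φ
      obtain ⟨S, φ, ⟨τ⟩⟩ := exists_subst (σ.toDec X).eff.2 ψ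
      obtain ⟨ω, hω, _⟩ := Subst.exists_comp X.eff.2 σ τ
      change ev (mu F) (cls (X.mapDec (mu F))) = ev (mu F) (ev (mu (bar F)) (cls X))
      rw [mu_cls X σ, mu_cls (σ.toDec X) τ, mu_cls (X.mapDec (mu F)) ω]
      exact cls_eq (Iso.refl _) (fun k => hω _) (by
        change nerve.map (𝟙 _) ≫ φ = φ
        simp)
  left_unit F := ev_ext fun E x => by
    cases E with
    | unit => rfl
    | corolla n hn =>
      obtain ⟨X, rfl⟩ := cls_ind x
      change ev (mu F) (cls (corDec n hn (cls X))) = cls X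
      rw [mu_cls (corDec n hn (cls X)) (Subst.intoCorolla hn X)]
      exact cls_eq (Iso.refl _) (fun k => rfl) (by
        change nerve.map (𝟙 _) ≫ X.φ = X.φ
        simp)
  right_unit F := ev_ext fun E x => by
    cases E with
    | unit => rfl
    | corolla n hn =>
      obtain ⟨X, rfl⟩ := cls_ind x
      change ev (mu F) (cls (X.mapDec (eta F))) = cls X
      rw [mu_cls (X.mapDec (eta F)) (Subst.corollas X.φ)]
      exact cls_eq (Iso.refl _) (fun k => rfl) (by
        change nerve.map (𝟙 _) ≫ X.φ = X.φ
        simp)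

end CCP

/-! ## The restricted Kleisli category -/

open Limits

/-- Graphs without isolated edges. -/
structure NIGraph : Type 1 where
  graph : JKGraph
  noIsolatedEdges : graph.NoIsolatedEdges

/-- The restricted Kleisli category: the full subcategory of the Kleisli category of the monad
given by the graphs without isolated edges. -/
abbrev KGr := InducedCategory (Kleisli CCP.monad)
  (fun R : NIGraph => Kleisli.mk CCP.monad (nerve.obj R.graph))

namespace KGr
open CCP

/-- The underlying graph of an object of the restricted Kleisli category. -/
abbrev gr (R : KGr) : JKGraph := NIGraph.graph R

lemma ni (R : KGr) : R.gr.NoIsolatedEdges := NIGraph.noIsolatedEdges R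

/-- The underlying morphism of species of a Kleisli morphism. -/
def dec {R S : KGr} (k : R ⟶ S) : nerve.obj R.gr ⟶ bar (nerve.obj S.gr) := k.hom.of

/-- The Kleisli morphism with given underlying morphism of species. -/
def ofDec {R S : KGr} (k : nerve.obj R.gr ⟶ bar (nerve.obj S.gr)) : R ⟶ S := ⟨⟨k⟩⟩

/-- The free morphism given by an etale morphism. -/
noncomputable def free {R S : KGr} (f : R.gr ⟶ S.gr) : R ⟶ S :=
  ⟨(Kleisli.Adjunction.toKleisli monad).map (nerve.map f)⟩

/-- Free morphisms on reduced covers. -/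
def IsRedCov {R S : KGr} (k : R ⟶ S) : Prop := ∃ f : R.gr ⟶ S.gr, IsReducedCover f ∧ k = free f

/-- A Kleisli morphism `R ⟶ Y` is generic if the colimit graph `S` obtained by substituting the
images of the vertices into `R` maps isomorphically to `Y`. -/
def IsGeneric {R Y : KGr} (k : R ⟶ Y) : Prop :=
  ∃ (S : JKGraph) (π : S ⟶ Y.gr), Nonempty (Subst (dec k) (nerve.map π)) ∧ IsIso π

lemma dec_ext {R S : KGr} {k l : R ⟶ S} (h : dec k = dec l) : k = l := by
  apply InducedCategory.hom_ext
  exact Kleisli.hom_ext h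

@[simp] lemma dec_ofDec {R S : KGr} (k : nerve.obj R.gr ⟶ bar (nerve.obj S.gr)) :
    dec (ofDec k : R ⟶ S) = k := rfl

lemma dec_comp {R S Y : KGr} (k : R ⟶ S) (l : S ⟶ Y) :
    dec (k ≫ l) = dec k ≫ barMap (dec l) ≫ mu _ := rfl

lemma dec_id (R : KGr) : dec (𝟙 R) = eta _ := rfl

lemma dec_free {R S : KGr} (f : R.gr ⟶ S.gr) :
    dec (free f : R ⟶ S) = nerve.map f ≫ eta _ := rfl

lemma eta_nat {F G : Species} (α : F ⟶ G) : α ≫ eta G = eta F ≫ barMap α :=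
  monad.η.naturality α

lemma dec_free_comp {R S Y : KGr} (f : R.gr ⟶ S.gr) (l : S ⟶ Y) :
    dec ((free f : R ⟶ S) ≫ l) = nerve.map f ≫ dec l := by
  rw [dec_comp, dec_free, Category.assoc, ← Category.assoc (eta _), ← eta_nat, Category.assoc]
  have h : eta (bar (nerve.obj Y.gr)) ≫ mu (nerve.obj Y.gr) = 𝟙 _ := monad.left_unit _
  rw [h, Category.comp_id]

lemma dec_comp_free {R S Y : KGr} (k : R ⟶ S) (f : S.gr ⟶ Y.gr) :
    dec (k ≫ (free f : S ⟶ Y)) = dec k ≫ barMap (nerve.map f) := by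
  rw [dec_comp, dec_free]
  have h1 : barMap (nerve.map f ≫ eta (nerve.obj Y.gr)) =
      barMap (nerve.map f) ≫ barMap (eta _) := T.map_comp _ _
  have h2 : barMap (eta (nerve.obj Y.gr)) ≫ mu (nerve.obj Y.gr) = 𝟙 _ := monad.right_unit _
  rw [h1, Category.assoc, h2, Category.comp_id]

lemma free_comp {R S Y : KGr} (f : R.gr ⟶ S.gr) (g : S.gr ⟶ Y.gr) :
    (free f : R ⟶ S) ≫ (free g : S ⟶ Y) = free (f ≫ g) :=
  dec_ext (by rw [dec_free_comp, dec_free, dec_free, Functor.map_comp, Category.assoc])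

lemma free_id (R : KGr) : (free (𝟙 R.gr) : R ⟶ R) = 𝟙 R :=
  dec_ext (by rw [dec_free, dec_id]; simp)

/-- Transport of a substitution along an isomorphism of the result. -/
def substPostIso {R S S' : JKGraph} {F : Species} {ψ : nerve.obj R ⟶ bar F}
    {φ : nerve.obj S ⟶ F} {φ' : nerve.obj S' ⟶ F} (σ : Subst ψ φ) (θ : S ≅ S')
    (h : nerve.map θ.hom ≫ φ' = φ) : Subst ψ φ' where
  piece := σ.piece
  ι x := σ.ι x ≫ θ.hom
  e a := θ.hom.fA (σ.e a)
  e_i a := by rw [σ.e_i, θ.hom.map_i]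
  ι_b x k := congrArg θ.hom.fA (σ.ι_b x k)
  bijV := (bijective_fV θ).comp σ.bijV
  ports := by
    refine Set.BijOn.comp (t := {a | S.IsPort a})
      ⟨fun a ha => (isPort_iso θ).2 ha, (bijective_fA θ).1.injOn, ?_⟩ σ.ports
    intro a ha
    obtain ⟨b, rfl⟩ := (bijective_fA θ).2 a
    exact ⟨b, (isPort_iso θ).1 ha, rfl⟩
  dec x := by
    rw [← σ.dec x, Functor.map_comp, Category.assoc, h]

lemma isGeneric_iff {R Y : KGr} (k : R ⟶ Y) :
    IsGeneric k ↔ Nonempty (Subst (dec k) (𝟙 (nerve.obj Y.gr))) := by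
  constructor
  · rintro ⟨S, π, ⟨σ⟩, hπ⟩
    exact ⟨substPostIso σ (asIso π) (by simp)⟩
  · rintro ⟨σ⟩
    exact ⟨Y.gr, 𝟙 _, ⟨by rw [nerve.map_id]; exact σ⟩, inferInstance⟩

lemma isGeneric_id (R : KGr) : IsGeneric (𝟙 R) := by
  rw [isGeneric_iff, dec_id]
  exact ⟨by simpa using Subst.corollas (𝟙 (nerve.obj R.gr))⟩

lemma isGeneric_comp {R S Y : KGr} {k : R ⟶ S} {l : S ⟶ Y} (hk : IsGeneric k)
    (hl : IsGeneric l) : IsGeneric (k ≫ l) := by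
  rw [isGeneric_iff] at *
  obtain ⟨σ⟩ := hk
  obtain ⟨τ⟩ := hl
  have σ' := σ.map (dec l)
  rw [Category.id_comp] at σ'
  obtain ⟨ω, _⟩ := Subst.exists_comp R.ni σ' τ
  rw [Category.assoc] at ω
  exact ⟨ω⟩

lemma isRedCov_id (R : KGr) : IsRedCov (𝟙 R) :=
  ⟨𝟙 _, (isReducedCover_iff R.ni _).2 ⟨Function.surjective_id, Function.bijective_id⟩,
    (free_id R).symm⟩

lemma isRedCov_comp {R S Y : KGr} {k : R ⟶ S} {l : S ⟶ Y} (hk : IsRedCov k)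
    (hl : IsRedCov l) : IsRedCov (k ≫ l) := by
  obtain ⟨f, hf, rfl⟩ := hk
  obtain ⟨g, hg, rfl⟩ := hl
  rw [isReducedCover_iff R.ni] at hf
  rw [isReducedCover_iff S.ni] at hg
  exact ⟨f ≫ g, (isReducedCover_iff R.ni _).2 ⟨hg.1.comp hf.1, hg.2.comp hf.2⟩,
    free_comp f g⟩

/-- Covers are epimorphisms in the restricted Kleisli category. -/
lemma free_cancel {R S Y : KGr} (f : R.gr ⟶ S.gr) (hA : Function.Surjective f.fA)
    (hV : Function.Surjective f.fV) {k l : S ⟶ Y}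
    (h : (free f : R ⟶ S) ≫ k = free f ≫ l) : k = l := by
  apply dec_ext
  refine cover_ext (I := Unit) (X := fun _ => R.gr) (fun _ => f)
    (fun v => ⟨(), hV v⟩) (fun a => ⟨(), hA a⟩) fun _ => ?_
  rw [← dec_free_comp, ← dec_free_comp, h]

/-- Descent of decorations along reduced covers. -/
lemma exists_descent_cover {X Y : JKGraph} (f : X ⟶ Y) (hA : Function.Surjective f.fA)
    (hV : Function.Bijective f.fV) {F : Species} (φ : nerve.obj X ⟶ F)
    (h : ∀ a b, f.fA a = f.fA b → col φ a = col φ b) :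
    ∃ ψ : nerve.obj Y ⟶ F, nerve.map f ≫ ψ = φ := by
  obtain ⟨ψ, hψ⟩ := exists_descent (I := Unit) (X := fun _ => X) (fun _ => f)
    (hV.comp (Equiv.punitProd X.V |>.bijective.comp
      (Equiv.sigmaEquivProd Unit X.V).bijective)) (fun a => ⟨(), hA a⟩) (fun _ => φ)
    (fun _ _ a b => h a b)
  exact ⟨ψ, hψ ()⟩

/-- The terminal species. -/
def terminalSpecies : Species := (Functor.const _).obj PUnit

/-- The morphism to the terminal species. -/
def toTerminal (F : Species) : F ⟶ terminalSpecies :=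
  mkHom (fun _ _ => PUnit.unit) fun _ _ _ _ => rfl

lemma cls_relabel_inj {F : Species} {m n : Type} {hm : Finite m} {hn : Finite n}
    {D D' : DecGraph F n} (u : m → n) (hu : Function.Bijective u)
    (h : (cls (D.relabel u hu) : (bar F).obj (op (corolla m hm))) = cls (D'.relabel u hu)) :
    (cls D : (bar F).obj (op (corolla n hn))) = cls D' := by
  obtain ⟨θ, h1, h2⟩ := cls_exact h
  refine cls_eq θ (fun k => ?_) h2
  obtain ⟨l, rfl⟩ := hu.2 k
  exact h1 l

/-- Colours of arcs in `F̄`-decorated graphs are colours of `F`. -/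
def colBar {X : JKGraph} {F : Species} (ψ : nerve.obj X ⟶ bar F) (a : X.A) : F.obj (op unit) :=
  (col ψ a : (bar F).obj (op unit))

lemma col_generic {R S : KGr} {k : R ⟶ S} (σ : Subst (dec k) (𝟙 (nerve.obj S.gr)))
    (r : R.gr.A) : colBar (dec k) r =
      ULift.up (arc (σ.e r)) := (σ.col_e R.ni r).symm

lemma col_comp {R S Y : KGr} {k : R ⟶ S} (σ : Subst (dec k) (𝟙 (nerve.obj S.gr)))
    (l : S ⟶ Y) (r : R.gr.A) : col (dec (k ≫ l)) r = col (dec l) (σ.e r) := by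
  have h : col (dec (k ≫ l)) r = ev (dec l) (E := unit) (colBar (dec k) r) := rfl
  rw [h, col_generic σ]
  rfl

/-- Reduced covers and generic morphisms admit pushouts along each other, and the resulting
morphisms are again a reduced cover and a generic morphism. -/
theorem exists_pushout {R R' S : KGr} (f : R ⟶ R') (k : R ⟶ S) (hf : IsRedCov f)
    (hk : IsGeneric k) :
    ∃ (S' : KGr) (k' : R' ⟶ S') (u : S ⟶ S'), IsPushout f k k' u ∧ IsGeneric k' ∧
      IsRedCov u := by
  obtain ⟨f, hf, rfl⟩ := hf
  rw [isReducedCover_iff R.ni] at hf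
  obtain ⟨fA, fV⟩ := hf
  rw [isGeneric_iff] at hk
  obtain ⟨σ⟩ := hk
  -- the glued graph
  obtain ⟨ψ, hψ⟩ := exists_descent_cover f fA fV (dec k ≫ barMap (toTerminal _))
    (fun _ _ _ => rfl)
  obtain ⟨S', φ', ⟨gl⟩⟩ := exists_subst R'.ni ψ
  have hθ : ∀ x, ∃ θ : (σ.piece x).G ≅ (gl.piece (f.fV x)).G,
      ∀ k, θ.hom.fA ((σ.piece x).b k) = (gl.piece (f.fV x)).b (flagMap f x k) := by
    intro x
    have h1 : at' (E := corolla (R.gr.Flags x) inferInstance) ψ (star x ≫ f) =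
        ev (barMap (toTerminal _)) (at' (E := corolla (R.gr.Flags x) inferInstance) (dec k)
          (star x)) :=
      congrArg (fun φ => at' (E := corolla (R.gr.Flags x) inferInstance) φ (star x)) hψ
    rw [at_star_comp f ψ x _ (gl.dec _), ← σ.dec x, barMap_cls] at h1
    obtain ⟨θ, h2, _⟩ := cls_exact h1.symm
    exact ⟨θ, h2⟩
  choose θ hθ using hθ
  let S'' : KGr := (⟨S', gl.noIsolatedEdges R'.ni⟩ : NIGraph)
  obtain ⟨u, hu1, hu2⟩ := σ.exists_desc R.ni (fun x => (θ x).hom ≫ gl.ι (f.fV x))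
    (fun a => gl.e (f.fA a)) (fun a => by rw [f.map_i, gl.e_i]) (fun x k => by
      rw [comp_fA, hθ, gl.ι_b, f.map_i, f.map_s]
      rfl)
  have huA : ∀ x a, u.fA ((σ.ι x).fA a) = (gl.ι (f.fV x)).fA ((θ x).hom.fA a) := fun x a =>
    congrArg (fun g => g.fA a) (hu1 x)
  have huV : ∀ x a, u.fV ((σ.ι x).fV a) = (gl.ι (f.fV x)).fV ((θ x).hom.fV a) := fun x a =>
    congrArg (fun g => g.fV a) (hu1 x)
  have uA : Function.Surjective u.fA := by
    intro a
    obtain ⟨x, b, rfl⟩ := gl.surjA R'.ni a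
    obtain ⟨y, rfl⟩ := fV.2 x
    obtain ⟨c, rfl⟩ := (bijective_fA (θ y)).2 b
    exact ⟨_, huA y c⟩
  have uV : Function.Bijective u.fV := by
    constructor
    · intro v w e
      obtain ⟨x, a, rfl⟩ := σ.surjV v
      obtain ⟨y, b, rfl⟩ := σ.surjV w
      rw [huV, huV] at e
      have e1 : (⟨_, (θ x).hom.fV a⟩ : Σ z, (gl.piece z).G.V) = ⟨_, (θ y).hom.fV b⟩ :=
        gl.bijV.1 e
      obtain rfl : x = y := fV.1 (congrArg Sigma.fst e1)
      have e2 : (θ x).hom.fV a = (θ x).hom.fV b := eq_of_heq (Sigma.mk.inj_iff.1 e1).2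
      rw [(bijective_fV (θ x)).1 e2]
    · intro v
      obtain ⟨x, b, rfl⟩ := gl.surjV v
      obtain ⟨y, rfl⟩ := fV.2 x
      obtain ⟨c, rfl⟩ := (bijective_fV (θ y)).2 b
      exact ⟨_, huV y c⟩
  have hover : ∀ a r', u.fA a = gl.e r' → ∃ r, a = σ.e r ∧ f.fA r = r' := by
    intro a r' h
    obtain ⟨x, b, rfl⟩ := σ.surjA R.ni a
    rw [huA] at h
    obtain ⟨l, h1⟩ := gl.over_e h
    obtain ⟨l, rfl⟩ := (flagMap_bij f x).2 l
    rcases h1 with ⟨h1, rfl⟩ | ⟨h1, rfl⟩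
    · rw [← hθ] at h1
      rw [(bijective_fA (θ x)).1 h1, σ.ι_b]
      exact ⟨_, rfl, by rw [f.map_i, f.map_s]; rfl⟩
    · rw [← hθ, ← (θ x).hom.map_i] at h1
      rw [(bijective_fA (θ x)).1 h1, (σ.ι x).map_i, σ.ι_b, ← σ.e_i, R.gr.i_i]
      exact ⟨_, rfl, by rw [f.map_s]; rfl⟩
  have hident : ∀ a b, u.fA a = u.fA b →
      a = b ∨ ∃ r r', a = σ.e r ∧ b = σ.e r' ∧ f.fA r = f.fA r' := by
    intro a b h
    obtain ⟨x, a, rfl⟩ := σ.surjA R.ni a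
    obtain ⟨y, b, rfl⟩ := σ.surjA R.ni b
    have h' := h
    rw [huA, huA] at h'
    rcases gl.ident h' with e1 | ⟨r, hr⟩
    · left
      obtain rfl : x = y := fV.1 (congrArg Sigma.fst e1)
      have e2 : (θ x).hom.fA a = (θ x).hom.fA b := eq_of_heq (Sigma.mk.inj_iff.1 e1).2
      rw [(bijective_fA (θ x)).1 e2]
    · right
      rw [← huA] at hr
      obtain ⟨r1, h1, h2⟩ := hover _ _ hr
      obtain ⟨r2, h3, h4⟩ := hover _ _ (h ▸ hr)
      exact ⟨r1, r2, h1, h3, h2.trans h4.symm⟩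
  -- the generic morphism
  have hk' : ∃ k' : nerve.obj R'.gr ⟶ bar (nerve.obj S'),
      nerve.map f ≫ k' = dec k ≫ barMap (nerve.map u) := by
    refine exists_descent_cover f fA fV _ fun a b h => ?_
    have key : ∀ a, colBar (dec k ≫ barMap (nerve.map u)) a =
        ULift.up (arc (gl.e (f.fA a))) := fun a => by
      have h1 : colBar (dec k ≫ barMap (nerve.map u)) a =
        ev (nerve.map u) (E := unit) (colBar (dec k) a) := rfl
      rw [h1, col_generic σ, ← hu2]
      exact congrArg ULift.up (arc_comp _ _)
    exact (key a).trans ((congrArg (fun c => ULift.up (arc (gl.e c))) h).trans (key b).symm)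
  obtain ⟨k', hk'⟩ := hk'
  let K : R' ⟶ S'' := ofDec k'
  let U : S ⟶ S'' := free u
  have hK : IsGeneric K := by
    rw [isGeneric_iff]
    refine ⟨{ gl.toGluing with dec := fun x' => ?_ }⟩
    obtain ⟨x, rfl⟩ := fV.2 x'
    change cls _ = at' (E := corolla _ _) k' (star (f.fV x))
    obtain ⟨D, hD⟩ := cls_ind (at' (E := corolla (R'.gr.Flags (f.fV x)) inferInstance) k'
      (star (f.fV x)))
    rw [← hD]
    refine cls_relabel_inj (hm := inferInstance) _ (flagMap_bij f x) ?_
    rw [← at_star_comp f k' x D hD, ← at_nerve, hk', at_comp_right, ← σ.dec x, barMap_cls]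
    refine cls_eq (θ x).symm (fun l => ?_) ?_
    · change (θ x).inv.fA ((gl.piece (f.fV x)).b (flagMap f x l)) = (σ.piece x).b l
      rw [← hθ, iso_hom_inv_fA]
    · change nerve.map (θ x).inv ≫ (nerve.map (σ.ι x) ≫ 𝟙 _) ≫ nerve.map u =
        nerve.map (gl.ι (f.fV x)) ≫ 𝟙 _
      rw [Category.comp_id, Category.comp_id, ← Functor.map_comp, hu1, ← Functor.map_comp]
      simp
  have hcomm : (free f : R ⟶ R') ≫ K = k ≫ U := by
    apply dec_ext
    rw [dec_free_comp, dec_comp_free]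
    exact hk'
  have huniv : ∀ c : PushoutCocone (free f : R ⟶ R') k,
      ∃ d : S'' ⟶ c.pt, K ≫ d = c.inl ∧ U ≫ d = c.inr := by
    intro c
    have hc : (free f : R ⟶ R') ≫ c.inl = k ≫ c.inr := c.condition
    obtain ⟨d, hd⟩ := exists_descent_cover u uA uV (dec c.inr) (fun a b h => by
      rcases hident a b h with rfl | ⟨r, r', rfl, rfl, h2⟩
      · rfl
      · rw [← col_comp σ, ← col_comp σ, ← hc, dec_free_comp, col_nerve, col_nerve, h2])
    let D : S'' ⟶ c.pt := ofDec d
    have hUD : U ≫ D = c.inr := by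
      apply dec_ext
      rw [dec_free_comp]
      exact hd
    refine ⟨D, free_cancel f fA fV.2 ?_, hUD⟩
    rw [← Category.assoc, hcomm, Category.assoc, hUD, hc]
  choose d hd1 hd2 using huniv
  refine ⟨S'', K, U, ⟨⟨hcomm⟩, ⟨PushoutCocone.IsColimit.mk _ d hd1 hd2 ?_⟩⟩, hK,
    ⟨u, (isReducedCover_iff S.ni u).2 ⟨uA, uV⟩, rfl⟩⟩
  intro c m _ h2
  refine free_cancel u uA uV.2 ?_
  exact h2.trans (hd2 c).symm

end KGr

/-! ## The category of cospans -/

open KGr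

/-- Cospans of a reduced cover and a generic (refinement) morphism in the restricted Kleisli
category. -/
structure RGCospan (T R : KGr) : Type 1 where
  apex : KGr
  left : T ⟶ apex
  right : R ⟶ apex
  left_mem : IsRedCov left
  right_mem : IsGeneric right

namespace RGCospan

/-- Isomorphism of cospans. -/
instance setoid (T R : KGr) : Setoid (RGCospan T R) where
  r c d := ∃ θ : c.apex ≅ d.apex, c.left ≫ θ.hom = d.left ∧ c.right ≫ θ.hom = d.right
  iseqv :=
    { refl := fun c => ⟨Iso.refl _, by simp, by simp⟩
      symm := by
        rintro c d ⟨θ, h1, h2⟩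
        exact ⟨θ.symm, by simp [← h1], by simp [← h2]⟩
      trans := by
        rintro c d e ⟨θ, h1, h2⟩ ⟨θ', h3, h4⟩
        exact ⟨θ ≪≫ θ', by simp [← h3, ← h1], by simp [← h4, ← h2]⟩ }

/-- The identity cospan. -/
noncomputable def id (R : KGr) : RGCospan R R := ⟨R, 𝟙 R, 𝟙 R, isRedCov_id R, isGeneric_id R⟩

/-- The cospan obtained by composing two cospans by means of a commutative square with a reduced
cover and a generic morphism. -/
noncomputable def compAlong {T R Q : KGr} (c : RGCospan T R) (d : RGCospan R Q) {P : KGr} (u : c.apex ⟶ P)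
    (v : d.apex ⟶ P) (hu : IsRedCov u) (hv : IsGeneric v) : RGCospan T Q :=
  ⟨P, c.left ≫ u, d.right ≫ v, isRedCov_comp c.left_mem hu, isGeneric_comp d.right_mem hv⟩

lemma exists_comp {T R Q : KGr} (c : RGCospan T R) (d : RGCospan R Q) :
    ∃ e : RGCospan T Q, ∃ (P : KGr) (u : c.apex ⟶ P) (v : d.apex ⟶ P) (hu : IsRedCov u)
      (hv : IsGeneric v), IsPushout c.right d.left u v ∧ e = compAlong c d u v hu hv := by
  obtain ⟨P, v, u, h, hv, hu⟩ := exists_pushout d.left c.right d.left_mem c.right_mem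
  exact ⟨_, P, u, v, hu, hv, h.flip, rfl⟩

/-- Composition of cospans by pushout. -/
noncomputable def comp {T R Q : KGr} (c : RGCospan T R) (d : RGCospan R Q) : RGCospan T Q :=
  (exists_comp c d).choose

lemma comp_rel {T R Q : KGr} {c c' : RGCospan T R} {d d' : RGCospan R Q} (hc : c ≈ c')
    (hd : d ≈ d') {P P' : KGr} {u : c.apex ⟶ P} {v : d.apex ⟶ P} {hu : IsRedCov u}
    {hv : IsGeneric v} (h : IsPushout c.right d.left u v) {u' : c'.apex ⟶ P'}
    {v' : d'.apex ⟶ P'} {hu' : IsRedCov u'} {hv' : IsGeneric v'}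
    (h' : IsPushout c'.right d'.left u' v') :
    compAlong c d u v hu hv ≈ compAlong c' d' u' v' hu' hv' := by
  obtain ⟨θ, t1, t2⟩ := hc
  obtain ⟨κ, k1, k2⟩ := hd
  have hh : IsPushout c.right d.left (θ.hom ≫ u') (κ.hom ≫ v') := by
    refine IsPushout.of_iso h' (Iso.refl _) θ.symm κ.symm (Iso.refl _) ?_ ?_ ?_ ?_
    · simp [← t2]
    · simp [← k1]
    · simp
    · simp
  refine ⟨h.isoIsPushout _ _ hh, ?_, ?_⟩
  · simp [compAlong, ← t1]
  · simp [compAlong, ← k2]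

/-- Composition can be computed by any pushout. -/
lemma comp_eq {T R Q : KGr} (c : RGCospan T R) (d : RGCospan R Q) {P : KGr} {u : c.apex ⟶ P}
    {v : d.apex ⟶ P} (hu : IsRedCov u) (hv : IsGeneric v) (h : IsPushout c.right d.left u v) :
    c.comp d ≈ compAlong c d u v hu hv := by
  obtain ⟨P', u', v', hu', hv', h', e⟩ := (exists_comp c d).choose_spec
  rw [comp, e]
  exact comp_rel (Setoid.refl _) (Setoid.refl _) h' h

lemma comp_congr {T R Q : KGr} {c c' : RGCospan T R} {d d' : RGCospan R Q} (hc : c ≈ c')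
    (hd : d ≈ d') : c.comp d ≈ c'.comp d' := by
  obtain ⟨P, u, v, hu, hv, h, e⟩ := (exists_comp c d).choose_spec
  obtain ⟨P', u', v', hu', hv', h', e'⟩ := (exists_comp c' d').choose_spec
  rw [comp, comp, e, e']
  exact comp_rel hc hd h h'

end RGCospan

/-- The category of cospans: objects are the graphs without isolated edges. -/
structure Cosp : Type 1 where
  of : KGr

/-- Morphisms of the category of cospans: isomorphism classes of cospans. -/
def CospHom (T R : KGr) : Type 1 := Quotient (RGCospan.setoid T R)

/-- The isomorphism class of a cospan. -/
def RGCospan.cls {T R : KGr} (c : RGCospan T R) : CospHom T R :=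
  Quotient.mk (RGCospan.setoid T R) c

noncomputable instance : Category Cosp where
  Hom T R := CospHom T.of R.of
  id R := (RGCospan.id R.of).cls
  comp := Quotient.map₂ RGCospan.comp fun _ _ hc _ _ hd => RGCospan.comp_congr hc hd
  id_comp := by
    rintro T R ⟨c⟩
    refine Quotient.sound (Setoid.trans (RGCospan.comp_eq _ c c.left_mem (isGeneric_id _)
      IsPushout.of_id_fst) ?_)
    exact ⟨Iso.refl _, by simp [RGCospan.compAlong, RGCospan.id],
      by simp [RGCospan.compAlong, RGCospan.id]⟩
  comp_id := by
    rintro T R ⟨c⟩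
    refine Quotient.sound (Setoid.trans (RGCospan.comp_eq c _ (isRedCov_id _) c.right_mem
      IsPushout.of_id_snd) ?_)
    exact ⟨Iso.refl _, by simp [RGCospan.compAlong, RGCospan.id],
      by simp [RGCospan.compAlong, RGCospan.id]⟩
  assoc := by
    rintro T R Q Z ⟨c⟩ ⟨d⟩ ⟨e⟩
    obtain ⟨P1, v1, u1, h1, hv1, hu1⟩ := exists_pushout d.left c.right d.left_mem c.right_mem
    obtain ⟨P2, v2, u2, h2, hv2, hu2⟩ := exists_pushout e.left d.right e.left_mem d.right_mem
    obtain ⟨P, b, a, h, hb, ha⟩ := exists_pushout u2 v1 hu2 hv1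
    have hl : IsPushout (RGCospan.compAlong c d u1 v1 hu1 hv1).right e.left a (v2 ≫ b) := by
      have := h2.paste_vert h
      exact this.flip
    have hr : IsPushout c.right (RGCospan.compAlong d e u2 v2 hu2 hv2).left (u1 ≫ a) b :=
      h1.flip.paste_vert h.flip
    refine Quotient.sound ?_
    refine Setoid.trans (RGCospan.comp_congr (RGCospan.comp_eq c d hu1 hv1 h1.flip)
      (Setoid.refl e)) ?_
    refine Setoid.trans (RGCospan.comp_eq _ e ha (isGeneric_comp hv2 hb) hl) ?_
    refine Setoid.symm ?_
    refine Setoid.trans (RGCospan.comp_congr (Setoid.refl c)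
      (RGCospan.comp_eq d e hu2 hv2 h2.flip)) ?_
    refine Setoid.trans (RGCospan.comp_eq c _ (isRedCov_comp hu1 ha) hb hr) ?_
    exact ⟨Iso.refl _, by simp [RGCospan.compAlong], by simp [RGCospan.compAlong]⟩

/-- The morphism of the category of cospans represented by a cospan. -/
def Cosp.ofCospan {T R : KGr} (c : RGCospan T R) : Cosp.mk T ⟶ Cosp.mk R := c.cls

/-! ## The Borisov–Manin category -/

/-- A graph in the sense of Kontsevich–Manin: finite sets of vertices `V` and flags `F`, a map
`bd : F → V` and an involution `j` of `F`. -/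
structure BMGraph : Type 1 where
  V : Type
  F : Type
  finV : Finite V
  finF : Finite F
  bd : F → V
  j : F → F
  j_j : ∀ f, j (j f) = f

namespace BMGraph

/-- Tails are the fixpoints of the involution. -/
def IsTail (τ : BMGraph) (f : τ.F) : Prop := τ.j f = f

/-- Morphisms of Borisov–Manin. -/
structure Hom (τ σ : BMGraph) where
  hF : σ.F → τ.F
  hV : τ.V → σ.V
  /-- The involution on the set of contracted flags. -/
  jh : {f : τ.F // f ∉ Set.range hF} → {f : τ.F // f ∉ Set.range hF}
  jh_jh : ∀ f, jh (jh f) = f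
  hF_inj : Function.Injective hF
  hV_surj : Function.Surjective hV
  /-- The image of `hF` and its complement are invariant. -/
  j_range : ∀ f, τ.j f ∈ Set.range hF ↔ f ∈ Set.range hF
  jh_ne : ∀ f, jh f ≠ f
  jh_edge : ∀ f, τ.j f.1 ≠ f.1 → (jh f).1 = τ.j f.1
  hV_bd : ∀ f, hV (τ.bd (hF f)) = σ.bd f
  /-- The vertices of a contracted edge, actual or virtual, have the same image. -/
  hV_jh : ∀ f, hV (τ.bd f.1) = hV (τ.bd (jh f).1)
  /-- The inverse of `hF` maps edges to edges. -/
  edge : ∀ f f', τ.j (hF f) = hF f' → hF f' ≠ hF f → σ.j f = f'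

lemma Hom.ext' {τ σ : BMGraph} {h k : Hom τ σ} (hF : h.hF = k.hF) (hV : h.hV = k.hV)
    (hj : ∀ f h1 h2, (h.jh ⟨f, h1⟩).1 = (k.jh ⟨f, h2⟩).1) : h = k := by
  obtain ⟨a, b, c⟩ := h
  obtain ⟨a', b', c'⟩ := k
  obtain rfl : a = a' := hF
  obtain rfl : b = b' := hV
  obtain rfl : c = c' := funext fun f => Subtype.ext (hj f.1 f.2 f.2)
  rfl

open Classical in
/-- The involution of a composite morphism: that of the first morphism on the flags contracted
by it, and that of the second one on the remaining contracted flags. -/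
noncomputable def compJ {τ σ ρ : BMGraph} (g : Hom τ σ) (c : Hom σ ρ) (f : τ.F)
    (hf : f ∉ Set.range fun x => g.hF (c.hF x)) : τ.F :=
  if h : f ∈ Set.range g.hF then
    g.hF (c.jh ⟨h.choose, fun ⟨x, hx⟩ => hf ⟨x, by
      change g.hF (c.hF x) = f
      rw [hx]; exact h.choose_spec⟩⟩).1
  else (g.jh ⟨f, h⟩).1

section
variable {τ σ ρ : BMGraph} (g : Hom τ σ) (c : Hom σ ρ)

lemma compJ_range (f : σ.F) (hf) (hf' : f ∉ Set.range c.hF) :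
    compJ g c (g.hF f) hf = g.hF (c.jh ⟨f, hf'⟩).1 := by
  have h : g.hF f ∈ Set.range g.hF := ⟨f, rfl⟩
  have e : h.choose = f := g.hF_inj h.choose_spec
  rw [compJ, dif_pos h]
  congr 3
  exact Subtype.ext e

lemma compJ_not_range (f : τ.F) (hf) (hf' : f ∉ Set.range g.hF) :
    compJ g c f hf = (g.jh ⟨f, hf'⟩).1 := by
  rw [compJ, dif_neg hf']

lemma comp_cases (f : τ.F) (hf : f ∉ Set.range fun x => g.hF (c.hF x)) :
    (∃ f', f = g.hF f' ∧ f' ∉ Set.range c.hF) ∨ f ∉ Set.range g.hF := by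
  by_cases h : f ∈ Set.range g.hF
  · obtain ⟨f', rfl⟩ := h
    exact Or.inl ⟨f', rfl, fun ⟨x, hx⟩ => hf ⟨x, congrArg g.hF hx⟩⟩
  · exact Or.inr h

lemma not_range_of_left {f : σ.F} (h : f ∉ Set.range c.hF) :
    g.hF f ∉ Set.range fun x => g.hF (c.hF x) :=
  fun ⟨x, hx⟩ => h ⟨x, g.hF_inj hx⟩

lemma not_range_of_right {f : τ.F} (h : f ∉ Set.range g.hF) :
    f ∉ Set.range fun x => g.hF (c.hF x) :=
  fun ⟨_, hx⟩ => h ⟨_, hx⟩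

lemma compJ_mem (f : τ.F) (hf : f ∉ Set.range fun x => g.hF (c.hF x)) :
    compJ g c f hf ∉ Set.range fun x => g.hF (c.hF x) := by
  rcases comp_cases g c f hf with ⟨f', rfl, h⟩ | h
  · rw [compJ_range g c f' hf h]
    exact not_range_of_left g c (c.jh _).2
  · rw [compJ_not_range g c f hf h]
    exact not_range_of_right g c (g.jh _).2

end

/-- The composite of two morphisms. -/
noncomputable def Hom.comp {τ σ ρ : BMGraph} (g : Hom τ σ) (c : Hom σ ρ) : Hom τ ρ where
  hF f := g.hF (c.hF f)
  hV v := c.hV (g.hV v)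
  jh f := ⟨compJ g c f.1 f.2, compJ_mem g c f.1 f.2⟩
  jh_jh := by
    rintro ⟨f, hf⟩
    apply Subtype.ext
    change compJ g c (compJ g c f hf) (compJ_mem g c f hf) = f
    rcases comp_cases g c f hf with ⟨f', rfl, h⟩ | h
    · simp only [compJ_range g c f' hf h]
      rw [compJ_range g c _ _ (c.jh ⟨f', h⟩).2, c.jh_jh]
    · simp only [compJ_not_range g c f hf h]
      rw [compJ_not_range g c _ _ (g.jh ⟨f, h⟩).2, g.jh_jh]
  hF_inj := g.hF_inj.comp c.hF_inj
  hV_surj := c.hV_surj.comp g.hV_surj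
  j_range := by
    have key : ∀ f, f ∈ Set.range (fun x => g.hF (c.hF x)) →
        τ.j f ∈ Set.range (fun x => g.hF (c.hF x)) := by
      rintro _ ⟨x, rfl⟩
      by_cases h : τ.j (g.hF (c.hF x)) = g.hF (c.hF x)
      · exact ⟨x, h.symm⟩
      · obtain ⟨f2, h2⟩ := (g.j_range (g.hF (c.hF x))).2 ⟨_, rfl⟩
        have h3 := g.edge (c.hF x) f2 h2.symm (by rw [h2]; exact h)
        obtain ⟨y, hy⟩ := (c.j_range (c.hF x)).2 ⟨x, rfl⟩
        exact ⟨y, by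
          change g.hF (c.hF y) = _
          rw [hy, h3, h2]⟩
    intro f
    refine ⟨fun h => ?_, key f⟩
    have := key _ h
    rwa [τ.j_j] at this
  jh_ne := by
    rintro ⟨f, hf⟩ e
    replace e : compJ g c f hf = f := congrArg Subtype.val e
    rcases comp_cases g c f hf with ⟨f', rfl, h⟩ | h
    · rw [compJ_range g c f' hf h] at e
      exact c.jh_ne ⟨f', h⟩ (Subtype.ext (g.hF_inj e))
    · rw [compJ_not_range g c f hf h] at e
      exact g.jh_ne ⟨f, h⟩ (Subtype.ext e)
  jh_edge := by
    rintro ⟨f, hf⟩ e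
    change compJ g c f hf = τ.j f
    rcases comp_cases g c f hf with ⟨f', rfl, h⟩ | h
    · rw [compJ_range g c f' hf h]
      obtain ⟨f2, h2⟩ := (g.j_range (g.hF f')).2 ⟨f', rfl⟩
      have h3 := g.edge f' f2 h2.symm (by rw [h2]; exact e)
      have h4 : σ.j f' ≠ f' := fun h5 => e (by
        change τ.j (g.hF f') = g.hF f'
        rw [← h2, ← h3, h5])
      rw [c.jh_edge ⟨f', h⟩ h4, ← h2, ← h3]
    · rw [compJ_not_range g c f hf h]
      exact g.jh_edge ⟨f, h⟩ e
  hV_bd f := by rw [g.hV_bd, c.hV_bd]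
  hV_jh := by
    rintro ⟨f, hf⟩
    change c.hV (g.hV (τ.bd f)) = c.hV (g.hV (τ.bd (compJ g c f hf)))
    rcases comp_cases g c f hf with ⟨f', rfl, h⟩ | h
    · rw [compJ_range g c f' hf h, g.hV_bd, g.hV_bd]
      exact c.hV_jh ⟨f', h⟩
    · rw [compJ_not_range g c f hf h]
      exact congrArg c.hV (g.hV_jh ⟨f, h⟩)
  edge f f' h hne := c.edge f f' (g.edge _ _ h hne) fun e => hne (congrArg g.hF e)

noncomputable instance : Category BMGraph where
  Hom := Hom
  id τ :=
    { hF := id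
      hV := id
      jh := fun f => (f.2 ⟨f.1, rfl⟩).elim
      jh_jh := fun f => (f.2 ⟨f.1, rfl⟩).elim
      hF_inj := Function.injective_id
      hV_surj := Function.surjective_id
      j_range := fun f => ⟨fun _ => ⟨f, rfl⟩, fun _ => ⟨_, rfl⟩⟩
      jh_ne := fun f => (f.2 ⟨f.1, rfl⟩).elim
      jh_edge := fun f => (f.2 ⟨f.1, rfl⟩).elim
      hV_bd := fun _ => rfl
      hV_jh := fun f => (f.2 ⟨f.1, rfl⟩).elim
      edge := fun _ _ h _ => h }
  comp := Hom.comp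
  id_comp g := Hom.ext' rfl rfl fun f h1 h2 => compJ_range _ g f h1 h2
  comp_id g := Hom.ext' rfl rfl fun f h1 h2 => compJ_not_range g _ f h1 h2
  assoc g c d := Hom.ext' rfl rfl fun f h1 h2 => by
    change compJ (Hom.comp g c) d f h1 = compJ g (Hom.comp c d) f h2
    rcases comp_cases g (Hom.comp c d) f h2 with ⟨f', rfl, h⟩ | h
    · rw [compJ_range g (Hom.comp c d) f' h2 h]
      change _ = g.hF (compJ c d f' h)
      rcases comp_cases c d f' h with ⟨f'', rfl, h'⟩ | h'
      · rw [compJ_range c d f'' h h']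
        exact compJ_range (Hom.comp g c) d f'' h1 h'
      · rw [compJ_not_range c d f' h h']
        refine (compJ_not_range (Hom.comp g c) d _ h1 (not_range_of_left g c h')).trans ?_
        exact compJ_range g c f' (not_range_of_left g c h') h'
    · rw [compJ_not_range g (Hom.comp c d) f h2 h]
      refine (compJ_not_range (Hom.comp g c) d _ h1 (not_range_of_right g c h)).trans ?_
      exact compJ_not_range g c f (not_range_of_right g c h) h

/-- Graftings. -/
def IsGrafting {τ σ : BMGraph} (h : τ ⟶ σ) : Prop :=
  Function.Bijective h.hV ∧ Function.Bijective h.hF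

/-- Compressions. -/
def IsCompression {τ σ : BMGraph} (h : τ ⟶ σ) : Prop :=
  Set.BijOn h.hF {f | σ.IsTail f} {f | τ.IsTail f}

open Classical in
/-- The graph without isolated edges corresponding to a Kontsevich–Manin graph: the same vertices
and flags, the arcs being the flags together with a port for each tail. -/
noncomputable def toJK (τ : BMGraph) : JKGraph where
  A := τ.F ⊕ {f : τ.F // τ.IsTail f}
  H := τ.F
  V := τ.V
  finA := have := τ.finF; inferInstance
  finH := τ.finF
  finV := τ.finV
  i := Sum.elim (fun f => if h : τ.IsTail f then Sum.inr ⟨f, h⟩ else Sum.inl (τ.j f))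
    (fun t => Sum.inl t.1)
  s := Sum.inl
  p := τ.bd
  s_inj := Sum.inl_injective
  i_i := by
    rintro (f | t)
    · by_cases h : τ.IsTail f
      · simp [h]
      · have h' : ¬ τ.IsTail (τ.j f) := fun e => h (by
          have e' : τ.j (τ.j f) = τ.j f := e
          rw [τ.j_j] at e'
          exact e'.symm)
        simp [h, h', τ.j_j]
    · simp [t.2]
  i_ne := by
    rintro (f | t)
    · by_cases h : τ.IsTail f
      · simp [h]
      · intro e
        rw [Sum.elim_inl, dif_neg h] at e
        exact h (Sum.inl_injective e)
    · simp

/-- The corresponding object of the restricted Kleisli category. -/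
noncomputable def toKGr (τ : BMGraph) : KGr := NIGraph.mk τ.toJK <| by
  rintro (f | t) ⟨h1, h2⟩
  · exact h1 f rfl
  · exact h2 t.1 rfl

/-- The etale morphism `f` corresponds to the grafting `g`: it agrees with `g` on vertices and is
inverse to `g` on flags.  (Its component on arcs is then forced.) -/
def CorrespondsToGrafting {τ σ : BMGraph} (g : τ ⟶ σ) (f : τ.toJK ⟶ σ.toJK) : Prop :=
  (∀ v, f.fV v = g.hV v) ∧ ∀ x, g.hF (f.fH x) = x

/-- The Kleisli morphism `k` corresponds to the compression `c`: substituting the images of the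
vertices into `ρ` yields `σ`, in such a way that the vertices of `σ` belonging to the graph
substituted into `x` are those that `c` sends to `x`, and that the map from the flags of `ρ` to
those of `σ` is that of `c`. -/
def CorrespondsToCompression {σ ρ : BMGraph} (c : σ ⟶ ρ) (k : ρ.toKGr ⟶ σ.toKGr) : Prop :=
  ∃ s : CCP.Subst (KGr.dec k) (𝟙 (nerve.obj σ.toJK)),
    (∀ x v, c.hV ((s.ι x).fV v) = x) ∧
    ∀ f : ρ.F, s.e (ρ.toJK.s f) = σ.toJK.s (c.hF f)

end BMGraph

end

/-! A morphism of the Borisov–Manin category merges vertices, keeps some flags and pairs off all the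
others. The gluing can be done before anything is contracted. Let `J` be the involution of the flags
of the source that carries the involution of the target on the kept flags and `jh` on the contracted
ones. Replacing the involution of the source by `J` is a grafting. Afterwards every contracted pair
is an actual edge and the tails are exactly those of the target, so what remains is a compression.
In any factorisation of this kind the intermediate involution is `J` transported, so two
factorisations differ by an isomorphism (`exists_factorisation`, `exists_iso_of_factorisations`).

The two factors match the two legs of a cospan. A reduced cover of graphs without isolated edges is
bijective on vertices, hence on flags, and it is determined there. Read backwards on flags, it is a
grafting. A generic morphism from `R` to `S` presents `S` as glued from pieces indexed by the
vertices of `R`. A piece is determined up to isomorphism over `S` by its vertices and the images of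
its labelled ports (`NGraph.exists_iso_over`). The morphism therefore amounts to a partition of the
vertices of `S` and a map on arcs, which is the data of a compression. A compression needs no
separate involution, because it contracts only actual edges.

Functoriality requires no computation of pushouts. A commutative square of reduced covers and
generic morphisms gives a commutative square of graftings and compressions (`comp_eq_of_comm`), and
commutativity of the pushout square is all that is used. Faithfulness follows from the same lemma
with one side an identity, once an isomorphism of cospans is known to be etale
(`exists_free_of_comp`). Fullness and essential surjectivity rest on the fact that every graph
without isolated edges is, up to isomorphism, the graph of a Borisov–Manin object
(`exists_toJK_iso`).

The argument is organised by the relation `IsRealizedBy`: every morphism is related to exactly one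
class of cospans, and conversely. -/

section
open JKGraph El CCP KGr

/-! ### Etale morphisms seen on flags and vertices -/

lemma JKGraph.Hom.fH_injective {X Y : JKGraph} (f : X ⟶ Y) (hf : Function.Injective f.fV) :
    Function.Injective f.fH := fun h h' e => by
  have hp : X.p h' = X.p h := hf (by rw [f.map_p, f.map_p, e])
  obtain ⟨_, _, hu⟩ := f.etale (X.p h) (f.fH h) (f.map_p h).symm
  rw [hu h ⟨rfl, rfl⟩, hu h' ⟨hp, e.symm⟩]

lemma JKGraph.Hom.fH_surjective {X Y : JKGraph} (f : X ⟶ Y) (hf : Function.Surjective f.fV) :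
    Function.Surjective f.fH := fun h => by
  obtain ⟨v, hv⟩ := hf (Y.p h)
  obtain ⟨h', ⟨_, e⟩, _⟩ := f.etale v h hv.symm
  exact ⟨h', e⟩

/-- Etale morphisms out of a graph without isolated edges are determined on flags and vertices. -/
lemma JKGraph.hom_ext_of_noIsolatedEdges {X Y : JKGraph} (hX : X.NoIsolatedEdges) {f g : X ⟶ Y}
    (hH : ∀ h, f.fH h = g.fH h) (hV : ∀ v, f.fV v = g.fV v) : f = g := by
  have hs : ∀ h, f.fA (X.s h) = g.fA (X.s h) := fun h => by rw [f.map_s, g.map_s, hH]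
  refine JKGraph.hom_ext (funext fun a => ?_) (funext hH) (funext hV)
  by_cases ha : X.IsPort a
  · obtain ⟨h, hh⟩ := IsPort.of_not fun hb => hX a ⟨ha, hb⟩
    have e : a = X.i (X.s h) := by rw [hh, X.i_i]
    rw [e, f.map_i, g.map_i, hs]
  · obtain ⟨h, rfl⟩ := IsPort.of_not ha
    exact hs h

/-! ### Graphs with labelled ports over a fixed graph -/

namespace NGraph

lemma isPort_b {n : Type} (X : NGraph n) (k : n) : X.G.IsPort (X.b k) := (X.b_port _).2 ⟨k, rfl⟩

/-- The morphism `q` may identify arcs, for instance two ports that are glued to flags of the same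
piece, so it cannot be cancelled on arcs. It is injective on flags, and these together with the
vertices determine a morphism out of an effective graph. -/
lemma hom_over_ext {n : Type} (X : NGraph n) {Y S : JKGraph} {f g : X.G ⟶ Y} (q : Y ⟶ S)
    (hq : Function.Injective q.fV) (h : f ≫ q = g ≫ q) : f = g :=
  hom_ext_of_noIsolatedEdges X.eff.2
    (fun x => q.fH_injective hq (congrArg (fun r => r.fH x) h))
    (fun x => hq (congrArg (fun r => r.fV x) h))

/-- Over a graph `S`, an `n`-graph whose vertices are those of a subset of `S` maps to every other
such `n`-graph containing these vertices. -/
lemma exists_hom_over {n : Type} (X Y : NGraph n) {S : JKGraph} (f : X.G ⟶ S) (g : Y.G ⟶ S)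
    (hf : Function.Injective f.fV) (hg : Function.Injective g.fV)
    (hr : ∀ v, ∃ w, g.fV w = f.fV v) (hb : ∀ k, f.fA (X.b k) = g.fA (Y.b k)) :
    ∃ θ : X.G ⟶ Y.G, (∀ k, θ.fA (X.b k) = Y.b k) ∧ θ ≫ g = f := by
  have gH := g.fH_injective hg
  choose tV hV using hr
  have hH : ∀ h, ∃ h', Y.G.p h' = tV (X.G.p h) ∧ g.fH h' = f.fH h := fun h => by
    obtain ⟨h', hh, _⟩ := g.etale (tV (X.G.p h)) (f.fH h) (by rw [hV, f.map_p])
    exact ⟨h', hh⟩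
  choose tH hp hH using hH
  have tH_inj : Function.Injective tH := fun a b e =>
    f.fH_injective hf (by rw [← hH, ← hH, e])
  -- Ports go by their label and the remaining arcs by their flag. Lifting arcs along `g` is not
  -- possible, as `g` need not be injective on them.
  have hA : ∀ a, ∃ a', (∀ k, a = X.b k → a' = Y.b k) ∧ ∀ h, a = X.G.s h → a' = Y.G.s (tH h) := by
    intro a
    by_cases ha : X.G.IsPort a
    · obtain ⟨k, rfl⟩ := (X.b_port a).1 ha
      exact ⟨Y.b k, fun l e => by rw [X.b_inj e], fun h e => (ha h e.symm).elim⟩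
    · obtain ⟨h, rfl⟩ := IsPort.of_not ha
      exact ⟨Y.G.s (tH h), fun l e => (X.isPort_b l h e).elim, fun h' e => by rw [X.G.s_inj e]⟩
  choose tA tb ts using hA
  replace tb : ∀ k, tA (X.b k) = Y.b k := fun k => tb _ k rfl
  replace ts : ∀ h, tA (X.G.s h) = Y.G.s (tH h) := fun h => ts _ h rfl
  -- The arcs opposite the ports labelled `k` come from flags of `X` and of `Y`. These have the same
  -- image in `S` by `hb`, and `g` is injective on flags.
  have i1 : ∀ k, tA (X.G.i (X.b k)) = Y.G.i (tA (X.b k)) := fun k => by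
    obtain ⟨h, hh⟩ := X.exists_flag k
    obtain ⟨h', hh'⟩ := Y.exists_flag k
    rw [tb, ← hh, ← hh', ts]
    congr 1
    apply gH
    apply S.s_inj
    rw [hH, ← f.map_s, ← g.map_s, hh, hh', f.map_i, g.map_i, hb]
  have i2 : ∀ a, tA (X.G.i a) = Y.G.i (tA a) := by
    intro a
    by_cases ha : X.G.IsPort a
    · obtain ⟨k, rfl⟩ := (X.b_port a).1 ha
      exact i1 k
    by_cases ha' : X.G.IsPort (X.G.i a)
    · obtain ⟨k, hk⟩ := (X.b_port _).1 ha'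
      have h := i1 k
      rw [hk, X.G.i_i] at h
      rw [h, Y.G.i_i]
    obtain ⟨h, rfl⟩ := IsPort.of_not ha
    obtain ⟨h2, e2⟩ := IsPort.of_not ha'
    -- An inner edge cannot become a boundary edge. If `tH h` were opposite the port labelled `k`,
    -- then by `i1` the flag of `X` opposite its own port `k` would have the same image as `h`, and
    -- injectivity of `tH` would put a port opposite `h`.
    have hn : ¬ Y.G.IsPort (Y.G.i (Y.G.s (tH h))) := fun hn => by
      obtain ⟨k, hk⟩ := (Y.b_port _).1 hn
      obtain ⟨h3, e3⟩ := X.exists_flag k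
      have e4 := i1 k
      rw [tb, hk, Y.G.i_i, ← e3, ts] at e4
      rw [tH_inj (Y.G.s_inj e4)] at e3
      exact ha' (by rw [e3, X.G.i_i]; exact X.isPort_b k)
    obtain ⟨h3, e3⟩ := IsPort.of_not hn
    -- Both edges are now inner, so the two opposite flags can be compared in `S`.
    rw [← e2, ts, ts, ← e3]
    congr 1
    apply gH
    apply S.s_inj
    rw [hH, ← f.map_s, ← g.map_s, e2, e3, f.map_i, g.map_i, f.map_s, g.map_s, hH]
  refine ⟨{ fA := tA
            fH := tH
            fV := tV
            map_i := i2
            map_s := ts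
            map_p := fun h => (hp h).symm
            etale := ?_ }, tb, ?_⟩
  · intro v h e
    obtain ⟨h', ⟨e1, e2⟩, _⟩ := f.etale v (g.fH h) (by rw [← hV, ← g.map_p, e])
    have e3 : tH h' = h := gH (by rw [hH, e2])
    exact ⟨h', ⟨e1, e3⟩, fun y hy => tH_inj (hy.2.trans e3.symm)⟩
  · exact hom_ext_of_noIsolatedEdges X.eff.2 hH hV

/-- The previous lemma applies in both directions, and both composites are identities because they
are so over `S`. This is the rigidity that reduces the isomorphism classes in a generic morphism to
combinatorial data. -/
lemma exists_iso_over {n : Type} (X Y : NGraph n) {S : JKGraph} (f : X.G ⟶ S) (g : Y.G ⟶ S)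
    (hf : Function.Injective f.fV) (hg : Function.Injective g.fV)
    (hr : ∀ v, (∃ w, f.fV w = v) ↔ ∃ w, g.fV w = v) (hb : ∀ k, f.fA (X.b k) = g.fA (Y.b k)) :
    ∃ θ : X.G ≅ Y.G, (∀ k, θ.hom.fA (X.b k) = Y.b k) ∧ θ.hom ≫ g = f := by
  obtain ⟨θ, h1, h2⟩ := exists_hom_over X Y f g hf hg (fun v => (hr _).1 ⟨v, rfl⟩) hb
  obtain ⟨κ, _, k2⟩ := exists_hom_over Y X g f hg hf (fun v => (hr _).2 ⟨v, rfl⟩)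
    fun k => (hb k).symm
  exact ⟨⟨θ, κ, hom_over_ext X f hf (by rw [Category.assoc, k2, h2, Category.id_comp]),
    hom_over_ext Y g hg (by rw [Category.assoc, h2, k2, Category.id_comp])⟩, h1, h2⟩

end NGraph

/-! ### Gluings and the decorations they define -/

namespace CCP

lemma Gluing.ι_fV_injective {R S : JKGraph} (gl : Gluing R S) (x : R.V) :
    Function.Injective (gl.ι x).fV := fun v w e => by
  have h : (⟨x, v⟩ : Σ x, (gl.piece x).G.V) = ⟨x, w⟩ := gl.bijV.1 e
  simpa using h

/-- The pieces of two gluings giving the same graph are isomorphic over it if they have the same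
vertices. -/
lemma Gluing.cls_piece_eq {R S : JKGraph} (gl gl' : Gluing R S) (he : ∀ a, gl.e a = gl'.e a)
    (x : R.V) (hV : ∀ v, (∃ w, (gl.ι x).fV w = v) ↔ ∃ w, (gl'.ι x).fV w = v) :
    (cls ⟨gl.piece x, nerve.map (gl.ι x)⟩ :
      (bar (nerve.obj S)).obj (op (corolla (R.Flags x) inferInstance))) =
      cls ⟨gl'.piece x, nerve.map (gl'.ι x)⟩ := by
  obtain ⟨θ, h1, h2⟩ := NGraph.exists_iso_over (gl.piece x) (gl'.piece x) (gl.ι x) (gl'.ι x)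
    (gl.ι_fV_injective x) (gl'.ι_fV_injective x) hV
    (fun k => by rw [gl.ι_b, gl'.ι_b, he])
  exact cls_eq θ h1 (by rw [← Functor.map_comp, h2])

/-- Every gluing is the substitution for a family of decorations over the glued graph. -/
lemma Gluing.exists_subst {R S : JKGraph} (hR : R.NoIsolatedEdges) (gl : Gluing R S) :
    ∃ (ψ : nerve.obj R ⟶ bar (nerve.obj S)) (s : Subst ψ (𝟙 (nerve.obj S))),
      s.toGluing = gl := by
  -- The colours of `bar (nerve.obj S)` are those of `nerve.obj S`, that is, arcs of `S`.
  let c : R.A → (bar (nerve.obj S)).obj (op unit) := fun a =>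
    (ULift.up (arc (gl.e a)) : (nerve.obj S).obj (op unit))
  -- The graph `R` is itself glued from its corollas, so a decoration of it may be prescribed vertex
  -- by vertex: at `x` it is the class of the piece at `x` together with its map to `S`.
  obtain ⟨ψ, h1, _⟩ := (Subst.corollas (𝟙 (nerve.obj R))).toGluing.exists_dec hR
    (fun x => yo (F := bar (nerve.obj S)) (E := corolla (R.Flags x) inferInstance)
      (cls ⟨gl.piece x, nerve.map (gl.ι x)⟩)) c
    (fun a => by
      change (ULift.up (arc (gl.e (R.i a))) : (nerve.obj S).obj (op unit)) = _
      rw [gl.e_i]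
      exact congrArg ULift.up (flip_arc (gl.e a)).symm)
    (fun x k => by
      refine congrArg ULift.up ((arc_comp _ _).trans ?_)
      congr 1
      exact gl.ι_b x k)
  refine ⟨ψ, { gl with dec := fun x => ?_ }, rfl⟩
  -- Evaluating at the identity of the corolla recovers the prescribed class at `x`.
  have h2 := congrArg (fun φ => at' (E := corolla (R.Flags x) inferInstance) φ (𝟙 _)) (h1 x)
  rw [Category.comp_id]
  exact (pull_id (E := corolla (R.Flags x) inferInstance) _).symm.trans h2.symm

/-- A decoration is determined by its colours and its values on the vertices. -/
lemma dec_ext_star {R : JKGraph} (hR : R.NoIsolatedEdges) {F : Species} {φ ψ : nerve.obj R ⟶ F}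
    (h : ∀ x, at' (E := corolla (R.Flags x) inferInstance) φ (star x) =
      at' (E := corolla (R.Flags x) inferInstance) ψ (star x)) : φ = ψ := by
  refine (Subst.corollas (𝟙 (nerve.obj R))).toGluing.dec_ext hR fun x => ?_
  refine (eq_yo (E := corolla (R.Flags x) inferInstance) _).trans
    (Eq.trans ?_ (eq_yo (E := corolla (R.Flags x) inferInstance) _).symm)
  congr 1
  exact h x

/-- A substitution with known result is determined by its effect on arcs and vertices. -/
lemma Subst.dec_unique {R S : JKGraph} (hR : R.NoIsolatedEdges)
    {ψ ψ' : nerve.obj R ⟶ bar (nerve.obj S)} (s : Subst ψ (𝟙 (nerve.obj S)))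
    (s' : Subst ψ' (𝟙 (nerve.obj S))) (he : ∀ a, s.e a = s'.e a)
    (hV : ∀ x v, (∃ w, (s.ι x).fV w = v) ↔ ∃ w, (s'.ι x).fV w = v) : ψ = ψ' := by
  refine dec_ext_star hR fun x => ?_
  rw [← s.dec x, ← s'.dec x, Category.comp_id, Category.comp_id]
  exact s.cls_piece_eq s'.toGluing he x (hV x)

end CCP

/-! ### Free morphisms and commutative squares in the restricted Kleisli category -/

namespace KGr

/-- Forming `bar` changes only the values at corollas, and the unit is the identity on colours.
Hence the colours of `l` show that `f'` is constant on the arcs identified by `f`, and `f'` descends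
along `f`. Cancelling the cover shows that the descended morphism is `l`. The lemma serves to see
that an isomorphism of cospans comes from an etale morphism. -/
lemma exists_free_of_comp {T S S' : KGr} {f : T.gr ⟶ S.gr} {f' : T.gr ⟶ S'.gr}
    (hA : Function.Surjective f.fA) (hV : Function.Bijective f.fV) {l : S ⟶ S'}
    (h : (free f : T ⟶ S) ≫ l = free f') : ∃ u : S.gr ⟶ S'.gr, f ≫ u = f' ∧ l = free u := by
  have h' : nerve.map f ≫ dec l = nerve.map f' ≫ eta _ := by rw [← dec_free_comp, h, dec_free]
  obtain ⟨ψ, hψ⟩ := exists_descent_cover f hA hV (nerve.map f') fun a b e => by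
    have h1 : ∀ a, col (nerve.map f') a = col (dec l) (f.fA a) := fun a => by
      rw [← col_nerve, h']
      rfl
    rw [h1, h1, e]
  obtain ⟨u, rfl⟩ := nerve_full ψ
  have hu : f ≫ u = f' := nerve_faithful (by rw [Functor.map_comp, hψ])
  exact ⟨u, hu, free_cancel f hA hV.2 (by rw [h, free_comp, hu])⟩

/-- Isomorphic graphs are isomorphic objects of the restricted Kleisli category. -/
noncomputable def freeIso {R S : KGr} (θ : R.gr ≅ S.gr) : R ≅ S where
  hom := free θ.hom
  inv := free θ.inv
  hom_inv_id := by rw [free_comp, θ.hom_inv_id, free_id]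
  inv_hom_id := by rw [free_comp, θ.inv_hom_id, free_id]

lemma isRedCov_freeIso {R S : KGr} (θ : R.gr ≅ S.gr) : IsRedCov (freeIso θ : R ≅ S).hom :=
  ⟨θ.hom, (isReducedCover_iff R.ni _).2 ⟨(bijective_fA θ).2, bijective_fV θ⟩, rfl⟩

/-- Postcomposition with an etale morphism leaves the substituted graphs alone and changes only
their maps to the target. The equation of gluings is recorded since the substitution is transported
along an equality of decorations and cannot simply be unfolded. -/
lemma exists_subst_comp_free {R S S' : KGr} {k : R ⟶ S} (s : Subst (dec k) (𝟙 (nerve.obj S.gr)))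
    (u : S.gr ⟶ S'.gr) :
    ∃ t : Subst (dec (k ≫ (free u : S ⟶ S'))) (nerve.map u), t.toGluing = s.toGluing := by
  rw [dec_comp_free]
  exact ⟨s.map (nerve.map u), rfl⟩

lemma isGeneric_comp_freeIso {R S S' : KGr} {k : R ⟶ S} (hk : IsGeneric k)
    (θ : S.gr ≅ S'.gr) : IsGeneric (k ≫ (freeIso θ : S ≅ S').hom) := by
  obtain ⟨s⟩ := (isGeneric_iff k).1 hk
  obtain ⟨t, _⟩ := exists_subst_comp_free s θ.hom
  exact ⟨S.gr, θ.hom, ⟨t⟩, inferInstance⟩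

/-- The effect of a generic morphism, followed or preceded by etale morphisms, on arcs. -/
lemma fA_e_of_comm {R R' S P : KGr} {k : R ⟶ S} {v : R' ⟶ P} {f : R.gr ⟶ R'.gr}
    {u : S.gr ⟶ P.gr} (s : Subst (dec k) (𝟙 (nerve.obj S.gr)))
    (t : Subst (dec v) (𝟙 (nerve.obj P.gr)))
    (h : k ≫ (free u : S ⟶ P) = (free f : R ⟶ R') ≫ v) (a : R.gr.A) :
    u.fA (s.e a) = t.e (f.fA a) := by
  -- On colours a generic morphism is its arc map and a free morphism is its underlying map on arcs,
  -- so equality of the composites becomes an equation between arcs of `P`.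
  have h1 : col (dec (k ≫ (free u : S ⟶ P))) a = col (dec ((free f : R ⟶ R') ≫ v)) a := by rw [h]
  rw [col_comp s, dec_free_comp, col_nerve, dec_free, col_nerve] at h1
  have h2 := h1.trans (col_generic t (f.fA a))
  exact congrArg (fun g => g.down.fA true) h2

/-- The effect of a generic morphism, followed or preceded by etale morphisms, on vertices. -/
lemma exists_ι_of_comm {R R' S P : KGr} {k : R ⟶ S} {v : R' ⟶ P} {f : R.gr ⟶ R'.gr}
    {u : S.gr ⟶ P.gr} (s : Subst (dec k) (𝟙 (nerve.obj S.gr)))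
    (t : Subst (dec v) (𝟙 (nerve.obj P.gr)))
    (h : k ≫ (free u : S ⟶ P) = (free f : R ⟶ R') ≫ v) (x : R.gr.V) (w : (s.piece x).G.V) :
    ∃ w', (t.ι (f.fV x)).fV w' = u.fV ((s.ι x).fV w) := by
  have h1 : at' (E := corolla (R.gr.Flags x) inferInstance) (dec (k ≫ (free u : S ⟶ P))) (star x) =
    at' (E := corolla (R.gr.Flags x) inferInstance) (dec ((free f : R ⟶ R') ≫ v)) (star x) := by
      rw [h]
  rw [dec_comp_free, at_comp_right, ← s.dec x, dec_free_comp, at_nerve,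
    at_star_comp f (dec v) x _ (t.dec _), barMap_cls] at h1
  -- At `x` the two composites give the piece of `s` at `x` and the relabelled piece of `t` at `f.fV
  -- x`, both over `P`. Equality of classes is an isomorphism over `P`, which transports the vertex
  -- `w`.
  obtain ⟨θ, _, h2⟩ := cls_exact h1
  let κ : (s.piece x).G ⟶ (t.piece (f.fV x)).G := θ.hom
  have h3 : nerve.map κ ≫ nerve.map (t.ι (f.fV x)) ≫ 𝟙 _ =
    (nerve.map (s.ι x) ≫ 𝟙 _) ≫ nerve.map u := h2
  rw [Category.comp_id, Category.comp_id, ← Functor.map_comp, ← Functor.map_comp] at h3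
  exact ⟨κ.fV w, congrArg (fun g => g.fV w) (nerve_faithful h3)⟩

end KGr

end

/-! ### Isomorphisms and covers of graphs without isolated edges -/

section
open JKGraph CCP KGr

/-- An etale morphism of graphs without isolated edges which is bijective on flags and vertices
and preserves ports is invertible. -/
lemma JKGraph.isIso_of_isPort {X Y : JKGraph} (hX : X.NoIsolatedEdges) (hY : Y.NoIsolatedEdges)
    (f : X ⟶ Y) (hH : Function.Injective f.fH) (hV : Function.Bijective f.fV)
    (hp : ∀ h, X.IsPort (X.i (X.s h)) → Y.IsPort (Y.i (Y.s (f.fH h)))) : IsIso f := by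
  have hfA : ∀ h, f.fA (X.i (X.s h)) = Y.i (Y.s (f.fH h)) := fun h => by rw [f.map_i, f.map_s]
  have port : ∀ a, X.IsPort a → ∃ h, a = X.i (X.s h) := fun a ha => by
    obtain ⟨h, hh⟩ := IsPort.of_not fun hb => hX a ⟨ha, hb⟩
    exact ⟨h, by rw [hh, X.i_i]⟩
  -- Etale morphisms always reflect ports. With preservation as well, a port can never be identified
  -- with the arc of a flag, and injectivity on arcs splits into two cases, each settled on flags.
  have hp' : ∀ a, X.IsPort a ↔ Y.IsPort (f.fA a) := fun a => by
    refine ⟨fun ha => ?_, isPort_of_map f⟩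
    obtain ⟨h, rfl⟩ := port a ha
    rw [hfA]
    exact hp h ha
  refine isIso_of_bijective f ⟨fun a b e => ?_, fun a => ?_⟩ hV
  · by_cases ha : X.IsPort a
    · have hb := ha
      rw [hp', e, ← hp'] at hb
      obtain ⟨h, rfl⟩ := port a ha
      obtain ⟨h', rfl⟩ := port b hb
      rw [hfA, hfA] at e
      have e' := congrArg Y.i e
      rw [Y.i_i, Y.i_i] at e'
      rw [hH (Y.s_inj e')]
    · have hb := ha
      rw [hp', e, ← hp'] at hb
      obtain ⟨h, rfl⟩ := IsPort.of_not ha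
      obtain ⟨h', rfl⟩ := IsPort.of_not hb
      rw [f.map_s, f.map_s] at e
      rw [hH (Y.s_inj e)]
  · obtain ⟨x, k, rfl | rfl⟩ := Gluing.eq_i_s hY a
    · obtain ⟨h, hh⟩ := f.fH_surjective hV.2 k.1
      exact ⟨X.s h, by rw [f.map_s, hh]⟩
    · obtain ⟨h, hh⟩ := f.fH_surjective hV.2 k.1
      exact ⟨X.i (X.s h), by rw [hfA, hh]⟩

lemma JKGraph.Hom.fA_surjective {X Y : JKGraph} (hY : Y.NoIsolatedEdges) (f : X ⟶ Y)
    (hV : Function.Surjective f.fV) : Function.Surjective f.fA := fun a => by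
  obtain ⟨x, k, rfl | rfl⟩ := Gluing.eq_i_s hY a
  · obtain ⟨h, hh⟩ := f.fH_surjective hV k.1
    exact ⟨X.s h, by rw [f.map_s, hh]⟩
  · obtain ⟨h, hh⟩ := f.fH_surjective hV k.1
    exact ⟨X.i (X.s h), by rw [f.map_i, f.map_s, hh]⟩

namespace BMGraph

/-! ### The graph of a Kontsevich–Manin graph -/

lemma toJK_noIsolatedEdges (τ : BMGraph) : τ.toJK.NoIsolatedEdges := τ.toKGr.ni

open Classical in
lemma isPort_i_s {τ : BMGraph} {f : τ.F} :
    τ.toJK.IsPort (τ.toJK.i (τ.toJK.s f)) ↔ τ.IsTail f := by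
  change (∀ h : τ.F, (Sum.inl h : τ.F ⊕ {f : τ.F // τ.IsTail f}) =
    (if h : τ.IsTail f then Sum.inr ⟨f, h⟩ else Sum.inl (τ.j f)) → False) ↔ _
  by_cases h : τ.IsTail f <;> simp [h]

-- The condition that `f` is not a tail cannot be dropped: a tail satisfies `τ.j f = f`, but its
-- opposite arc is the added port and not `s f`.
open Classical in
lemma i_s_eq_s {τ : BMGraph} {f f' : τ.F} :
    τ.toJK.i (τ.toJK.s f) = τ.toJK.s f' ↔ ¬ τ.IsTail f ∧ τ.j f = f' := by
  change (if h : τ.IsTail f then Sum.inr ⟨f, h⟩ else Sum.inl (τ.j f) :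
    τ.F ⊕ {f : τ.F // τ.IsTail f}) = Sum.inl f' ↔ _
  by_cases h : τ.IsTail f <;> simp [h]

lemma i_s {τ : BMGraph} {f : τ.F} (hf : ¬ τ.IsTail f) :
    τ.toJK.i (τ.toJK.s f) = τ.toJK.s (τ.j f) := i_s_eq_s.2 ⟨hf, rfl⟩

open Classical in
/-- Etale morphisms from the graph of a Kontsevich–Manin graph. -/
lemma exists_toJK_hom {τ : BMGraph} {Y : JKGraph} (fH : τ.F → Y.H) (fV : τ.V → Y.V)
    (hp : ∀ x, fV (τ.bd x) = Y.p (fH x)) (hj : ∀ x, ¬ τ.IsTail x →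
      Y.i (Y.s (fH x)) = Y.s (fH (τ.j x)))
    (he : ∀ v h, Y.p h = fV v → ∃! h' : τ.F, τ.bd h' = v ∧ fH h' = h) :
    ∃ f : τ.toJK ⟶ Y, (∀ x, f.fH x = fH x) ∧ ∀ v, f.fV v = fV v :=
  ⟨{ fA := Sum.elim (fun x => Y.s (fH x)) (fun t => Y.i (Y.s (fH t.1)))
     fH := fH
     fV := fV
     map_i := by
      rintro (x | t)
      · by_cases hx : τ.IsTail x
        · change Sum.elim _ _ (if h : τ.IsTail x then Sum.inr (⟨x, h⟩ : {f : τ.F // τ.IsTail f})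
            else Sum.inl (τ.j x)) = _
          rw [dif_pos hx]
          rfl
        · change Sum.elim _ _ (if h : τ.IsTail x then Sum.inr (⟨x, h⟩ : {f : τ.F // τ.IsTail f})
            else Sum.inl (τ.j x)) = _
          rw [dif_neg hx]
          exact (hj x hx).symm
      · exact (Y.i_i _).symm
     map_s := fun _ => rfl
     map_p := hp
     etale := he }, fun _ => rfl, fun _ => rfl⟩

/-- As `exists_toJK_hom`, for bijective maps. -/
lemma exists_toJK_hom_of_bijective {τ : BMGraph} {Y : JKGraph} (fH : τ.F → Y.H) (fV : τ.V → Y.V)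
    (hH : Function.Bijective fH) (hV : Function.Bijective fV)
    (hp : ∀ x, fV (τ.bd x) = Y.p (fH x)) (hj : ∀ x, ¬ τ.IsTail x →
      Y.i (Y.s (fH x)) = Y.s (fH (τ.j x))) :
    ∃ f : τ.toJK ⟶ Y, (∀ x, f.fH x = fH x) ∧ ∀ v, f.fV v = fV v :=
  exists_toJK_hom fH fV hp hj fun v h e => by
    obtain ⟨x, rfl⟩ := hH.2 h
    exact ⟨x, ⟨hV.1 (by rw [hp, e]), rfl⟩, fun y hy => hH.1 hy.2⟩

/-- Every graph without isolated edges comes from a Kontsevich–Manin graph. -/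
lemma exists_toJK_iso (Y : JKGraph) (hY : Y.NoIsolatedEdges) :
    ∃ τ : BMGraph, Nonempty (τ.toJK ≅ Y) := by
  -- The involution on flags exchanges the two flags of an inner edge and fixes a flag that faces a
  -- port.
  have hj : ∀ h, ∃ h', (∀ k, Y.i (Y.s h) = Y.s k → h' = k) ∧
      (Y.IsPort (Y.i (Y.s h)) → h' = h) := fun h => by
    by_cases hp : Y.IsPort (Y.i (Y.s h))
    · exact ⟨h, fun k hk => (hp k hk.symm).elim, fun _ => rfl⟩
    · obtain ⟨k, hk⟩ := IsPort.of_not hp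
      exact ⟨k, fun l hl => Y.s_inj (hk.trans hl), fun h => (hp h).elim⟩
  choose j j1 j2 using hj
  have hjs : ∀ h, ¬ Y.IsPort (Y.i (Y.s h)) → Y.i (Y.s h) = Y.s (j h) := fun h hp => by
    obtain ⟨k, hk⟩ := IsPort.of_not hp
    rw [j1 h k hk.symm, hk]
  let τ : BMGraph :=
    { V := Y.V
      F := Y.H
      finV := Y.finV
      finF := Y.finH
      bd := Y.p
      j := j
      j_j := fun h => by
        by_cases hp : Y.IsPort (Y.i (Y.s h))
        · rw [j2 h hp, j2 h hp]
        · exact j1 _ _ (by rw [← hjs h hp, Y.i_i]) }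
  -- No tails arise other than the flags facing ports: a fixed flag on an inner edge would be a
  -- fixpoint of `i` on arcs.
  have tail : ∀ h : τ.F, τ.IsTail h → Y.IsPort (Y.i (Y.s h)) := fun h ht => by
    by_contra hp
    have e := hjs h hp
    rw [show j h = h from ht] at e
    exact Y.i_ne _ e
  obtain ⟨f, fH, fV⟩ := exists_toJK_hom_of_bijective (τ := τ) (Y := Y) id id
    Function.bijective_id Function.bijective_id (fun _ => rfl)
    (fun x hx => hjs x fun hp => hx (j2 x hp))
  have hH : f.fH = id := funext fH
  have := isIso_of_isPort τ.toJK_noIsolatedEdges hY f (by rw [hH]; exact Function.injective_id)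
    (by rw [show f.fV = id from funext fV]; exact Function.bijective_id) (fun h hp => by
      rw [hH]
      exact tail h (isPort_i_s.1 hp))
  exact ⟨τ, ⟨asIso f⟩⟩

/-! ### Graftings, compressions and factorisations -/

lemma comp_hF {τ σ ρ : BMGraph} (g : τ ⟶ σ) (c : σ ⟶ ρ) (f : ρ.F) :
    (g ≫ c).hF f = g.hF (c.hF f) := rfl

lemma comp_jh_left {τ σ ρ : BMGraph} (g : τ ⟶ σ) (c : σ ⟶ ρ) (f : τ.F)
    (hf : f ∉ Set.range (g ≫ c).hF) (hf' : f ∉ Set.range g.hF) :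
    ((g ≫ c).jh ⟨f, hf⟩).1 = (g.jh ⟨f, hf'⟩).1 := compJ_not_range g c f hf hf'

lemma comp_jh_right {τ σ ρ : BMGraph} (g : τ ⟶ σ) (c : σ ⟶ ρ) (f : σ.F)
    (hf : g.hF f ∉ Set.range (g ≫ c).hF) (hf' : f ∉ Set.range c.hF) :
    ((g ≫ c).jh ⟨g.hF f, hf⟩).1 = g.hF (c.jh ⟨f, hf'⟩).1 := compJ_range g c f hf hf'

lemma IsGrafting.comp {τ σ ρ : BMGraph} {g : τ ⟶ σ} {c : σ ⟶ ρ} (hg : IsGrafting g)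
    (hc : IsGrafting c) : IsGrafting (g ≫ c) := ⟨hc.1.comp hg.1, hg.2.comp hc.2⟩

lemma IsCompression.comp {τ σ ρ : BMGraph} {g : τ ⟶ σ} {c : σ ⟶ ρ} (hg : IsCompression g)
    (hc : IsCompression c) : IsCompression (g ≫ c) := 
  show Set.BijOn (g.hF ∘ c.hF) _ _ from Set.BijOn.comp (show Set.BijOn g.hF _ _ from hg) hc

lemma isGrafting_id (τ : BMGraph) : IsGrafting (𝟙 τ) :=
  ⟨Function.bijective_id, Function.bijective_id⟩

lemma isCompression_id (τ : BMGraph) : IsCompression (𝟙 τ) := Set.bijOn_id _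

namespace IsCompression
variable {σ ρ : BMGraph} {c : σ ⟶ ρ}

/-- For an arbitrary morphism `Hom.edge` gives compatibility only where the image lies on an edge of
the source. For a compression, every tail of `σ` is the image of a tail of `ρ`, so a flag on an edge
of `ρ` has its image on an edge of `σ`, and compatibility holds everywhere. -/
lemma hF_j (hc : IsCompression c) (y : ρ.F) : c.hF (ρ.j y) = σ.j (c.hF y) := by
  by_cases hy : ρ.IsTail y
  · rw [show ρ.j y = y from hy]
    exact (show σ.j (c.hF y) = c.hF y from hc.1 hy).symm
  · have hn : σ.j (c.hF y) ≠ c.hF y := fun ht => hy (by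
      obtain ⟨z, hz, e⟩ := hc.2.2 (show c.hF y ∈ {f | σ.IsTail f} from ht)
      rw [← c.hF_inj e]
      exact hz)
    obtain ⟨z, hz⟩ := (c.j_range (c.hF y)).2 ⟨y, rfl⟩
    rw [c.edge y z hz.symm (by rwa [hz]), hz]

lemma not_isTail (hc : IsCompression c) {f : σ.F} (hf : f ∉ Set.range c.hF) : ¬ σ.IsTail f :=
  fun ht => by
    obtain ⟨z, _, e⟩ := hc.2.2 (show f ∈ {f | σ.IsTail f} from ht)
    exact hf ⟨z, e⟩

/-- A compression has no virtual contractions, since all tails are kept. Its involution is thus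
forced by `σ`, and a compression is determined by its maps on flags and vertices. -/
lemma jh_eq (hc : IsCompression c) (f : σ.F) (hf : f ∉ Set.range c.hF) :
    (c.jh ⟨f, hf⟩).1 = σ.j f := c.jh_edge ⟨f, hf⟩ (hc.not_isTail hf)

lemma isTail_hF (hc : IsCompression c) {y : ρ.F} : σ.IsTail (c.hF y) ↔ ρ.IsTail y := by
  refine ⟨fun h => c.hF_inj ?_, fun h => hc.1 h⟩
  rw [hc.hF_j]
  exact h

end IsCompression

/-- The involution obtained by glueing all edges, actual, grafted and contracted. -/
lemma exists_involution {τ ρ : BMGraph} (h : τ ⟶ ρ) : ∃ J : τ.F → τ.F,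
    (∀ y, J (h.hF y) = h.hF (ρ.j y)) ∧
      ∀ f (hf : f ∉ Set.range h.hF), J f = (h.jh ⟨f, hf⟩).1 := by
  have key : ∀ f, ∃ f', (∀ y, f = h.hF y → f' = h.hF (ρ.j y)) ∧
      ∀ (hf : f ∉ Set.range h.hF), f' = (h.jh ⟨f, hf⟩).1 := fun f => by
    by_cases hf : f ∈ Set.range h.hF
    · obtain ⟨y, rfl⟩ := hf
      exact ⟨h.hF (ρ.j y), fun z hz => by rw [h.hF_inj hz], fun hf => (hf ⟨y, rfl⟩).elim⟩
    · exact ⟨(h.jh ⟨f, hf⟩).1, fun y hy => (hf ⟨y, hy.symm⟩).elim, fun _ => rfl⟩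
  choose J h1 h2 using key
  exact ⟨J, fun y => h1 _ y rfl, h2⟩

/-- In a factorisation as a grafting followed by a compression, the involution of the intermediate
graph is determined by the composite. -/
lemma hF_j_of_factorisation {τ σ ρ : BMGraph} {g : τ ⟶ σ} {c : σ ⟶ ρ} (hc : IsCompression c)
    {J : τ.F → τ.F} (h1 : ∀ y, J ((g ≫ c).hF y) = (g ≫ c).hF (ρ.j y))
    (h2 : ∀ f (hf : f ∉ Set.range (g ≫ c).hF), J f = ((g ≫ c).jh ⟨f, hf⟩).1) (x : σ.F) :
    g.hF (σ.j x) = J (g.hF x) := by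
  by_cases hx : x ∈ Set.range c.hF
  · obtain ⟨y, rfl⟩ := hx
    rw [← hc.hF_j, ← comp_hF, ← comp_hF, h1]
  · have hx' : g.hF x ∉ Set.range (g ≫ c).hF := not_range_of_left g c hx
    rw [h2 _ hx', comp_jh_right g c x hx' hx, hc.jh_eq]

/-- Every morphism is a grafting followed by a compression. -/
lemma exists_factorisation {τ ρ : BMGraph} (h : τ ⟶ ρ) :
    ∃ (σ : BMGraph) (g : τ ⟶ σ) (c : σ ⟶ ρ), IsGrafting g ∧ IsCompression c ∧ g ≫ c = h := by
  obtain ⟨J, J1, J2⟩ := exists_involution h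
  -- The intermediate graph has the vertices and flags of `τ` and the involution `J`. The grafting
  -- is the identity on both sets, and the compression has the same data as `h`.
  let σ : BMGraph :=
    { V := τ.V
      F := τ.F
      finV := τ.finV
      finF := τ.finF
      bd := τ.bd
      j := J
      j_j := fun f => by
        by_cases hf : f ∈ Set.range h.hF
        · obtain ⟨y, rfl⟩ := hf
          rw [J1, J1, ρ.j_j]
        · rw [J2 f hf, J2 _ (h.jh ⟨f, hf⟩).2, h.jh_jh] }
  let g : Hom τ σ :=
    { hF := id
      hV := id
      jh := fun f => (f.2 ⟨f.1, rfl⟩).elim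
      jh_jh := fun f => (f.2 ⟨f.1, rfl⟩).elim
      hF_inj := Function.injective_id
      hV_surj := Function.surjective_id
      j_range := fun f => ⟨fun _ => ⟨f, rfl⟩, fun _ => ⟨_, rfl⟩⟩
      jh_ne := fun f => (f.2 ⟨f.1, rfl⟩).elim
      jh_edge := fun f => (f.2 ⟨f.1, rfl⟩).elim
      hV_bd := fun _ => rfl
      hV_jh := fun f => (f.2 ⟨f.1, rfl⟩).elim
      -- An edge of `τ` is an orbit of `J`: by `h.edge` if its flags are kept, and by `jh_edge` if
      -- they are contracted.
      edge := fun f f' e hne => by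
        change τ.j f = f' at e
        change f' ≠ f at hne
        change J f = f'
        by_cases hf : f ∈ Set.range h.hF
        · obtain ⟨y, hy⟩ := hf
          obtain ⟨z, hz⟩ := (h.j_range f).2 ⟨y, hy⟩
          have e' := h.edge y z (by rw [hy, hz]) (by rw [hz, hy, e]; exact hne)
          rw [← hy, J1, e', hz, e]
        · rw [J2 f hf, h.jh_edge ⟨f, hf⟩ (by rw [e]; exact hne), e] }
  let c : Hom σ ρ :=
    { hF := h.hF
      hV := h.hV
      jh := h.jh
      jh_jh := h.jh_jh
      hF_inj := h.hF_inj
      hV_surj := h.hV_surj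
      j_range := fun f => by
        change J f ∈ _ ↔ _
        by_cases hf : f ∈ Set.range h.hF
        · obtain ⟨y, rfl⟩ := hf
          rw [J1]
          exact ⟨fun _ => ⟨_, rfl⟩, fun _ => ⟨_, rfl⟩⟩
        · rw [J2 f hf]
          exact ⟨fun hn => ((h.jh ⟨f, hf⟩).2 hn).elim, fun hn => (hf hn).elim⟩
      jh_ne := h.jh_ne
      jh_edge := fun f _ => (J2 f.1 f.2).symm
      hV_bd := h.hV_bd
      hV_jh := h.hV_jh
      edge := fun f f' e _ => h.hF_inj ((J1 f).symm.trans e) }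
  refine ⟨σ, g, c, ⟨Function.bijective_id, Function.bijective_id⟩,
    ⟨fun y hy => ?_, h.hF_inj.injOn, fun f hf => ?_⟩, Hom.ext' rfl rfl fun f hf hf' => ?_⟩
  · change J (h.hF y) = h.hF y
    rw [J1, show ρ.j y = y from hy]
  · have hf' : J f = f := hf
    by_cases hr : f ∈ Set.range h.hF
    · obtain ⟨y, rfl⟩ := hr
      exact ⟨y, h.hF_inj (by rw [← J1, hf']), rfl⟩
    -- A contracted flag is never fixed by `J`, because `jh` has no fixpoints. So all tails of the
    -- intermediate graph come from `ρ`.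
    · rw [J2 f hr] at hf'
      exact (h.jh_ne ⟨f, hr⟩ (Subtype.ext hf')).elim
  · exact compJ_range g c f hf hf'

end BMGraph

end

section
open JKGraph CCP KGr

namespace BMGraph

/-! ### Graftings and reduced covers -/

lemma CorrespondsToGrafting.fH_hF {τ σ : BMGraph} {g : τ ⟶ σ} {f : τ.toJK ⟶ σ.toJK}
    (h : CorrespondsToGrafting g f) (y : σ.F) : f.fH (g.hF y) = y := g.hF_inj (h.2 _)

lemma CorrespondsToGrafting.comp {τ σ ρ : BMGraph} {g : τ ⟶ σ} {g' : σ ⟶ ρ}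
    {f : τ.toJK ⟶ σ.toJK} {f' : σ.toJK ⟶ ρ.toJK} (h : CorrespondsToGrafting g f)
    (h' : CorrespondsToGrafting g' f') : CorrespondsToGrafting (g ≫ g') (f ≫ f') :=
  ⟨fun v => (h'.1 (f.fV v)).trans (congrArg g'.hV (h.1 v)),
    fun x => (congrArg g.hF (h'.2 (f.fH x))).trans (h.2 x)⟩

lemma correspondsToGrafting_id (τ : BMGraph) : CorrespondsToGrafting (𝟙 τ) (𝟙 τ.toJK) :=
  ⟨fun _ => rfl, fun _ => rfl⟩

lemma CorrespondsToGrafting.isReducedCover {τ σ : BMGraph} {g : τ ⟶ σ} {f : τ.toJK ⟶ σ.toJK}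
    (hg : IsGrafting g) (h : CorrespondsToGrafting g f) : IsReducedCover f := by
  have hV : Function.Bijective f.fV := by
    rw [show f.fV = g.hV from funext h.1]
    exact hg.1
  exact (isReducedCover_iff τ.toJK_noIsolatedEdges f).2
    ⟨f.fA_surjective σ.toJK_noIsolatedEdges hV.2, hV⟩

/-- A grafting contracts no flag, so there is no involution to compare. -/
lemma CorrespondsToGrafting.unique {τ σ : BMGraph} {g g' : τ ⟶ σ} {f : τ.toJK ⟶ σ.toJK}
    (hg : IsGrafting g) (h : CorrespondsToGrafting g f) (h' : CorrespondsToGrafting g' f) :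
    g = g' := by
  refine Hom.ext' (funext fun y => ?_) (funext fun v => ?_) fun x hx _ => ?_
  · have e := h'.2 (g.hF y)
    rw [h.fH_hF] at e
    exact e.symm
  · exact (h.1 v).symm.trans (h'.1 v)
  · exact (hx (hg.2.2 x)).elim

/-- On flags the etale morphism is the inverse of `g.hF`. A tail may become part of an edge, and
this puts no condition on the morphism. By `Hom.edge` an edge of `τ` stays an edge, its two flags
having distinct images. -/
lemma exists_correspondsToGrafting {τ σ : BMGraph} {g : τ ⟶ σ} (hg : IsGrafting g) :
    ∃ f : τ.toJK ⟶ σ.toJK, CorrespondsToGrafting g f := by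
  let e := Equiv.ofBijective _ hg.2
  have he : ∀ x, g.hF (e.symm x) = x := fun x => e.apply_symm_apply x
  obtain ⟨f, f1, f2⟩ := exists_toJK_hom_of_bijective (Y := σ.toJK) e.symm g.hV e.symm.bijective
    hg.1 (fun x => by
      conv_lhs => rw [← he x]
      exact g.hV_bd _) (fun x hx => by
      refine i_s_eq_s.2 ?_
      have h := g.edge (e.symm x) (e.symm (τ.j x)) (by rw [he, he]) (by rw [he, he]; exact hx)
      refine ⟨fun ht => hx ?_, h⟩
      have h' : e.symm (τ.j x) = e.symm x := h.symm.trans ht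
      exact e.symm.injective h')
  exact ⟨f, f2, fun x => (congrArg g.hF (f1 x)).trans (he x)⟩

/-- A reduced cover is bijective on vertices, hence on flags. With nothing contracted, all
conditions on `jh` are vacuous. The substance is in `edge`: an edge of `τ` is an equation between
arcs, and `f` preserves it. -/
lemma exists_grafting {τ σ : BMGraph} (f : τ.toJK ⟶ σ.toJK) (hf : IsReducedCover f) :
    ∃ g : τ ⟶ σ, IsGrafting g ∧ CorrespondsToGrafting g f := by
  have hV := ((isReducedCover_iff τ.toJK_noIsolatedEdges f).1 hf).2
  have hH : Function.Bijective f.fH := ⟨f.fH_injective hV.1, f.fH_surjective hV.2⟩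
  let e : τ.F ≃ σ.F := Equiv.ofBijective _ hH
  have he : ∀ y, f.fH (e.symm y) = y := fun y => e.apply_symm_apply y
  have he' : ∀ x, e.symm (f.fH x) = x := fun x => e.symm_apply_apply x
  have hr : ∀ x, x ∈ Set.range e.symm := fun x => ⟨_, he' x⟩
  let g : Hom τ σ :=
    { hF := e.symm
      hV := f.fV
      jh := fun x => (x.2 (hr _)).elim
      jh_jh := fun x => (x.2 (hr _)).elim
      hF_inj := e.symm.injective
      hV_surj := hV.2
      j_range := fun x => ⟨fun _ => hr _, fun _ => hr _⟩
      jh_ne := fun x => (x.2 (hr _)).elim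
      jh_edge := fun x => (x.2 (hr _)).elim
      hV_bd := fun y => (f.map_p (e.symm y)).trans (congrArg σ.bd (he y))
      hV_jh := fun x => (x.2 (hr _)).elim
      edge := fun y y' h hne => by
        have h1 : τ.toJK.i (τ.toJK.s (e.symm y)) = τ.toJK.s (e.symm y') :=
          i_s_eq_s.2 ⟨fun ht => hne (h.symm.trans ht), h⟩
        have h2 : σ.toJK.i (σ.toJK.s (f.fH (e.symm y))) = σ.toJK.s (f.fH (e.symm y')) :=
          ((congrArg σ.toJK.i (f.map_s _).symm).trans (f.map_i _).symm).trans
            ((congrArg f.fA h1).trans (f.map_s _))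
        have h3 : σ.j (f.fH (e.symm y)) = f.fH (e.symm y') := (i_s_eq_s.1 h2).2
        rwa [he, he] at h3 }
  exact ⟨g, ⟨hV, e.symm.bijective⟩, fun _ => rfl, he'⟩

/-! ### Compressions and generic morphisms -/

lemma correspondsToCompression_id (τ : BMGraph) :
    CorrespondsToCompression (𝟙 τ) (𝟙 τ.toKGr) := by
  -- Leaving the decoration variable turns the transport along an equality of decorations into a
  -- substitution of variables, so that the underlying gluing stays known.
  have h : ∀ ψ : nerve.obj τ.toJK ⟶ bar (nerve.obj τ.toJK), ψ = 𝟙 _ ≫ eta _ →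
      ∃ s : Subst ψ (𝟙 (nerve.obj τ.toJK)),
        s.toGluing = (Subst.corollas (𝟙 (nerve.obj τ.toJK))).toGluing := by
    rintro _ rfl
    exact ⟨_, rfl⟩
  obtain ⟨s, hs⟩ := h (dec (𝟙 τ.toKGr)) (Category.id_comp _).symm
  refine ⟨s, ?_⟩
  change (∀ x v, (s.toGluing.ι x).fV v = x) ∧ ∀ f : τ.F, s.toGluing.e (τ.toJK.s f) = τ.toJK.s f
  rw [hs]
  exact ⟨fun _ _ => rfl, fun _ => rfl⟩

lemma CorrespondsToCompression.comp {τ σ ρ : BMGraph} {c : τ ⟶ σ} {d : σ ⟶ ρ}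
    {k : σ.toKGr ⟶ τ.toKGr} {l : ρ.toKGr ⟶ σ.toKGr} (h : CorrespondsToCompression c k)
    (h' : CorrespondsToCompression d l) : CorrespondsToCompression (c ≫ d) (l ≫ k) := by
  obtain ⟨s, s1, s2⟩ := h
  obtain ⟨t, t1, t2⟩ := h'
  -- The decorations produced by `Subst.map` and `Subst.exists_comp` are not literally the required
  -- ones. Here and in `key2` they are replaced while keeping the gluing.
  have key : ∀ φ : nerve.obj σ.toJK ⟶ bar (nerve.obj τ.toJK), φ = 𝟙 _ ≫ dec k →
      ∃ t' : Subst (dec l ≫ barMap (dec k)) φ, t'.toGluing = t.toGluing := by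
    rintro _ rfl
    exact ⟨t.map (dec k), rfl⟩
  obtain ⟨t', ht'⟩ := key (dec k) (Category.id_comp _).symm
  obtain ⟨ω, h1, h2⟩ := Subst.exists_comp ρ.toKGr.ni t' s
  have h3 : (dec l ≫ barMap (dec k)) ≫ mu _ = dec (l ≫ k) := (Category.assoc _ _ _).trans
    (dec_comp l k).symm
  have key2 : ∀ ψ, (dec l ≫ barMap (dec k)) ≫ mu _ = ψ →
      ∃ w : Subst ψ (𝟙 (nerve.obj τ.toJK)), w.toGluing = ω.toGluing := by
    rintro _ rfl
    exact ⟨ω, rfl⟩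
  obtain ⟨w, hw⟩ := key2 _ h3
  have t1' : ∀ x v, d.hV ((t'.toGluing.ι x).fV v) = x := by rw [ht']; exact t1
  have t2' : ∀ f : ρ.F, t'.toGluing.e (ρ.toJK.s f) = σ.toJK.s (d.hF f) := by rw [ht']; exact t2
  refine ⟨w, ?_⟩
  rw [hw]
  refine ⟨fun x v => ?_, fun f => ?_⟩
  -- A vertex of the composite piece at `x` lies in a piece of `s` at a vertex of `σ`, which in turn
  -- lies in the piece of `t` at `x`.
  · obtain ⟨y, u, e⟩ := h2 x v
    exact (congrArg (fun z => d.hV (c.hV z)) e).trans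
      ((congrArg d.hV (s1 _ u)).trans (t1' x y))
  · exact (h1 _).trans ((congrArg s.e (t2' f)).trans (s2 _))

lemma CorrespondsToCompression.isGeneric {σ ρ : BMGraph} {c : σ ⟶ ρ} {k : ρ.toKGr ⟶ σ.toKGr}
    (h : CorrespondsToCompression c k) : IsGeneric k :=
  (isGeneric_iff k).2 ⟨h.choose⟩

/-- The pieces together exhaust the vertices of `σ`, so as soon as each is contained in the fibre
over its index, it fills that fibre. -/
lemma hV_eq_iff {σ ρ : BMGraph} {c : σ ⟶ ρ} (gl : Gluing ρ.toJK σ.toJK)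
    (h : ∀ x v, c.hV ((gl.ι x).fV v) = x) (x : ρ.V) (v : σ.V) :
    (∃ w, (gl.ι x).fV w = v) ↔ c.hV v = x := by
  constructor
  · rintro ⟨w, rfl⟩
    exact h x w
  · rintro rfl
    obtain ⟨y, w, rfl⟩ := gl.surjV v
    rw [h y w]
    exact ⟨w, rfl⟩

/-- Both substitutions have the fibres of `c.hV` as vertices of their pieces. Their arc maps agree
on flags, hence everywhere, since each arc of `ρ.toJK` is that of a flag or opposite to one.
`Subst.dec_unique` then applies. -/
lemma CorrespondsToCompression.unique {σ ρ : BMGraph} {c : σ ⟶ ρ} {k l : ρ.toKGr ⟶ σ.toKGr}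
    (h : CorrespondsToCompression c k) (h' : CorrespondsToCompression c l) : k = l := by
  obtain ⟨s, s1, s2⟩ := h
  obtain ⟨t, t1, t2⟩ := h'
  have hs : ∀ f, s.e (ρ.toJK.s f) = t.e (ρ.toJK.s f) := fun f => (s2 f).trans (t2 f).symm
  refine KGr.dec_ext (Subst.dec_unique ρ.toJK_noIsolatedEdges s t (fun a => ?_) fun x v => ?_)
  · obtain ⟨x, k, rfl | rfl⟩ := Gluing.eq_i_s ρ.toJK_noIsolatedEdges a
    · exact hs _
    · exact (s.e_i _).trans ((congrArg σ.toJK.i (hs k.1)).trans (t.e_i _).symm)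
  · exact (hV_eq_iff s.toGluing s1 x v).trans (hV_eq_iff t.toGluing t1 x v).symm

open Classical in
/-- The graph over `σ` substituted into the vertex `x` by a compression. -/
noncomputable def fiber {σ ρ : BMGraph} {c : σ ⟶ ρ} (hc : IsCompression c) (x : ρ.V) :
    NGraph (ρ.toJK.Flags x) where
  G :=
    { A := {f : σ.F // c.hV (σ.bd f) = x} ⊕ {f : ρ.F // ρ.bd f = x}
      H := {f : σ.F // c.hV (σ.bd f) = x}
      V := {v : σ.V // c.hV v = x}
      finA := have := σ.finF; have := ρ.finF; inferInstance
      finH := have := σ.finF; inferInstance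
      finV := have := σ.finV; inferInstance
      -- A kept flag faces a new port of the piece, even if in `σ` it is joined to a flag of the
      -- same fibre. Only contracted edges stay inner, and both of their ends lie in one fibre by
      -- `c.hV_jh`.
      i := Sum.elim (fun f => if h : f.1 ∈ Set.range c.hF
        then Sum.inr ⟨h.choose, by rw [← c.hV_bd, h.choose_spec]; exact f.2⟩
        else Sum.inl ⟨σ.j f.1, by
          rw [← hc.jh_eq f.1 h, ← c.hV_jh ⟨f.1, h⟩]; exact f.2⟩)
        fun k => Sum.inl ⟨c.hF k.1, by rw [c.hV_bd]; exact k.2⟩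
      s := Sum.inl
      p := fun f => ⟨σ.bd f.1, f.2⟩
      s_inj := Sum.inl_injective
      i_i := by
        rintro (⟨f, hf⟩ | k)
        · by_cases h : f ∈ Set.range c.hF
          · simp only [Sum.elim_inl, dif_pos h, Sum.elim_inr]
            exact congrArg Sum.inl (Subtype.ext h.choose_spec)
          · have h' : σ.j f ∉ Set.range c.hF := fun e => h ((c.j_range f).1 e)
            simp only [Sum.elim_inl, dif_neg h, dif_neg h', σ.j_j]
        · have h : c.hF k.1 ∈ Set.range c.hF := ⟨_, rfl⟩
          simp only [Sum.elim_inr, Sum.elim_inl, dif_pos h]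
          exact congrArg Sum.inr (Subtype.ext (c.hF_inj h.choose_spec))
      i_ne := by
        rintro (⟨f, hf⟩ | k)
        · by_cases h : f ∈ Set.range c.hF
          · simp only [Sum.elim_inl, dif_pos h]
            exact fun e => by cases e
          · simp only [Sum.elim_inl, dif_neg h]
            exact fun e => hc.not_isTail h (congrArg Subtype.val (Sum.inl_injective e))
        · exact fun e => by cases e }
  eff := by
    -- Surjectivity of `c.hV` is what makes the piece nonempty, as required for an effective graph.
    obtain ⟨v, hv⟩ := c.hV_surj x
    refine ⟨Or.inl ⟨⟨v, hv⟩⟩, ?_⟩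
    rintro (f | k) ⟨h1, h2⟩
    · exact h1 f rfl
    · exact h2 _ rfl
  b := Sum.inr
  b_inj := Sum.inr_injective
  b_port := by
    rintro (f | k)
    · exact ⟨fun h => (h f rfl).elim, fun ⟨_, e⟩ => by cases e⟩
    · exact ⟨fun _ => ⟨k, rfl⟩, fun _ h e => by cases e⟩

/-- The etale morphism from a fiber of a compression. -/
noncomputable def fiberHom {σ ρ : BMGraph} {c : σ ⟶ ρ} (hc : IsCompression c) (x : ρ.V) :
    (fiber hc x).G ⟶ σ.toJK where
  -- The port labelled `k` goes to the arc opposite the flag `c.hF k`, which is a port of `σ.toJK`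
  -- only if that flag is a tail.
  fA := Sum.elim (fun f => σ.toJK.s f.1) fun k => σ.toJK.i (σ.toJK.s (c.hF k.1))
  fH f := f.1
  fV v := v.1
  map_i := by
    rintro (⟨f, hf⟩ | k)
    · dsimp only [fiber, Sum.elim_inl]
      split_ifs with h
      · change σ.toJK.i (σ.toJK.s (c.hF h.choose)) = σ.toJK.i (σ.toJK.s f)
        rw [h.choose_spec]
      · exact (i_s (hc.not_isTail h)).symm
    · exact (σ.toJK.i_i _).symm
  map_s _ := rfl
  map_p _ := rfl
  etale v h e := ⟨⟨h, (congrArg c.hV e).trans v.2⟩, ⟨Subtype.ext e, rfl⟩,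
    fun _ hy => Subtype.ext hy.2⟩

/-- Compatibility with `i` extends `c.hF` from flags to all arcs. An arc on an inner edge of `ρ` is
both a flag and opposite to a flag, and the two prescriptions agree by `hF_j`. The bijection on
ports is the bijection on tails. -/
lemma exists_arcMap {σ ρ : BMGraph} {c : σ ⟶ ρ} (hc : IsCompression c) :
    ∃ e : ρ.toJK.A → σ.toJK.A, (∀ f, e (ρ.toJK.s f) = σ.toJK.s (c.hF f)) ∧
      (∀ a, e (ρ.toJK.i a) = σ.toJK.i (e a)) ∧
      Set.BijOn e {a | ρ.toJK.IsPort a} {a | σ.toJK.IsPort a} := by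
  have port : ∀ (τ : BMGraph) (a : τ.toJK.A), τ.toJK.IsPort a →
      ∃ f : τ.F, τ.IsTail f ∧ a = τ.toJK.i (τ.toJK.s f) := fun τ a ha => by
    obtain ⟨f, hf⟩ := IsPort.of_not fun hb => τ.toJK_noIsolatedEdges a ⟨ha, hb⟩
    have e : a = τ.toJK.i (τ.toJK.s f) := by rw [hf, τ.toJK.i_i]
    rw [e] at ha
    exact ⟨f, isPort_i_s.1 ha, e⟩
  have key : ∀ a, ∃ b, (∀ f, a = ρ.toJK.s f → b = σ.toJK.s (c.hF f)) ∧
      ∀ f, a = ρ.toJK.i (ρ.toJK.s f) → b = σ.toJK.i (σ.toJK.s (c.hF f)) := by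
    intro a
    by_cases ha : ρ.toJK.IsPort a
    · obtain ⟨f, hf, rfl⟩ := port ρ a ha
      refine ⟨σ.toJK.i (σ.toJK.s (c.hF f)), fun f' e => (ha f' e.symm).elim, fun f' e => ?_⟩
      have e' := congrArg ρ.toJK.i e
      rw [ρ.toJK.i_i, ρ.toJK.i_i] at e'
      rw [ρ.toJK.s_inj e']
    · obtain ⟨f, rfl⟩ := IsPort.of_not ha
      refine ⟨σ.toJK.s (c.hF f), fun f' e => by rw [ρ.toJK.s_inj e], fun f' e => ?_⟩
      obtain ⟨hn, rfl⟩ := i_s_eq_s.1 e.symm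
      rw [i_s (mt hc.isTail_hF.1 hn)]
      exact congrArg σ.toJK.s (hc.hF_j f')
  choose e e1 e2 using key
  replace e1 : ∀ f : ρ.F, e (ρ.toJK.s f) = σ.toJK.s (c.hF f) := fun f => e1 _ f rfl
  replace e2 : ∀ f : ρ.F, e (ρ.toJK.i (ρ.toJK.s f)) = σ.toJK.i (σ.toJK.s (c.hF f)) :=
    fun f => e2 _ f rfl
  refine ⟨e, e1, fun a => ?_, fun a ha => ?_, fun a ha b hb h => ?_, fun a ha => ?_⟩
  · obtain ⟨x, k, rfl | rfl⟩ := Gluing.eq_i_s ρ.toJK_noIsolatedEdges a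
    · exact (e2 k.1).trans (congrArg σ.toJK.i (e1 k.1)).symm
    · rw [ρ.toJK.i_i]
      exact (e1 k.1).trans ((congrArg σ.toJK.i (e2 k.1)).trans (σ.toJK.i_i _)).symm
  · obtain ⟨f, hf, rfl⟩ := port ρ a ha
    rw [e2]
    exact isPort_i_s.2 (hc.isTail_hF.2 hf)
  · obtain ⟨f, hf, rfl⟩ := port ρ a ha
    obtain ⟨f', hf', rfl⟩ := port ρ b hb
    rw [e2, e2] at h
    have h' := congrArg σ.toJK.i h
    rw [σ.toJK.i_i, σ.toJK.i_i] at h'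
    rw [c.hF_inj (σ.toJK.s_inj h')]
  · obtain ⟨f, hf, rfl⟩ := port σ a ha
    obtain ⟨f', hf', rfl⟩ := hc.2.2 hf
    exact ⟨_, isPort_i_s.2 hf', e2 f'⟩

/-- The graph of `σ` is glued from the fibres of `c` in the pattern of `ρ`, and
`Gluing.exists_subst` turns this gluing into a Kleisli morphism. -/
lemma exists_correspondsToCompression {σ ρ : BMGraph} {c : σ ⟶ ρ} (hc : IsCompression c) :
    ∃ k : ρ.toKGr ⟶ σ.toKGr, CorrespondsToCompression c k := by
  obtain ⟨e, e1, e2, e3⟩ := exists_arcMap hc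
  let gl : Gluing ρ.toJK σ.toJK :=
    { piece := fiber hc
      ι := fiberHom hc
      e := e
      e_i := e2
      ι_b := fun x k => by
        exact ((e2 _).trans (congrArg σ.toJK.i (e1 k.1))).symm
      bijV := by
        constructor
        · rintro ⟨x, v, hv⟩ ⟨y, w, hw⟩ h
          obtain rfl : v = w := h
          subst hv hw
          rfl
        · exact fun v => ⟨⟨c.hV v, v, rfl⟩, rfl⟩
      ports := e3 }
  obtain ⟨ψ, s, hs⟩ := gl.exists_subst ρ.toJK_noIsolatedEdges
  refine ⟨ofDec ψ, s, ?_⟩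
  change (∀ x v, c.hV ((s.toGluing.ι x).fV v) = x) ∧
    ∀ f : ρ.F, s.toGluing.e (ρ.toJK.s f) = σ.toJK.s (c.hF f)
  rw [hs]
  exact ⟨fun x v => v.2, e1⟩

/-- The gluing behind a generic morphism is read off: `hF` is its arc map on flags, `hV` sends a
vertex to the index of its piece, and contracted flags are paired by the involution of `σ`. -/
lemma exists_compression {σ ρ : BMGraph} (k : ρ.toKGr ⟶ σ.toKGr) (hk : IsGeneric k) :
    ∃ c : σ ⟶ ρ, IsCompression c ∧ CorrespondsToCompression c k := by
  obtain ⟨s⟩ := (isGeneric_iff k).1 hk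
  let gl : Gluing ρ.toJK σ.toJK := s.toGluing
  -- The image flag is chosen along with the fact that its vertex lies in the piece at `ρ.bd f`,
  -- which yields `hV_bd`.
  have hF : ∀ f : ρ.F, ∃ f' : σ.F, gl.e (ρ.toJK.s f) = σ.toJK.s f' ∧
      ∃ w, (gl.ι (ρ.bd f)).fV w = σ.bd f' := fun f => by
    refine ⟨_, gl.e_s (ρ.bd f) ⟨f, rfl⟩, _, (gl.ι (ρ.bd f)).map_p _⟩
  choose hF hFe hFp using hF
  have hV : ∀ v : σ.V, ∃ x : ρ.V, ∃ w, (gl.ι x).fV w = v := gl.surjV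
  choose hV hVι using hV
  have hVe : ∀ x w, hV ((gl.ι x).fV w) = x := fun x w => by
    obtain ⟨w', hw'⟩ := hVι ((gl.ι x).fV w)
    have h : (⟨_, w'⟩ : Σ x, (gl.piece x).G.V) = ⟨x, w⟩ := gl.bijV.1 hw'
    exact congrArg Sigma.fst h
  have hF_inj : Function.Injective hF := fun f f' h => by
    apply ρ.toJK.s_inj
    apply gl.e_inj
    rw [hFe, hFe, h]
  have tail : ∀ f, σ.IsTail (hF f) ↔ ρ.IsTail f := fun f => by
    rw [← isPort_i_s, ← isPort_i_s, ← hFe, ← gl.e_i, gl.isPort_e]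
  have hFj : ∀ f, hF (ρ.j f) = σ.j (hF f) := fun f => by
    by_cases hf : ρ.IsTail f
    · rw [show σ.j (hF f) = hF f from (tail f).2 hf, show ρ.j f = f from hf]
    · have h := hFe (ρ.j f)
      rw [← i_s hf, gl.e_i, hFe] at h
      exact (i_s_eq_s.1 h).2.symm
  have surj : ∀ f, σ.IsTail f → ∃ y, ρ.IsTail y ∧ hF y = f := fun f hf => by
    obtain ⟨r, hr, h⟩ := gl.ports.2.2 (isPort_i_s.2 hf)
    obtain ⟨y, hy⟩ := IsPort.of_not fun hb => ρ.toJK_noIsolatedEdges r ⟨hr, hb⟩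
    have h' : σ.toJK.s (hF y) = σ.toJK.s f := by
      refine (hFe y).symm.trans ?_
      rw [hy, gl.e_i, h, σ.toJK.i_i]
    obtain rfl : hF y = f := σ.toJK.s_inj h'
    exact ⟨y, (tail y).1 hf, rfl⟩
  have ntail : ∀ f, f ∉ Set.range hF → ¬ σ.IsTail f := fun f hf ht => by
    obtain ⟨y, _, hy⟩ := surj f ht
    exact hf ⟨y, hy⟩
  have jr : ∀ f, f ∈ Set.range hF → σ.j f ∈ Set.range hF := by
    rintro _ ⟨y, rfl⟩
    exact ⟨_, hFj y⟩
  have jn : ∀ f, f ∉ Set.range hF → σ.j f ∉ Set.range hF := fun f hf h => hf (by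
    have := jr _ h
    rwa [σ.j_j] at this)
  have hVj : ∀ f, f ∉ Set.range hF → hV (σ.bd f) = hV (σ.bd (σ.j f)) := fun f hf => by
    obtain ⟨x, h, rfl⟩ := surj_fH gl.ι gl.bijV f
    -- In its piece a contracted flag does not face a port, since the flags facing ports are those
    -- coming from `ρ`. Its edge is therefore inner to the piece, and both ends have index `x`.
    have hn : ¬ (gl.piece x).G.IsPort ((gl.piece x).G.i ((gl.piece x).G.s h)) := fun hp => by
      obtain ⟨k, hk⟩ := ((gl.piece x).b_port _).1 hp
      have e := gl.ι_b x k
      rw [hk, (gl.ι x).map_i, gl.e_i] at e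
      have e' := congrArg σ.toJK.i e
      rw [σ.toJK.i_i, σ.toJK.i_i, (gl.ι x).map_s] at e'
      exact hf ⟨k.1, (σ.toJK.s_inj (e'.trans (hFe k.1))).symm⟩
    obtain ⟨h', hh'⟩ := IsPort.of_not hn
    have e := congrArg (gl.ι x).fA hh'
    rw [(gl.ι x).map_i, (gl.ι x).map_s, (gl.ι x).map_s] at e
    have e' := (i_s_eq_s.1 e.symm).2
    have key : ∀ h, hV (σ.bd ((gl.ι x).fH h)) = x := fun h =>
      (congrArg hV ((gl.ι x).map_p h).symm).trans (hVe x _)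
    rw [e', key, key]
  let c : Hom σ ρ :=
    { hF := hF
      hV := hV
      jh := fun f => ⟨σ.j f.1, jn f.1 f.2⟩
      jh_jh := fun f => Subtype.ext (σ.j_j f.1)
      hF_inj := hF_inj
      hV_surj := fun x => by
        obtain ⟨w⟩ := (gl.piece x).eff.nonempty_V
        exact ⟨_, hVe x w⟩
      j_range := fun f => ⟨fun h => by
        by_contra hf
        exact jn f hf h, jr f⟩
      jh_ne := fun f h => ntail f.1 f.2 (congrArg Subtype.val h)
      jh_edge := fun _ _ => rfl
      hV_bd := fun f => by
        obtain ⟨w, hw⟩ := hFp f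
        exact (congrArg hV hw).symm.trans (hVe _ w)
      hV_jh := fun f => hVj f.1 f.2
      edge := fun f f' h _ => hF_inj (by rw [hFj, h]) }
  exact ⟨c, ⟨fun f hf => (tail f).2 hf, hF_inj.injOn, fun f hf => surj f hf⟩, s, hVe, hFe⟩

end BMGraph

end

section
open JKGraph CCP KGr

/-- Both conditions, surjectivity on arcs and bijectivity on vertices, can be cancelled on the
right-hand factor; the latter uses that `f` is bijective on vertices. -/
lemma JKGraph.IsReducedCover.of_comp {X Y Z : JKGraph} {f : X ⟶ Y} {u : Y ⟶ Z} {f' : X ⟶ Z}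
    (hf : IsReducedCover f) (hX : X.NoIsolatedEdges) (hY : Y.NoIsolatedEdges) (hu : f ≫ u = f')
    (hf' : IsReducedCover f') : IsReducedCover u := by
  subst hu
  have h := (isReducedCover_iff hX _).1 hf
  have h' := (isReducedCover_iff hX _).1 hf'
  exact (isReducedCover_iff hY u).2
    ⟨Function.Surjective.of_comp (f := u.fA) (g := f.fA) h'.1, (Function.Bijective.of_comp_iff u.fV h.2).1 h'.2⟩

namespace BMGraph

/-! ### Realisation of morphisms by cospans -/

/-- A commutative square of reduced covers and generic morphisms corresponds to a commutative
square of graftings and compressions. -/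
lemma comp_eq_of_comm {σ ρ σ' π : BMGraph} {c : σ ⟶ ρ} {g' : ρ ⟶ σ'} {g : σ ⟶ π} {c' : π ⟶ σ'}
    (hc : IsCompression c) (hg' : IsGrafting g') (hc' : IsCompression c')
    {k : ρ.toKGr ⟶ σ.toKGr} {f : ρ.toJK ⟶ σ'.toJK} {u : σ.toJK ⟶ π.toJK}
    {v : σ'.toKGr ⟶ π.toKGr} (hk : CorrespondsToCompression c k)
    (hf : CorrespondsToGrafting g' f) (hu : CorrespondsToGrafting g u)
    (hv : CorrespondsToCompression c' v)
    (h : k ≫ (free u : σ.toKGr ⟶ π.toKGr) = (free f : ρ.toKGr ⟶ σ'.toKGr) ≫ v) :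
    g ≫ c' = c ≫ g' := by
  obtain ⟨s, s1, s2⟩ := hk
  obtain ⟨t, t1, t2⟩ := hv
  -- The arc of the flag `g'.hF y` of `ρ` is followed around the square into `π`; the reduced covers
  -- invert the graftings on flags.
  have hF : ∀ y, g.hF (c'.hF y) = c.hF (g'.hF y) := fun y => by
    have h1 := fA_e_of_comm s t h (ρ.toJK.s (g'.hF y))
    have h2 : u.fA (s.e (ρ.toJK.s (g'.hF y))) = π.toJK.s (u.fH (c.hF (g'.hF y))) :=
      (congrArg u.fA (s2 _)).trans (u.map_s _)
    have h3 : t.e (f.fA (ρ.toJK.s (g'.hF y))) = π.toJK.s (c'.hF y) :=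
      (congrArg t.e ((f.map_s _).trans (congrArg σ'.toJK.s (hf.fH_hF y)))).trans (t2 y)
    have h4 : u.fH (c.hF (g'.hF y)) = c'.hF y := π.toJK.s_inj (h2.symm.trans (h1.trans h3))
    rw [← h4]
    exact hu.2 _
  have hV : ∀ z, c'.hV (g.hV z) = g'.hV (c.hV z) := fun z => by
    obtain ⟨x, w, rfl⟩ := s.surjV z
    obtain ⟨w', hw'⟩ := exists_ι_of_comm s t h x w
    have h1 : c'.hV (u.fV ((s.ι x).fV w)) = f.fV x := by
      rw [← hw']
      exact t1 _ w'
    exact (congrArg c'.hV (hu.1 _).symm).trans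
      (h1.trans ((hf.1 x).trans (congrArg g'.hV (s1 x w).symm)))
  refine Hom.ext' (funext hF) (funext hV) fun x hx hx' => ?_
  -- As `g'` is onto on flags, all contraction in `c ≫ g'` is done by `c`, which pairs `x` by the
  -- involution of `σ`.
  have hxc : x ∉ Set.range c.hF := by
    rintro ⟨y, rfl⟩
    obtain ⟨z, rfl⟩ := hg'.2.2 y
    exact hx' ⟨z, rfl⟩
  rw [comp_jh_left c g' x hx' hxc, hc.jh_eq]
  obtain ⟨y, rfl⟩ : ∃ y : π.F, g.hF y = x := ⟨u.fH x, hu.2 x⟩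
  have hy : y ∉ Set.range c'.hF := fun ⟨z, hz⟩ => hx ⟨z, congrArg g.hF hz⟩
  rw [comp_jh_right g c' y hx hy, hc'.jh_eq]
  -- In `g ≫ c'` the pairing is by the involution of `π`. The flag is not a tail of `σ`, so `g.edge`
  -- identifies the two involutions at this flag.
  have ht := hc.not_isTail hxc
  obtain ⟨z, hz⟩ := (g.j_range (g.hF y)).2 ⟨y, rfl⟩
  rw [g.edge y z hz.symm (by rw [hz]; exact ht), hz]

/-- Transport of a generic morphism corresponding to a compression along an isomorphism. -/
lemma CorrespondsToCompression.comp_free {σ σ' ρ : BMGraph} {c : σ ⟶ ρ} {c' : σ' ⟶ ρ}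
    {k : ρ.toKGr ⟶ σ.toKGr} (h : CorrespondsToCompression c k) (θ : σ.toJK ≅ σ'.toJK)
    (hV : ∀ v, c'.hV (θ.hom.fV v) = c.hV v) (hF : ∀ y, θ.hom.fH (c.hF y) = c'.hF y) :
    CorrespondsToCompression c' (k ≫ (free θ.hom : σ.toKGr ⟶ σ'.toKGr)) := by
  obtain ⟨s, s1, s2⟩ := h
  obtain ⟨t, ht⟩ := exists_subst_comp_free (S' := σ'.toKGr) s θ.hom
  refine ⟨substPostIso t θ (Category.comp_id _), ?_⟩
  change (∀ x v, c'.hV (θ.hom.fV ((t.toGluing.ι x).fV v)) = x) ∧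
    ∀ f : ρ.F, θ.hom.fA (t.toGluing.e (ρ.toJK.s f)) = σ'.toJK.s (c'.hF f)
  rw [ht]
  exact ⟨fun x v => (hV _).trans (s1 x v), fun f => (congrArg θ.hom.fA (s2 f)).trans
    ((θ.hom.map_s _).trans (congrArg σ'.toJK.s (hF f)))⟩

/-- Two factorisations of a morphism differ by an isomorphism of the intermediate graphs. -/
lemma exists_iso_of_factorisations {τ σ σ' ρ : BMGraph} {g : τ ⟶ σ} {c : σ ⟶ ρ} {g' : τ ⟶ σ'}
    {c' : σ' ⟶ ρ} (hg : IsGrafting g) (hc : IsCompression c) (hg' : IsGrafting g')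
    (hc' : IsCompression c') (h : g ≫ c = g' ≫ c') :
    ∃ θ : σ.toJK ≅ σ'.toJK, (∀ v, θ.hom.fV (g.hV v) = g'.hV v) ∧
      ∀ x, g'.hF (θ.hom.fH x) = g.hF x := by
  -- Transported to the flags of `τ`, the involutions of `σ` and `σ'` are both `J`. Thus the
  -- bijection of flags given by `g` and `g'` preserves edges and tails.
  obtain ⟨J, J1, J2⟩ := exists_involution (g ≫ c)
  have hj := hF_j_of_factorisation hc J1 J2
  rw [h] at J1 J2
  have hj' := hF_j_of_factorisation hc' J1 J2
  let eV := Equiv.ofBijective _ hg.1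
  let eV' := Equiv.ofBijective _ hg'.1
  let eF := Equiv.ofBijective _ hg.2
  let eF' := Equiv.ofBijective _ hg'.2
  let fV : σ.V ≃ σ'.V := eV.symm.trans eV'
  let fF : σ.F ≃ σ'.F := eF.trans eF'.symm
  have hV : ∀ v, fV (g.hV v) = g'.hV v := fun v => congrArg eV' (eV.symm_apply_apply v)
  have hF : ∀ x, g'.hF (fF x) = g.hF x := fun x => eF'.apply_symm_apply (g.hF x)
  have hfj : ∀ x, σ'.j (fF x) = fF (σ.j x) := fun x => g'.hF_inj (by rw [hj', hF, hF, hj])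
  have tail : ∀ x, σ'.IsTail (fF x) ↔ σ.IsTail x := fun x => by
    refine ⟨fun ht => fF.injective ?_, fun ht => ?_⟩
    · rw [← hfj]
      exact ht
    · exact (hfj x).trans (congrArg fF ht)
  obtain ⟨f, f1, f2⟩ := exists_toJK_hom_of_bijective (Y := σ'.toJK) fF fV fF.bijective
    fV.bijective (fun x => by
      rw [← g.hV_bd, hV, ← hF]
      exact g'.hV_bd _)
    (fun x hx => i_s_eq_s.2 ⟨mt (tail x).1 hx, hfj x⟩)
  have f1' : f.fH = fF := funext f1
  have f2' : f.fV = fV := funext f2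
  have := isIso_of_isPort σ.toJK_noIsolatedEdges σ'.toJK_noIsolatedEdges f
    (f1' ▸ fF.injective) (f2' ▸ fV.bijective) fun x hx => by
      have := (tail x).2 (isPort_i_s.1 hx)
      rw [← f1] at this
      exact isPort_i_s.2 this
  exact ⟨asIso f, fun v => (f2 _).trans (hV v), fun x => (congrArg g'.hF (f1 x)).trans (hF x)⟩

/-- The morphism of cospans `q` is the class of the cospan given by a factorisation of `h` as a
grafting followed by a compression. -/
def IsRealizedBy {τ ρ : BMGraph} (h : τ ⟶ ρ) (q : Cosp.mk τ.toKGr ⟶ Cosp.mk ρ.toKGr) : Prop :=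
  ∃ (σ : BMGraph) (g : τ ⟶ σ) (c : σ ⟶ ρ) (f : τ.toJK ⟶ σ.toJK) (k : ρ.toKGr ⟶ σ.toKGr)
    (hf : IsRedCov (free f : τ.toKGr ⟶ σ.toKGr)) (hk : IsGeneric k),
    IsGrafting g ∧ IsCompression c ∧ g ≫ c = h ∧ CorrespondsToGrafting g f ∧
      CorrespondsToCompression c k ∧ q = Cosp.ofCospan ⟨σ.toKGr, free f, k, hf, hk⟩

lemma exists_cospan_of_factorisation {τ σ ρ : BMGraph} {g : τ ⟶ σ} {c : σ ⟶ ρ}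
    (hg : IsGrafting g) (hc : IsCompression c) :
    ∃ (f : τ.toJK ⟶ σ.toJK) (k : ρ.toKGr ⟶ σ.toKGr)
      (hf : IsRedCov (free f : τ.toKGr ⟶ σ.toKGr)) (hk : IsGeneric k),
      CorrespondsToGrafting g f ∧ CorrespondsToCompression c k ∧
        IsRealizedBy (g ≫ c) (Cosp.ofCospan ⟨σ.toKGr, free f, k, hf, hk⟩) := by
  obtain ⟨f, hf⟩ := exists_correspondsToGrafting hg
  obtain ⟨k, hk⟩ := exists_correspondsToCompression hc
  have hf' : IsRedCov (free f : τ.toKGr ⟶ σ.toKGr) := ⟨f, hf.isReducedCover hg, rfl⟩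
  exact ⟨f, k, hf', hk.isGeneric, hf, hk,
    σ, g, c, f, k, hf', hk.isGeneric, hg, hc, rfl, hf, hk, rfl⟩

lemma exists_isRealizedBy {τ ρ : BMGraph} (h : τ ⟶ ρ) : ∃ q, IsRealizedBy h q := by
  obtain ⟨σ, g, c, hg, hc, rfl⟩ := exists_factorisation h
  obtain ⟨f, k, hf, hk, _, _, hr⟩ := exists_cospan_of_factorisation hg hc
  exact ⟨_, hr⟩

/-- The isomorphism `θ` between the intermediate graphs carries one first leg to the other, as etale
morphisms are determined on flags and vertices. It carries one second leg to the other because at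
most one Kleisli morphism corresponds to a given compression. -/
lemma IsRealizedBy.unique {τ ρ : BMGraph} {h : τ ⟶ ρ} {q q' : Cosp.mk τ.toKGr ⟶ Cosp.mk ρ.toKGr}
    (hq : IsRealizedBy h q) (hq' : IsRealizedBy h q') : q = q' := by
  obtain ⟨σ, g, c, f, k, hf, hk, hg, hc, rfl, hgf, hck, rfl⟩ := hq
  obtain ⟨σ', g', c', f', k', hf', hk', hg', hc', e, hgf', hck', rfl⟩ := hq'
  obtain ⟨θ, hV, hF⟩ := exists_iso_of_factorisations hg hc hg' hc' e.symm
  have h1 : f ≫ θ.hom = f' := hom_ext_of_noIsolatedEdges τ.toJK_noIsolatedEdges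
    (fun x => g'.hF_inj ((hF _).trans ((hgf.2 x).trans (hgf'.2 x).symm)))
    (fun v => (congrArg θ.hom.fV (hgf.1 v)).trans ((hV v).trans (hgf'.1 v).symm))
  have h2 : k ≫ (free θ.hom : σ.toKGr ⟶ σ'.toKGr) = k' := by
    refine (hck.comp_free (c' := c') θ (fun v => ?_) fun y => g'.hF_inj ?_).unique hck'
    · obtain ⟨w, rfl⟩ := hg.1.2 v
      exact (congrArg c'.hV (hV w)).trans (congrArg (fun m => Hom.hV m w) e)
    · exact (hF _).trans (congrArg (fun m => Hom.hF m y) e).symm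
  refine Quotient.sound ⟨freeIso θ, ?_, h2⟩
  exact (free_comp _ _).trans (congrArg (fun m => (free m : τ.toKGr ⟶ σ'.toKGr)) h1)

/-- An isomorphism of cospans turns the cover `f` into the cover `f'`, so it is free on a reduced
cover `u`, and `u` corresponds to a grafting `w`. The left triangle gives `g ≫ w = g'`, and the
right one, a square with an identity side, gives `w ≫ c' = c`. That `w` is invertible plays no role.
-/
lemma IsRealizedBy.injective {τ ρ : BMGraph} {h h' : τ ⟶ ρ}
    {q : Cosp.mk τ.toKGr ⟶ Cosp.mk ρ.toKGr} (hq : IsRealizedBy h q) (hq' : IsRealizedBy h' q) :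
    h = h' := by
  obtain ⟨σ, g, c, f, k, hf, hk, hg, hc, rfl, hgf, hck, rfl⟩ := hq
  obtain ⟨σ', g', c', f', k', hf', hk', hg', hc', rfl, hgf', hck', e⟩ := hq'
  obtain ⟨θ, h1, h2⟩ := Quotient.exact e
  have hf0 := hgf.isReducedCover hg
  have hf1 := (isReducedCover_iff τ.toJK_noIsolatedEdges f).1 hf0
  obtain ⟨u, hu, hθ⟩ := exists_free_of_comp (T := τ.toKGr) (S := σ.toKGr) (S' := σ'.toKGr)
    (f := f) (f' := f') hf1.1 hf1.2 h1
  have huc : IsReducedCover u := hf0.of_comp τ.toJK_noIsolatedEdges σ.toJK_noIsolatedEdges hu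
    (hgf'.isReducedCover hg')
  obtain ⟨w, hw, hwu⟩ := exists_grafting u huc
  have e1 : g ≫ w = g' := by
    have hgw : CorrespondsToGrafting (g ≫ w) f' := hu ▸ hgf.comp hwu
    exact hgw.unique (hg.comp hw) hgf'
  have e2 : w ≫ c' = c ≫ 𝟙 ρ := by
    refine comp_eq_of_comm hc (isGrafting_id ρ) hc' hck (correspondsToGrafting_id ρ) hwu hck' ?_
    have h3 : k ≫ (free u : σ.toKGr ⟶ σ'.toKGr) = k' := by
      rw [← hθ]
      exact h2
    rw [h3]
    exact ((congrArg (· ≫ k') (free_id ρ.toKGr)).trans (Category.id_comp k')).symm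
  rw [Category.comp_id] at e2
  rw [← e1, ← e2, Category.assoc]

lemma isRealizedBy_id (τ : BMGraph) : IsRealizedBy (𝟙 τ) (𝟙 (Cosp.mk τ.toKGr)) := by
  refine ⟨τ, 𝟙 τ, 𝟙 τ, 𝟙 τ.toJK, 𝟙 τ.toKGr, ?_, isGeneric_id _, isGrafting_id τ,
    isCompression_id τ, Category.comp_id _, correspondsToGrafting_id τ,
    correspondsToCompression_id τ, Quotient.sound ⟨Iso.refl _, ?_, ?_⟩⟩
  · have := isRedCov_id τ.toKGr
    rwa [← free_id] at this
  · exact (Category.comp_id _).trans (free_id τ.toKGr).symm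
  · exact Category.comp_id _

/-- Every object of the restricted Kleisli category is isomorphic to the graph of a
Kontsevich–Manin graph. -/
lemma exists_toKGr_iso (R : KGr) : ∃ τ : BMGraph, Nonempty (R.gr ≅ τ.toKGr.gr) := by
  obtain ⟨τ, ⟨θ⟩⟩ := exists_toJK_iso R.gr R.ni
  exact ⟨τ, ⟨θ.symm⟩⟩

/-- Cospans between graphs of Kontsevich–Manin graphs come from graftings and compressions. -/
lemma exists_factorisation_of_cospan {τ ρ : BMGraph} {P : KGr} {l : τ.toKGr ⟶ P}
    {r : ρ.toKGr ⟶ P} (hl : IsRedCov l) (hr : IsGeneric r) :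
    ∃ (σ : BMGraph) (θ : P ≅ σ.toKGr) (g : τ ⟶ σ) (c : σ ⟶ ρ) (f : τ.toJK ⟶ σ.toJK),
      IsRedCov θ.hom ∧ IsGeneric (r ≫ θ.hom) ∧
      IsGrafting g ∧ IsCompression c ∧ CorrespondsToGrafting g f ∧
      CorrespondsToCompression c (r ≫ θ.hom) ∧ l ≫ θ.hom = (free f : τ.toKGr ⟶ σ.toKGr) := by
  obtain ⟨σ, ⟨θ⟩⟩ := exists_toKGr_iso P
  obtain ⟨f, hf, e⟩ := isRedCov_comp hl (isRedCov_freeIso (S := σ.toKGr) θ)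
  have hk := isGeneric_comp_freeIso (S' := σ.toKGr) hr θ
  obtain ⟨g, hg, hgf⟩ := exists_grafting f hf
  obtain ⟨c, hc, hck⟩ := exists_compression _ hk
  exact ⟨σ, freeIso θ, g, c, f, isRedCov_freeIso θ, hk, hg, hc, hgf, hck, e⟩

/-- The apex of a cospan need not be the graph of a Borisov–Manin object. Replacing it by an
isomorphic one does not change the class. -/
lemma exists_isRealizedBy_of_hom {τ ρ : BMGraph} (q : Cosp.mk τ.toKGr ⟶ Cosp.mk ρ.toKGr) :
    ∃ h : τ ⟶ ρ, IsRealizedBy h q := by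
  obtain ⟨d, rfl⟩ : ∃ d : RGCospan τ.toKGr ρ.toKGr, d.cls = q := Quotient.exists_rep q
  obtain ⟨σ, θ, g, c, f, hθ, hk, hg, hc, hgf, hck, e⟩ :=
    exists_factorisation_of_cospan d.left_mem d.right_mem
  have hf : IsRedCov (free f : τ.toKGr ⟶ σ.toKGr) := ⟨f, hgf.isReducedCover hg, rfl⟩
  exact ⟨g ≫ c, σ, g, c, f, _, hf, hk, hg, hc, rfl, hgf, hck, Quotient.sound ⟨θ, e, rfl⟩⟩

/-- The pushout square yields a grafting `a` and a compression `b` with `a ≫ b = c ≫ g'`. Hence `g ≫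
a` followed by `b ≫ c'` is a factorisation of the composite, and it corresponds to the outer legs of
the composed cospans. -/
lemma IsRealizedBy.comp {τ ρ υ : BMGraph} {h : τ ⟶ ρ} {h' : ρ ⟶ υ}
    {q : Cosp.mk τ.toKGr ⟶ Cosp.mk ρ.toKGr} {q' : Cosp.mk ρ.toKGr ⟶ Cosp.mk υ.toKGr}
    (hq : IsRealizedBy h q) (hq' : IsRealizedBy h' q') : IsRealizedBy (h ≫ h') (q ≫ q') := by
  obtain ⟨σ, g, c, f, k, hf, hk, hg, hc, rfl, hgf, hck, rfl⟩ := hq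
  obtain ⟨σ', g', c', f', k', hf', hk', hg', hc', rfl, hgf', hck', rfl⟩ := hq'
  obtain ⟨P, v, u, hP, hv, hu⟩ := exists_pushout _ k hf' hk
  obtain ⟨π, θ, a, b, m, hθ, hbk, ha, hb, ham, hbv, e⟩ := exists_factorisation_of_cospan hu hv
  have hm : IsRedCov (free m : σ.toKGr ⟶ π.toKGr) := ⟨m, ham.isReducedCover ha, rfl⟩
  -- The apex is moved along `θ` to the graph of `π`, and composition in `Cosp` may be computed with
  -- this pushout as well.
  have hP' : IsPushout k (free f' : ρ.toKGr ⟶ σ'.toKGr) (free m : σ.toKGr ⟶ π.toKGr)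
      (v ≫ θ.hom) := by
    refine IsPushout.of_iso hP.flip (Iso.refl _) (Iso.refl _) (Iso.refl _) θ ?_ ?_ ?_ ?_
    · simp
    · simp
    · simpa using e
    · simp
  have sq : a ≫ b = c ≫ g' := comp_eq_of_comm hc hg' hb hck hgf' ham hbv hP'.w
  have hcf : (free f : τ.toKGr ⟶ σ.toKGr) ≫ (free m : σ.toKGr ⟶ π.toKGr) = free (f ≫ m) :=
    free_comp _ _
  have hL : IsRedCov (free (f ≫ m) : τ.toKGr ⟶ π.toKGr) := by
    have := isRedCov_comp hf hm
    rwa [hcf] at this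
  refine ⟨π, g ≫ a, b ≫ c', f ≫ m, k' ≫ v ≫ θ.hom, hL, isGeneric_comp hk' hbk, hg.comp ha,
    hb.comp hc', ?_, hgf.comp ham, hbv.comp hck', ?_⟩
  · rw [Category.assoc, ← Category.assoc a, sq, Category.assoc, Category.assoc]
  · refine Quotient.sound (Setoid.trans (RGCospan.comp_eq _ _ hm hbk hP') ?_)
    exact ⟨Iso.refl _, (Category.comp_id _).trans hcf, Category.comp_id _⟩

/-! ### The equivalence -/

/-- The functor from the Borisov–Manin category to the category of cospans. -/
noncomputable def toCosp : BMGraph ⥤ Cosp where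
  obj τ := Cosp.mk τ.toKGr
  map h := (exists_isRealizedBy h).choose
  map_id τ := (exists_isRealizedBy (𝟙 τ)).choose_spec.unique (isRealizedBy_id τ)
  map_comp h h' := (exists_isRealizedBy (h ≫ h')).choose_spec.unique
    ((exists_isRealizedBy h).choose_spec.comp (exists_isRealizedBy h').choose_spec)

lemma isRealizedBy_toCosp {τ ρ : BMGraph} (h : τ ⟶ ρ) : IsRealizedBy h (toCosp.map h) :=
  (exists_isRealizedBy h).choose_spec

instance : toCosp.Faithful where
  map_injective {_ _ h h'} e := by
    have := isRealizedBy_toCosp h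
    rw [e] at this
    exact this.injective (isRealizedBy_toCosp h')

instance : toCosp.Full where
  map_surjective q := by
    obtain ⟨h, hq⟩ := exists_isRealizedBy_of_hom q
    exact ⟨h, (isRealizedBy_toCosp h).unique hq⟩

end BMGraph

/-! ### Isomorphisms of graphs as isomorphisms of cospans -/

namespace Cosp

/-- The morphism in the category of cospans given by an isomorphism of graphs. -/
noncomputable def ofIso {R S : KGr} (θ : R.gr ≅ S.gr) : Cosp.mk R ⟶ Cosp.mk S :=
  ofCospan ⟨S, (freeIso θ).hom, 𝟙 S, isRedCov_freeIso θ, isGeneric_id S⟩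

lemma ofIso_comp_ofIso {R S : KGr} (θ : R.gr ≅ S.gr) : ofIso θ ≫ ofIso θ.symm = 𝟙 _ := by
  -- The second legs are identities, so the pushout is along an identity and composition is that of
  -- the first legs.
  refine Quotient.sound (Setoid.trans (RGCospan.comp_eq _ _ (isRedCov_freeIso θ.symm)
    (isGeneric_id R) IsPushout.of_id_fst) ?_)
  refine ⟨Iso.refl _, ?_, ?_⟩
  · exact (Category.comp_id _).trans (freeIso θ).hom_inv_id
  · exact (Category.comp_id _).trans (Category.comp_id _)

/-- Isomorphic graphs are isomorphic in the category of cospans. -/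
noncomputable def isoOfIso {R S : KGr} (θ : R.gr ≅ S.gr) : Cosp.mk R ≅ Cosp.mk S where
  hom := ofIso θ
  inv := ofIso θ.symm
  hom_inv_id := ofIso_comp_ofIso θ
  inv_hom_id := ofIso_comp_ofIso θ.symm

end Cosp

instance : BMGraph.toCosp.EssSurj where
  mem_essImage R := by
    obtain ⟨τ, ⟨θ⟩⟩ := BMGraph.exists_toKGr_iso R.of
    exact ⟨τ, ⟨(Cosp.isoOfIso θ).symm⟩⟩

instance : BMGraph.toCosp.IsEquivalence where

end

/-! ### The equivalence, and its values on arbitrary factorisations -/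

theorem theorem5 :
    ∃ (Φ : BMGraph ⥤ Cosp) (hΦ : ∀ τ : BMGraph, Φ.obj τ = Cosp.mk τ.toKGr),
      Φ.IsEquivalence ∧
      ∀ (τ ρ : BMGraph) (h : τ ⟶ ρ),
        (∃ (σ : BMGraph) (g : τ ⟶ σ) (c : σ ⟶ ρ),
          BMGraph.IsGrafting g ∧ BMGraph.IsCompression c ∧ g ≫ c = h) ∧
        ∀ (σ : BMGraph) (g : τ ⟶ σ) (c : σ ⟶ ρ),
          BMGraph.IsGrafting g → BMGraph.IsCompression c → g ≫ c = h →
          ∃ (f : τ.toJK ⟶ σ.toJK) (k : ρ.toKGr ⟶ σ.toKGr)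
            (hf : KGr.IsRedCov (KGr.free f : τ.toKGr ⟶ σ.toKGr)) (hk : KGr.IsGeneric k),
            BMGraph.CorrespondsToGrafting g f ∧ BMGraph.CorrespondsToCompression c k ∧
            Φ.map h = eqToHom (hΦ τ) ≫
              Cosp.ofCospan ⟨σ.toKGr, KGr.free f, k, hf, hk⟩ ≫ eqToHom (hΦ ρ).symm := by
  refine ⟨BMGraph.toCosp, fun _ => rfl, inferInstance, fun τ ρ h =>
    ⟨BMGraph.exists_factorisation h, ?_⟩⟩
  rintro σ g c hg hc rfl
  obtain ⟨f, k, hf, hk, hgf, hck, hr⟩ := BMGraph.exists_cospan_of_factorisation hg hc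
  -- The functor was defined with a chosen cospan for each morphism. As a morphism realises only one
  -- class, the given factorisation yields the same value.
  refine ⟨f, k, hf, hk, hgf, hck, ((BMGraph.isRealizedBy_toCosp _).unique hr).trans ?_⟩
  -- The functor has the stated values on objects by definition, so both `eqToHom` are identities.
  exact ((Category.id_comp _).trans (Category.comp_id _)).symm
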